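/- Let $N$ be a ground set with $|N|=n$, let $f:2^N\to\mathbb R_{\ge 0}$ be a non-negative submodular function (not necessarily monotone), and let $O^*\in\arg\max_{S\subseteq N} f(S)$. The function is accessed only through a persistent noisy value oracle $\tilde f(S)=\xi_S f(S)$, where the multipliers $\xi_S$ ($S\subseteq N$) are independent and follow a common distribution $\mathcal D$ on $[0,\infty)$ with mean $1$ that is sub-exponential with parameters $(\nu,\alpha)$, $\nu>0$, $\alpha\ge 0$, i.e. $\mathbb E_{\xi\sim\mathcal D}[e^{\lambda(\xi-1)}]\le e^{\nu^2\lambda^2/2}$ whenever $\alpha|\lambda|\le 1$. Fix $\varepsilon>0$ with $\varepsilon<2\nu^2/\alpha$ (read as $\infty$ if $\alpha=0$). Consider the following algorithm, with parameters $m=\lceil \max\{2,8\nu^2\}\frac{n^2}{\varepsilon^2}(n+\lceil\log_2(4n)\rceil)\rceil$, $t=\lceil\log_2(4m)\rceil$, $h=t^2$ (for $n=0$ all three are $0$). If $h>n$, return $\emptyset$. Otherwise: 1. Draw a uniformly random subset $H\subseteq N$ of size $h$, and draw $m$ distinct subsets $H_1,\dots,H_m$ of $H$ of size $t$ uniformly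 at random without replacement. Let $\hat F(S)=\frac1m\sum_{i=1}^m\tilde f(S\cup H_i)$. 2. Run double greedy on the ground set $N\setminus H$ with oracle $\hat F$: start with $X=\emptyset$, $Y=N\setminus H$ and process the elements $u$ of $N\setminus H$ one after another; put $a=\hat F(X\cup\{u\})-\hat F(X)$, $b=\hat F(Y\setminus\{u\})-\hat F(Y)$, and with probability $p$ add $u$ to $X$, otherwise remove $u$ from $Y$, where $p=\frac{a}{a+b}$ if $a,b>0$, $p=1$ if $a>0\ge b$, and $p=0$ if $a\le 0$. Let $S_H$ be the final set $X$. 3. Draw a fresh uniformly random subset $H'\subseteq H$ of size $t$ and return $\mathrm{ALG}=S_H\cup H'$. Then the following holds. (a) There is an absolute constant $c>0$, and for every $\nu>0$ a constant $C>0$ depending only on $\nu$, such that for all $\alpha,\varepsilon,\mathcal D,n,f$ as above with $n\ge \frac{C}{\varepsilon}\log^2\frac n\varepsilon$ we have $$\mathbb E[f(\mathrm{ALG})]\ \ge\ \Big(\frac12-c\,\varepsilon\Big)f(O^*),$$ where the expectation is over the noise and over the random choices of the algorithm. (b) The algorithm runs in polynomial time: there is a single program for a randomized real random-access machine with a value oracle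 (exact real arithmetic, one step per elementary instruction, coin flip or oracle query) that, on input $(n,\varepsilon,\nu)$ and for every oracle, produces an output with exactly the distribution of the algorithm's output, and always halts after a number of steps bounded by a fixed polynomial in $n$, $1/\varepsilon$ and $\nu$. -/

import Mathlib

open MeasureTheory ProbabilityTheory

noncomputable section

namespace NoisySubmodular

/-! ### Set functions and noise -/

/-- Diminishing marginal values. -/
def Submodular {N : Type*} [DecidableEq N] (f : Finset N → ℝ) : Prop :=
  ∀ A B : Finset N, A ⊆ B → ∀ x, x ∉ B → f (insert x B) - f B ≤ f (insert x A) - f A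

/-- `D` is sub-exponential with parameters `(ν, α)`: the centred moment generating function at `l`
is finite and at most `exp (ν² l² / 2)` whenever `|l| ≤ 1 / α` (every `l` when `α = 0`). -/
def SubExponential (D : Measure ℝ) (ν α : ℝ) : Prop :=
  ∀ l : ℝ, α * |l| ≤ 1 →
    Integrable (fun x => Real.exp (l * (x - ∫ y, y ∂D))) D ∧
      ∫ x, Real.exp (l * (x - ∫ y, y ∂D)) ∂D ≤ Real.exp (ν ^ 2 * l ^ 2 / 2)

/-- An admissible distribution of the noise multipliers: a probability distribution on the
non-negative reals with mean one, sub-exponential with parameters `(ν, α)`. -/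
structure IsNoise (D : Measure ℝ) (ν α : ℝ) : Prop where
  prob : IsProbabilityMeasure D
  nonneg : ∀ᵐ x ∂D, 0 ≤ x
  mean : ∫ x, x ∂D = 1
  subExp : SubExponential D ν α

/-- The (persistent) noisy value oracle with noise multipliers `z`. -/
def noisy {N : Type*} (f z : Finset N → ℝ) : Finset N → ℝ := fun S => z S * f S

/-! ### The randomized algorithm -/

/-- A coin showing `true` with probability `p`, where `p` is clipped to `[0, 1]`. -/
def coin (p : ℝ) : PMF Bool :=
  PMF.ofFintype
    (fun b => if b then ENNReal.ofReal (max 0 (min p 1))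
      else ENNReal.ofReal (1 - max 0 (min p 1))) (by
    have h0 : 0 ≤ max 0 (min p 1) := le_max_left _ _
    have h1 : max 0 (min p 1) ≤ 1 := max_le zero_le_one (min_le_right _ _)
    rw [Fintype.sum_bool]
    simp only [if_true, Bool.false_eq_true, if_false]
    rw [← ENNReal.ofReal_add h0 (sub_nonneg.2 h1), add_sub_cancel, ENNReal.ofReal_one])

/-- A uniformly random element of `s` (a default value if `s` is empty). -/
def uniform {β : Type*} [Inhabited β] (s : Finset β) : PMF β :=
  if h : s.Nonempty then PMF.uniformOfFinset s h else PMF.pure default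

/-- The probability with which double greedy accepts an element, from the (approximate) marginal
value `a` of adding it and the (approximate) marginal value `b` of removing it. -/
def acceptProb (a b : ℝ) : ℝ :=
  if 0 < a ∧ 0 < b then a / (a + b) else if 0 < a then 1 else 0

/-- Double greedy with value oracle `F`, processing the elements of the list in order,
from the current pair of sets `X ⊆ Y`. -/
def doubleGreedyFrom {N : Type*} [DecidableEq N] (F : Finset N → ℝ) :
    List N → Finset N → Finset N → PMF (Finset N)
  | [], X, _ => PMF.pure X
  | u :: l, X, Y =>
    (coin (acceptProb (F (insert u X) - F X) (F (Y.erase u) - F Y))).bind fun b =>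
      if b then doubleGreedyFrom F l (insert u X) Y else doubleGreedyFrom F l X (Y.erase u)

/-- Double greedy with value oracle `F` on the ground set `G`. -/
def doubleGreedy {n : ℕ} (F : Finset (Fin n) → ℝ) (G : Finset (Fin n)) : PMF (Finset (Fin n)) :=
  doubleGreedyFrom F (G.sort (· ≤ ·)) ∅ G

/-- The sampled noisy surrogate function: the average of `g (S ∪ H')` over `H'` in `T`. -/
def surrogate {n : ℕ} (g : Finset (Fin n) → ℝ) (T : Finset (Finset (Fin n)))
    (S : Finset (Fin n)) : ℝ :=
  (∑ H' ∈ T, g (S ∪ H')) / (T.card : ℝ)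

/-- The meta-algorithm with parameters `h, t, m` for the unconstrained problem on `Fin n`, given
access to the oracle `g`. The argument `A` is the maximization algorithm that is used as a
subroutine; it receives a value oracle and a ground set.
* `H` is a uniformly random subset of size `h` of the whole ground set;
* `T` consists of `m` subsets of `H` of size `t`, sampled without replacement;
* `A` is run on the complement of `H` with the surrogate function as oracle, and returns `S`;
* `H'` is a fresh uniformly random subset of `H` of size `t`, and `S ∪ H'` is returned.
If no subset of size `h` exists, the empty set is returned. -/
def metaAlgorithm {n : ℕ}
    (A : (Finset (Fin n) → ℝ) → Finset (Fin n) → PMF (Finset (Fin n)))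
    (h t m : ℕ) (g : Finset (Fin n) → ℝ) : PMF (Finset (Fin n)) :=
  if h ≤ n then
    (uniform (Finset.powersetCard h Finset.univ)).bind fun H =>
      (uniform (Finset.powersetCard m (Finset.powersetCard t H))).bind fun T =>
        (A (surrogate g T) (Finset.univ \ H)).bind fun S =>
          (uniform (Finset.powersetCard t H)).bind fun H' =>
            PMF.pure (S ∪ H')
  else PMF.pure ∅

/-- The number `m` of samples; it is at least `max {2, 8 ν²} (n / ε)² (n + log (4 n))`. -/
def paramM (n : ℕ) (ν ε : ℝ) : ℕ :=
  ⌈max 2 (8 * ν ^ 2) * ((n : ℝ) / ε) ^ 2 * ((n : ℝ) + (Nat.clog 2 (4 * n) : ℝ))⌉₊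

/-- The size `t = ⌈log₂ (4 m)⌉` of the sampled sets. -/
def paramT (n : ℕ) (ν ε : ℝ) : ℕ := Nat.clog 2 (4 * paramM n ν ε)

/-- The size `h = t²` of the smoothing set. -/
def paramH (n : ℕ) (ν ε : ℝ) : ℕ := paramT n ν ε ^ 2

/-- The meta-algorithm instantiated with double greedy. -/
def noisyDoubleGreedy (n : ℕ) (ν ε : ℝ) (g : Finset (Fin n) → ℝ) : PMF (Finset (Fin n)) :=
  metaAlgorithm doubleGreedy (paramH n ν ε) (paramT n ν ε) (paramM n ν ε) g

/-- The expected value of `f` on a random set with distribution `μ`. -/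
def expect {n : ℕ} (μ : PMF (Finset (Fin n))) (f : Finset (Fin n) → ℝ) : ℝ :=
  ∑ S, (μ S).toReal * f S

/-! ### A randomized real random-access machine with a value oracle

Programs are finite texts that do not depend on the size of the instance. They work on three
memories with indirect addressing: natural numbers (addition and truncated subtraction only), real
numbers (field operations), and finite sets of natural numbers (operations charged per element).
Loops are bounded, with the bound evaluated on entry. -/

/-- A memory configuration, with the number of steps made so far. -/
structure State where
  nat : ℕ → ℕ
  real : ℕ → ℝ
  set : ℕ → Finset ℕ
  steps : ℕ

/-- Expressions with natural-number values. -/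
inductive NatExpr
  | lit (k : ℕ)
  | get (addr : NatExpr)
  | add (a b : NatExpr)
  | sub (a b : NatExpr)

/-- Expressions with real values. -/
inductive RealExpr
  | lit (k : ℕ)
  | get (addr : NatExpr)
  | ofNat (a : NatExpr)
  | add (a b : RealExpr)
  | sub (a b : RealExpr)
  | mul (a b : RealExpr)
  | div (a b : RealExpr)

/-- Tests. -/
inductive Test
  | natLt (a b : NatExpr)
  | realLt (a b : RealExpr)
  | mem (e k : NatExpr)

/-- Programs. -/
inductive Program
  /-- `nat[dst] := e` -/
  | setNat (dst e : NatExpr)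
  /-- `real[dst] := e` -/
  | setReal (dst : NatExpr) (e : RealExpr)
  /-- `nat[dst] := ⌈e⌉`, computed by counting -/
  | ceil (dst : NatExpr) (e : RealExpr)
  /-- insert the number `e` into `set[k]` -/
  | insert (k e : NatExpr)
  /-- remove the number `e` from `set[k]` -/
  | erase (k e : NatExpr)
  /-- `set[k] := set[a] ∪ set[b]`, copied element by element -/
  | union (k a b : NatExpr)
  /-- `real[dst] :=` the oracle's answer to the query `set[k]` -/
  | query (dst k : NatExpr)
  /-- `nat[dst] := 1` with probability `p`, and `nat[dst] := 0` otherwise -/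
  | flip (dst : NatExpr) (p : RealExpr)
  | seq (c d : Program)
  | ite (b : Test) (c d : Program)
  /-- repeat `c` as often as the value of `e` on entry says -/
  | loop (e : NatExpr) (c : Program)

def NatExpr.eval (s : State) : NatExpr → ℕ
  | lit k => k
  | get a => s.nat (a.eval s)
  | add a b => a.eval s + b.eval s
  | sub a b => a.eval s - b.eval s

def RealExpr.eval (s : State) : RealExpr → ℝ
  | lit k => k
  | get a => s.real (a.eval s)
  | ofNat a => (a.eval s : ℝ)
  | add a b => a.eval s + b.eval s
  | sub a b => a.eval s - b.eval s
  | mul a b => a.eval s * b.eval s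
  | div a b => a.eval s / b.eval s

def Test.eval (s : State) : Test → Prop
  | natLt a b => a.eval s < b.eval s
  | realLt a b => a.eval s < b.eval s
  | mem e k => e.eval s ∈ s.set (k.eval s)

/-- Charge `k` steps. -/
def State.tick (s : State) (k : ℕ) : State := { s with steps := s.steps + k }

/-- The subset of the ground set `Fin n` stored in the set register `k`. -/
def State.subset (n : ℕ) (s : State) (k : ℕ) : Finset (Fin n) :=
  Finset.univ.filter fun i => (i : ℕ) ∈ s.set k

/-- `k` successive runs of a random transition. -/
def iterate (F : State → PMF State) : ℕ → State → PMF State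
  | 0, s => PMF.pure s
  | k + 1, s => (F s).bind (iterate F k)

open Classical in
/-- The distribution of the final state. Every instruction, every test and every pass through a loop
costs one step, except that taking a ceiling costs its value and taking a union costs the
number of elements that are copied. -/
def Program.run {n : ℕ} (g : Finset (Fin n) → ℝ) : Program → State → PMF State
  | setNat dst e, s =>
    PMF.pure { s.tick 1 with nat := Function.update s.nat (dst.eval s) (e.eval s) }
  | setReal dst e, s =>
    PMF.pure { s.tick 1 with real := Function.update s.real (dst.eval s) (e.eval s) }
  | ceil dst e, s =>
    PMF.pure { s.tick (1 + ⌈e.eval s⌉₊) with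
      nat := Function.update s.nat (dst.eval s) ⌈e.eval s⌉₊ }
  | insert k e, s =>
    PMF.pure { s.tick 1 with
      set := Function.update s.set (k.eval s) (Insert.insert (e.eval s) (s.set (k.eval s))) }
  | erase k e, s =>
    PMF.pure { s.tick 1 with
      set := Function.update s.set (k.eval s) ((s.set (k.eval s)).erase (e.eval s)) }
  | union k a b, s =>
    PMF.pure { s.tick (1 + (s.set (a.eval s)).card + (s.set (b.eval s)).card) with
      set := Function.update s.set (k.eval s) (s.set (a.eval s) ∪ s.set (b.eval s)) }
  | query dst k, s =>
    PMF.pure { s.tick 1 with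
      real := Function.update s.real (dst.eval s) (g (s.subset n (k.eval s))) }
  | flip dst p, s =>
    (coin (p.eval s)).map fun b =>
      { s.tick 1 with nat := Function.update s.nat (dst.eval s) (if b then 1 else 0) }
  | seq c d, s => (c.run g s).bind (d.run g)
  | ite b c d, s => if b.eval s then c.run g (s.tick 1) else d.run g (s.tick 1)
  | loop e c, s => iterate (fun s' => c.run g (s'.tick 1)) (e.eval s) (s.tick 1)

/-- The initial state: the input `n`, `ε`, `ν` is stored in the first registers. -/
def State.init (n : ℕ) (ν ε : ℝ) : State where
  nat := fun i => if i = 0 then n else 0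
  real := fun i => if i = 0 then ε else if i = 1 then ν else 0
  set := fun _ => ∅
  steps := 0

/-- The program computes the randomized oracle algorithm `alg`, its output being the subset of the
ground set that is stored in the set register `0` at the end. -/
def Computes (P : Program)
    (alg : (n : ℕ) → (ν ε : ℝ) → (Finset (Fin n) → ℝ) → PMF (Finset (Fin n))) : Prop :=
  ∀ (n : ℕ) (ν ε : ℝ), 0 < ν → 0 < ε → ∀ g : Finset (Fin n) → ℝ,
    (P.run g (State.init n ν ε)).map (fun s => s.subset n 0) = alg n ν ε g

/-- Every run of the program, whatever the answers of the oracle and the outcomes of the coins, makes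
a number of steps polynomial in `n`, `1 / ε` and `ν`. -/
def RunsInPolyTime (P : Program) : Prop :=
  ∃ k : ℕ, ∃ c : ℝ, ∀ (n : ℕ) (ν ε : ℝ), 0 < ν → 0 < ε → ∀ g : Finset (Fin n) → ℝ,
    ∀ s ∈ (P.run g (State.init n ν ε)).support,
      (s.steps : ℝ) ≤ c * ((n : ℝ) + 1 / ε + ν + 1) ^ k

end NoisySubmodular

end

set_option linter.unusedSimpArgs false
set_option linter.flexible false

noncomputable section

namespace NoisySubmodular

/-! Approximation. Write F_H(S) for the average of f(S ∪ H') over all t-subsets H' of H. It is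
non-negative and submodular, and because H' is fresh, the value of the output given H is the mean of
F_H(S_H). Three facts are combined. (1) Smoothing is cheap (`mean_smoothing_ge`): the mean of F_H(O*
\ H) over H is at least (1 - h/n) f(O*). Adding H' to O* and removing H \ H' from it each cost at
most the inclusion probability of an element, namely t/n and (h-t)/n, by comparison with a modular
minorant (`Submodular.mean_ge`). One use of diminishing returns merges the two changes. (2) Double
greedy is robust (`two_mul_mean_doubleGreedy_ge`): with an oracle within η of F on every subset of
the ground set, twice the mean value is at least F(O) - 3ηn. The usual potential argument loses 3η
per element. (3) The noisy oracle is uniformly close to F_H with M = f(O*) as scale. Sampling m of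
the t-subsets costs (ε/n)M (`mean_sample_abs_le`) and the noise costs (ε/2n)M (`noise_abs_le`). For
S disjoint from H the sets S ∪ H_i are distinct, so their multipliers are independent and a Chernoff
bound applies. The halved tolerance makes ε < 2ν²/α exactly what the exponential moment needs. The
factors 2 and 8ν² in m make each exponent at least n + log₂(4n), so a union bound over at most 2^n
sets leaves a failure term of order 1/n, hence of order ε. Sampling without replacement is treated
directly: the mean of a product over the sample is at most (∑y)^m divided by the falling factorial
of the population size K, which is at least K^m/2 once K ≥ 2m². The choice h = t², t = ⌈log₂ 4m⌉
makes K = C(h,t) large enough. The hypothesis on n gives h ≤ εn and 1 ≤ εn; in total twice the mean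
is at least (1 - 7ε) f(O*).

Running time. The family of t-subsets may be too large to list, so distinct subsets must be drawn
without enumerating them. The program walks through the ground set and decides each element by a
coin with the exact conditional probability. The number of admissible sets with a given prefix is a
binomial coefficient minus the number of already drawn sets with that prefix; both are updated as
the walk proceeds (`SampleInv`, `sampleStepProg_coupled`). Correctness and cost are proved together:
the output distribution of the algorithm is coupled with the distribution of the final state, the
relation saying both that the memory holds the output and that few steps were made
(`mainProg_coupled`). Equality of distributions and the bound for every run are read off from this
one coupling. -/

/-! ### Couplings of distributions -/

/-- `p` and `q` have a coupling that is supported in the relation `R`. -/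
def Coupled {β σ : Type*} (p : PMF β) (q : PMF σ) (R : β → σ → Prop) : Prop :=
  ∃ j : PMF (β × σ), j.map Prod.fst = p ∧ j.map Prod.snd = q ∧ ∀ x ∈ j.support, R x.1 x.2

namespace Coupled

variable {β γ σ τ : Type*}

theorem mono {p : PMF β} {q : PMF σ} {R R' : β → σ → Prop} (h : Coupled p q R)
    (hR : ∀ b s, R b s → R' b s) : Coupled p q R' := by
  obtain ⟨j, h1, h2, h3⟩ := h
  exact ⟨j, h1, h2, fun x hx => hR _ _ (h3 x hx)⟩

theorem exists_prod (p : PMF β) (q : PMF σ) :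
    ∃ j : PMF (β × σ), j.map Prod.fst = p ∧ j.map Prod.snd = q := by
  refine ⟨p.bind fun b => q.map fun s => (b, s), ?_, ?_⟩
  · simp only [PMF.map_bind, PMF.map_comp]
    exact (congrArg p.bind (funext fun b => PMF.map_const q b)).trans (PMF.bind_pure p)
  · simp only [PMF.map_bind, PMF.map_comp, Function.comp_def, PMF.bind_const]
    exact PMF.map_id q

/-- Gluing of couplings: draw from the first coupling, then from the coupling of the two
continuations. This lets program and algorithm be compared one random choice at a time. -/
theorem bind {p : PMF β} {q : PMF σ} {R : β → σ → Prop} {p' : β → PMF γ} {q' : σ → PMF τ}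
    {R' : γ → τ → Prop} (h : Coupled p q R) (h' : ∀ b s, R b s → Coupled (p' b) (q' s) R') :
    Coupled (p.bind p') (q.bind q') R' := by
  classical
  obtain ⟨j, rfl, rfl, h3⟩ := h
  have key : ∀ x : β × σ, ∃ k : PMF (γ × τ), k.map Prod.fst = p' x.1 ∧ k.map Prod.snd = q' x.2 ∧
      (R x.1 x.2 → ∀ y ∈ k.support, R' y.1 y.2) := by
    intro x
    by_cases hx : R x.1 x.2
    · obtain ⟨k, k1, k2, k3⟩ := h' _ _ hx
      exact ⟨k, k1, k2, fun _ => k3⟩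
    -- Pairs outside `R` are never drawn, but the joint continuation must be total with the right
    -- marginals; the independent coupling serves.
    · obtain ⟨k, k1, k2⟩ := exists_prod (p' x.1) (q' x.2)
      exact ⟨k, k1, k2, fun hh => absurd hh hx⟩
  choose k k1 k2 k3 using key
  refine ⟨j.bind k, ?_, ?_, ?_⟩
  · simp only [PMF.map_bind, k1, PMF.bind_map, Function.comp_def]
  · simp only [PMF.map_bind, k2, PMF.bind_map, Function.comp_def]
  · intro y hy
    rw [PMF.mem_support_bind_iff] at hy
    obtain ⟨x, hx, hy⟩ := hy
    exact k3 x (h3 x hx) y hy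

theorem of_support {b : β} {q : PMF σ} {R : β → σ → Prop} (h : ∀ s ∈ q.support, R b s) :
    Coupled (PMF.pure b) q R := by
  refine ⟨q.map fun s => (b, s), ?_, ?_, ?_⟩
  · rw [PMF.map_comp]
    exact PMF.map_const q b
  · simp only [PMF.map_comp, Function.comp_def]
    exact PMF.map_id q
  · intro x hx
    rw [PMF.mem_support_map_iff] at hx
    obtain ⟨s, hs, rfl⟩ := hx
    exact h s hs

/-- Used where the program computes and the algorithm makes no random choice: only the set of
reachable states matters. -/
theorem support_bind {p : PMF γ} {q : PMF σ} {F : σ → PMF τ} {R : γ → τ → Prop}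
    (h : ∀ s ∈ q.support, Coupled p (F s) R) : Coupled p (q.bind F) R := by
  have h1 : Coupled (PMF.pure ()) q fun _ s => s ∈ q.support := of_support fun s hs => hs
  simpa using h1.bind (p' := fun _ => p) fun _ s hs => h s hs

theorem map_right (p : PMF β) (φ : β → σ) : Coupled p (p.map φ) fun b s => s = φ b := by
  refine ⟨p.map fun b => (b, φ b), ?_, ?_, ?_⟩
  · simp only [PMF.map_comp, Function.comp_def]
    exact PMF.map_id p
  · simp [PMF.map_comp, Function.comp_def]
  · intro x hx
    rw [PMF.mem_support_map_iff] at hx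
    obtain ⟨s, _, rfl⟩ := hx
    rfl

/-- Turns a coupling whose relation determines the output into equality of distributions. -/
theorem map_eq {p : PMF β} {q : PMF σ} {R : β → σ → Prop} (h : Coupled p q R) (φ : σ → β)
    (hR : ∀ b s, R b s → φ s = b) : q.map φ = p := by
  obtain ⟨j, rfl, rfl, h3⟩ := h
  rw [PMF.map_comp]
  simp only [PMF.map]
  refine PMF.ext fun b => ?_
  simp only [PMF.bind_apply]
  refine tsum_congr fun x => ?_
  by_cases hx : x ∈ j.support
  · simp [hR _ _ (h3 x hx)]
  · simp [(PMF.apply_eq_zero_iff _ _).2 hx]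

theorem of_mem_support {p : PMF β} {q : PMF σ} {R : β → σ → Prop} (h : Coupled p q R) {s : σ}
    (hs : s ∈ q.support) : ∃ b ∈ p.support, R b s := by
  obtain ⟨j, rfl, rfl, h3⟩ := h
  rw [PMF.mem_support_map_iff] at hs
  obtain ⟨x, hx, rfl⟩ := hs
  exact ⟨x.1, (PMF.mem_support_map_iff _ _ _).2 ⟨x, hx, rfl⟩, h3 x hx⟩

/-- Records that the outcome had positive probability; the sampler needs this to exclude branches
with no admissible completion. -/
theorem and_mem_support {p : PMF β} {q : PMF σ} {R : β → σ → Prop} (h : Coupled p q R) :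
    Coupled p q fun b s => R b s ∧ b ∈ p.support := by
  obtain ⟨j, rfl, rfl, h3⟩ := h
  exact ⟨j, rfl, rfl, fun x hx => ⟨h3 x hx, (PMF.mem_support_map_iff _ _ _).2 ⟨x, hx, rfl⟩⟩⟩

end Coupled

/-! ### Reasoning about programs -/

/-- Every final state of the program satisfies `Q`. -/
def Program.Ensures {n : ℕ} (g : Finset (Fin n) → ℝ) (c : Program) (s : State)
    (Q : State → Prop) : Prop := ∀ s' ∈ (c.run g s).support, Q s'

section rules
variable {n : ℕ} {g : Finset (Fin n) → ℝ} {s : State} {Q Q' : State → Prop}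

theorem Program.Ensures.mono {c : Program} (h : c.Ensures g s Q) (hQ : ∀ s', Q s' → Q' s') :
    c.Ensures g s Q' := fun s' hs => hQ s' (h s' hs)

theorem ensures_setNat {dst e : NatExpr} :
    (Program.setNat dst e).Ensures g s Q ↔
      Q { s.tick 1 with nat := Function.update s.nat (dst.eval s) (e.eval s) } := by
  simp [Program.Ensures, Program.run]

theorem ensures_setReal {dst : NatExpr} {e : RealExpr} :
    (Program.setReal dst e).Ensures g s Q ↔
      Q { s.tick 1 with real := Function.update s.real (dst.eval s) (e.eval s) } := by
  simp [Program.Ensures, Program.run]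

theorem ensures_ceil {dst : NatExpr} {e : RealExpr} :
    (Program.ceil dst e).Ensures g s Q ↔
      Q { s.tick (1 + ⌈e.eval s⌉₊) with
        nat := Function.update s.nat (dst.eval s) ⌈e.eval s⌉₊ } := by
  simp [Program.Ensures, Program.run]

theorem ensures_insert {k e : NatExpr} :
    (Program.insert k e).Ensures g s Q ↔
      Q { s.tick 1 with
        set := Function.update s.set (k.eval s) (insert (e.eval s) (s.set (k.eval s))) } := by
  simp [Program.Ensures, Program.run]

theorem ensures_erase {k e : NatExpr} :
    (Program.erase k e).Ensures g s Q ↔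
      Q { s.tick 1 with
        set := Function.update s.set (k.eval s) ((s.set (k.eval s)).erase (e.eval s)) } := by
  simp [Program.Ensures, Program.run]

theorem ensures_union {k a b : NatExpr} :
    (Program.union k a b).Ensures g s Q ↔
      Q { s.tick (1 + (s.set (a.eval s)).card + (s.set (b.eval s)).card) with
        set := Function.update s.set (k.eval s) (s.set (a.eval s) ∪ s.set (b.eval s)) } := by
  simp [Program.Ensures, Program.run]

theorem ensures_query {dst k : NatExpr} :
    (Program.query dst k).Ensures g s Q ↔
      Q { s.tick 1 with
        real := Function.update s.real (dst.eval s) (g (s.subset n (k.eval s))) } := by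
  simp [Program.Ensures, Program.run]

theorem ensures_seq {c d : Program} :
    (Program.seq c d).Ensures g s Q ↔ c.Ensures g s fun s' => d.Ensures g s' Q := by
  simp only [Program.Ensures, Program.run, PMF.mem_support_bind_iff]
  exact ⟨fun h s' hs' s'' hs'' => h s'' ⟨s', hs', hs''⟩, fun h s'' ⟨s', hs', hs''⟩ => h s' hs' s'' hs''⟩

theorem ensures_ite {b : Test} {c d : Program} :
    (Program.ite b c d).Ensures g s Q ↔
      (b.eval s → c.Ensures g (s.tick 1) Q) ∧ (¬ b.eval s → d.Ensures g (s.tick 1) Q) := by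
  simp only [Program.Ensures, Program.run]
  by_cases h : b.eval s <;> simp [h]

theorem iterate_succ' (F : State → PMF State) (k : ℕ) (s : State) :
    iterate F (k + 1) s = (iterate F k s).bind F := by
  induction k generalizing s with
  | zero => simp [iterate]
  | succ k ih =>
    change (F s).bind (iterate F (k + 1)) = ((F s).bind (iterate F k)).bind F
    rw [PMF.bind_bind]
    exact congrArg (F s).bind (funext ih)

/-- The number of passes is fixed on entry, so an invariant indexed by the number of completed
passes suffices and no termination argument is needed. -/
theorem ensures_loop {e : NatExpr} {c : Program} (I : ℕ → State → Prop)
    (h0 : I 0 (s.tick 1))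
    (hs : ∀ i < e.eval s, ∀ s', I i s' → c.Ensures g (s'.tick 1) (I (i + 1))) :
    (Program.loop e c).Ensures g s (I (e.eval s)) := by
  have key : ∀ k ≤ e.eval s, ∀ s' ∈
      (iterate (fun s' => c.run g (s'.tick 1)) k (s.tick 1)).support, I k s' := by
    intro k
    induction k with
    | zero =>
      intro _ s' hs'
      simp only [iterate, PMF.support_pure, Set.mem_singleton_iff] at hs'
      exact hs' ▸ h0
    | succ k ih =>
      intro hk s' hs'
      rw [iterate_succ', PMF.mem_support_bind_iff] at hs'
      obtain ⟨s₁, h1, h2⟩ := hs'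
      exact hs k hk s₁ (ih (by omega) s₁ h1) s' h2
  exact key _ le_rfl

theorem Program.Ensures.loop {e : NatExpr} {c : Program} (k : ℕ) (I : ℕ → State → Prop)
    (hk : e.eval s = k) (h0 : I 0 (s.tick 1))
    (hs : ∀ i < k, ∀ s', I i s' → c.Ensures g (s'.tick 1) (I (i + 1)))
    (hQ : ∀ s', I k s' → Q s') :
    (Program.loop e c).Ensures g s Q := by
  subst hk
  exact (ensures_loop I h0 hs).mono hQ

variable {β γ : Type*} {R : β → State → Prop}

theorem Coupled.seq_det {c d : Program} {p : PMF β}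
    (h : c.Ensures g s fun s' => Coupled p (d.run g s') R) :
    Coupled p ((Program.seq c d).run g s) R := by
  rw [Program.run]
  exact Coupled.support_bind h

theorem Coupled.of_ensures {c : Program} {b : β} (h : c.Ensures g s (R b)) :
    Coupled (PMF.pure b) (c.run g s) R := Coupled.of_support h

theorem Coupled.ite {b : Test} {c d : Program} {p : PMF β}
    (h1 : b.eval s → Coupled p (c.run g (s.tick 1)) R)
    (h2 : ¬ b.eval s → Coupled p (d.run g (s.tick 1)) R) :
    Coupled p ((Program.ite b c d).run g s) R := by
  simp only [Program.run]
  by_cases h : b.eval s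
  · simpa [h] using h1 h
  · simpa [h] using h2 h

theorem Coupled.flip (dst : NatExpr) (p : RealExpr) :
    Coupled (coin (p.eval s)) ((Program.flip dst p).run g s) fun b s' =>
      s' = { s.tick 1 with nat := Function.update s.nat (dst.eval s) (if b then 1 else 0) } := by
  simp only [Program.run]
  exact Coupled.map_right _ _

end rules

/-! ### Uniform distributions -/

section uniform
variable {β : Type*} [Inhabited β]

theorem uniform_of_nonempty {s : Finset β} (h : s.Nonempty) :
    uniform s = PMF.uniformOfFinset s h := by
  simp [uniform, h]

theorem uniform_apply_of_mem {s : Finset β} {a : β} (ha : a ∈ s) :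
    uniform s a = (s.card : ENNReal)⁻¹ := by
  have h : s.Nonempty := ⟨a, ha⟩
  rw [uniform_of_nonempty h, PMF.uniformOfFinset_apply_of_mem _ ha]

theorem uniform_apply_of_notMem {s : Finset β} (h : s.Nonempty) {a : β} (ha : a ∉ s) :
    uniform s a = 0 := by
  rw [uniform_of_nonempty h, PMF.uniformOfFinset_apply_of_notMem _ ha]

theorem mem_of_mem_support_uniform {s : Finset β} (h : s.Nonempty) {a : β}
    (ha : a ∈ (uniform s).support) : a ∈ s := by
  rw [uniform_of_nonempty h] at ha
  exact (PMF.mem_support_uniformOfFinset_iff h a).1 ha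

theorem uniform_singleton (a : β) : uniform {a} = PMF.pure a := by
  classical
  refine PMF.ext fun b => ?_
  by_cases h : b = a
  · subst h; rw [uniform_apply_of_mem (by simp)]; simp
  · rw [uniform_apply_of_notMem (by simp) (by simpa using h)]; simp [h]

theorem coin_apply_true {p : ℝ} (h0 : 0 ≤ p) (h1 : p ≤ 1) : coin p true = ENNReal.ofReal p := by
  simp [coin, h0, h1]

theorem coin_apply_false {p : ℝ} (h0 : 0 ≤ p) (h1 : p ≤ 1) :
    coin p false = ENNReal.ofReal (1 - p) := by
  simp [coin, h0, h1]

theorem ofReal_card_div {a b : ℕ} (hb : b ≠ 0) :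
    ENNReal.ofReal ((a : ℝ) / b) = (a : ENNReal) * (b : ENNReal)⁻¹ := by
  rw [ENNReal.ofReal_div_of_pos (by positivity), ENNReal.ofReal_natCast, ENNReal.ofReal_natCast,
    div_eq_mul_inv]

/-- A uniformly random element can be drawn by first deciding, by a biased coin, whether it has the
property `p`. -/
theorem uniform_eq_coin_bind {U : Finset β} (hU : U.Nonempty) (p : β → Prop) [DecidablePred p] :
    uniform U = (coin (((U.filter p).card : ℝ) / U.card)).bind fun b =>
      uniform (if b then U.filter p else U.filter fun a => ¬ p a) := by
  classical
  have hc : U.card ≠ 0 := Finset.card_ne_zero.2 hU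
  have hsum := Finset.card_filter_add_card_filter_not (s := U) p
  have hle : (U.filter p).card ≤ U.card := Finset.card_filter_le _ _
  have h0 : (0 : ℝ) ≤ ((U.filter p).card : ℝ) / U.card := by positivity
  have h1 : ((U.filter p).card : ℝ) / U.card ≤ 1 := by
    rw [div_le_one (by positivity)]; exact_mod_cast hle
  have h2 : (1 : ℝ) - ((U.filter p).card : ℝ) / U.card =
      ((U.filter fun a => ¬ p a).card : ℝ) / U.card := by
    rw [eq_div_iff (by positivity), sub_mul, div_mul_cancel₀ _ (by positivity), ← hsum]
    push_cast; ring
  have aux : ∀ (V : Finset β), V ⊆ U → ∀ a, (V.card : ENNReal) * (U.card : ENNReal)⁻¹ * uniform V a =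
      if a ∈ V then (U.card : ENNReal)⁻¹ else 0 := by
    intro V _ a
    by_cases ha : a ∈ V
    · rw [uniform_apply_of_mem ha, if_pos ha, mul_right_comm, ENNReal.mul_inv_cancel, one_mul]
      · exact_mod_cast Finset.card_ne_zero.2 ⟨a, ha⟩
      · exact ENNReal.natCast_ne_top _
    · rw [if_neg ha]
      -- For empty `V` the law `uniform V` is a point mass at a meaningless default, but its
      -- coefficient `V.card` vanishes.
      rcases V.eq_empty_or_nonempty with rfl | hV
      · simp
      · rw [uniform_apply_of_notMem hV ha, mul_zero]
  refine PMF.ext fun a => ?_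
  rw [PMF.bind_apply, tsum_bool, coin_apply_true h0 h1, coin_apply_false h0 h1, h2,
    ofReal_card_div hc, ofReal_card_div hc]
  simp only [if_true, Bool.false_eq_true, if_false]
  rw [aux _ (Finset.filter_subset _ _), aux _ (Finset.filter_subset _ _)]
  by_cases ha : a ∈ U
  · rw [uniform_apply_of_mem ha]
    by_cases hp : p a <;> simp [ha, hp]
  · rw [uniform_apply_of_notMem hU ha]
    simp [ha]

/-- Sampling without replacement, one element at a time. -/
theorem uniform_powersetCard_succ [DecidableEq β] {P : Finset β} {j : ℕ} (hj : j + 1 ≤ P.card) :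
    (uniform (Finset.powersetCard j P)).bind
      (fun T => (uniform (P \ T)).bind fun A => PMF.pure (insert A T)) =
      uniform (Finset.powersetCard (j + 1) P) := by
  have hne : (Finset.powersetCard j P).Nonempty := Finset.powersetCard_nonempty.2 (by omega)
  have hne' : (Finset.powersetCard (j + 1) P).Nonempty := Finset.powersetCard_nonempty.2 hj
  have hsd : ∀ T ∈ Finset.powersetCard j P, (P \ T).card = P.card - j := fun T hT => by
    rw [Finset.mem_powersetCard] at hT
    rw [Finset.card_sdiff_of_subset hT.1, hT.2]
  have hsdne : ∀ T ∈ Finset.powersetCard j P, (P \ T).Nonempty := fun T hT => by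
    rw [← Finset.card_pos, hsd T hT]; omega
  refine PMF.ext fun T' => ?_
  have hinner : ∀ T, uniform (Finset.powersetCard j P) T *
      ((uniform (P \ T)).bind fun A => PMF.pure (insert A T)) T' =
      if T ∈ Finset.powersetCard j P then ((P.card.choose j : ENNReal))⁻¹ *
        (((P \ T).filter fun A => T' = insert A T).card * ((P.card - j : ℕ) : ENNReal)⁻¹) else 0 := by
    intro T
    by_cases hT : T ∈ Finset.powersetCard j P
    · rw [if_pos hT, uniform_apply_of_mem hT, Finset.card_powersetCard, PMF.bind_apply]
      congr 1
      rw [tsum_eq_sum (s := P \ T)]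
      · rw [Finset.card_filter, Nat.cast_sum, Finset.sum_mul]
        refine Finset.sum_congr rfl fun A hA => ?_
        rw [uniform_apply_of_mem hA, hsd T hT, PMF.pure_apply, mul_comm]
        simp
      · intro A hA
        rw [uniform_apply_of_notMem (hsdne T hT) hA, zero_mul]
    · rw [if_neg hT, uniform_apply_of_notMem hne hT, zero_mul]
  rw [PMF.bind_apply, tsum_congr hinner, tsum_eq_sum (s := Finset.powersetCard j P)
    (fun T hT => if_neg hT), Finset.sum_congr rfl (fun T hT => if_pos hT), ← Finset.mul_sum,
    ← Finset.sum_mul, ← Nat.cast_sum]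
  -- Double counting: a (j+1)-set arises from exactly j+1 pairs (T, A), one for each choice of the
  -- element added last.
  have hcount : ∑ T ∈ Finset.powersetCard j P, ((P \ T).filter fun A => T' = insert A T).card =
      if T' ∈ Finset.powersetCard (j + 1) P then j + 1 else 0 := by
    split_ifs with hT'
    · rw [Finset.mem_powersetCard] at hT'
      have : (∑ T ∈ Finset.powersetCard j P, ((P \ T).filter fun A => T' = insert A T).card) =
          ∑ A ∈ P, ((Finset.powersetCard j P).filter
            fun T => A ∉ T ∧ T' = insert A T).card := by
        simp only [Finset.card_filter]
        rw [Finset.sum_comm' (t' := P) (s' := fun A => (Finset.powersetCard j P).filter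
          fun T => A ∉ T)]
        · refine Finset.sum_congr rfl fun A _ => ?_
          rw [Finset.sum_filter]
          refine Finset.sum_congr rfl fun T _ => ?_
          by_cases h1 : A ∈ T <;> simp [h1]
        · intro T A
          simp only [Finset.mem_sdiff, Finset.mem_filter]
          tauto
      rw [this]
      have h2 : ∀ A ∈ P, ((Finset.powersetCard j P).filter
            fun T => A ∉ T ∧ T' = insert A T).card = if A ∈ T' then 1 else 0 := by
        intro A hA
        split_ifs with hAT
        · rw [Finset.card_eq_one]
          refine ⟨T'.erase A, ?_⟩
          ext T
          simp only [Finset.mem_filter, Finset.mem_powersetCard, Finset.mem_singleton]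
          constructor
          · rintro ⟨_, h3, rfl⟩
            rw [Finset.erase_insert h3]
          · rintro rfl
            refine ⟨⟨(Finset.erase_subset _ _).trans hT'.1, ?_⟩, Finset.notMem_erase _ _,
              (Finset.insert_erase hAT).symm⟩
            rw [Finset.card_erase_of_mem hAT, hT'.2]; rfl
        · rw [Finset.card_eq_zero, Finset.filter_eq_empty_iff]
          rintro T _ ⟨_, rfl⟩
          exact hAT (Finset.mem_insert_self _ _)
      rw [Finset.sum_congr rfl h2, ← Finset.card_filter, Finset.filter_mem_eq_inter,
        Finset.inter_eq_right.2 hT'.1, hT'.2]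
    · refine Finset.sum_eq_zero fun T hT => ?_
      rw [Finset.card_eq_zero, Finset.filter_eq_empty_iff]
      rintro A hA rfl
      refine hT' ?_
      rw [Finset.mem_powersetCard] at hT ⊢
      rw [Finset.mem_sdiff] at hA
      exact ⟨Finset.insert_subset hA.1 hT.1, by rw [Finset.card_insert_of_notMem hA.2, hT.2]⟩
  rw [hcount]
  split_ifs with hT'
  · rw [uniform_apply_of_mem hT', Finset.card_powersetCard]
    -- With c the size of `P`, the identity C(c,j+1)(j+1) = C(c,j)(c-j) makes the weight
    -- (j+1)/(C(c,j)(c-j)) equal to 1/C(c,j+1).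
    have e1 : P.card.choose (j + 1) * (j + 1) = P.card.choose j * (P.card - j) :=
      Nat.choose_succ_right_eq _ _
    have hpos : 0 < P.card.choose (j + 1) := Nat.choose_pos hj
    have e2 : (P.card.choose (j + 1) : ENNReal) * ((j + 1 : ℕ) : ENNReal) =
      (P.card.choose j : ENNReal) * ((P.card - j : ℕ) : ENNReal) := by exact_mod_cast e1
    have ht : ∀ k : ℕ, (k : ENNReal) ≠ ⊤ := ENNReal.natCast_ne_top
    rw [mul_left_comm, ← ENNReal.mul_inv (Or.inr (ht _)) (Or.inl (ht _)), ← e2,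
      ENNReal.mul_inv (Or.inr (ht _)) (Or.inl (ht _)), mul_left_comm, ENNReal.mul_inv_cancel, mul_one]
    · simp
    · exact ht _
  · rw [uniform_apply_of_notMem hne' hT']; simp

end uniform

/-! ### Prefixes of finite sets -/

section below
variable {n : ℕ}

/-- The elements of `A` below `e`. -/
def below (e : ℕ) (A : Finset (Fin n)) : Finset (Fin n) := A.filter fun i => (i : ℕ) < e

/-- The members of the family `U` whose elements below `e` are those of `B`. -/
def extending (U : Finset (Finset (Fin n))) (e : ℕ) (B : Finset (Fin n)) :
    Finset (Finset (Fin n)) := U.filter fun A => below e A = B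

@[simp] theorem mem_below {e : ℕ} {A : Finset (Fin n)} {i : Fin n} :
    i ∈ below e A ↔ i ∈ A ∧ (i : ℕ) < e := by simp [below]

@[simp] theorem mem_extending {U : Finset (Finset (Fin n))} {e : ℕ} {A B : Finset (Fin n)} :
    A ∈ extending U e B ↔ A ∈ U ∧ below e A = B := by simp [extending]

theorem below_of_le {e : ℕ} (he : n ≤ e) (A : Finset (Fin n)) : below e A = A := by
  ext i; simp; intro _; omega

theorem below_zero (A : Finset (Fin n)) : below 0 A = ∅ := by
  ext i; simp

theorem extending_zero (U : Finset (Finset (Fin n))) : extending U 0 ∅ = U := by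
  ext A; simp [below_zero]

theorem below_succ_eq_iff {e : ℕ} (he : e < n) {A B : Finset (Fin n)}
    (hB : ∀ i ∈ B, (i : ℕ) < e) : below (e + 1) A = B ↔ below e A = B ∧ (⟨e, he⟩ : Fin n) ∉ A := by
  constructor
  · rintro rfl
    have h : (⟨e, he⟩ : Fin n) ∉ A := fun hA => by
      have := hB ⟨e, he⟩ (by simp [hA]); simp at this
    refine ⟨?_, h⟩
    ext i
    simp only [mem_below, and_congr_right_iff]
    intro hi
    have : (i : ℕ) ≠ e := fun h' => h (by subst h'; exact hi)
    omega
  · rintro ⟨rfl, h⟩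
    ext i
    simp only [mem_below, and_congr_right_iff]
    intro hi
    have : (i : ℕ) ≠ e := fun h' => h (by subst h'; exact hi)
    omega

theorem below_succ_eq_insert_iff {e : ℕ} (he : e < n) {A B : Finset (Fin n)}
    (hB : ∀ i ∈ B, (i : ℕ) < e) :
    below (e + 1) A = insert ⟨e, he⟩ B ↔ below e A = B ∧ (⟨e, he⟩ : Fin n) ∈ A := by
  simp only [Finset.ext_iff, mem_below, Finset.mem_insert]
  constructor
  · intro h
    have hA : (⟨e, he⟩ : Fin n) ∈ A := ((h ⟨e, he⟩).2 (Or.inl rfl)).1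
    refine ⟨fun i => ?_, hA⟩
    constructor
    · rintro ⟨h1, h2⟩
      rcases (h i).1 ⟨h1, by omega⟩ with rfl | h3
      · simp at h2
      · exact h3
    · intro h1
      exact ⟨((h i).2 (Or.inr h1)).1, hB i h1⟩
  · rintro ⟨h, hA⟩ i
    constructor
    · rintro ⟨h1, h2⟩
      rcases Nat.lt_succ_iff_lt_or_eq.1 h2 with h3 | h3
      · exact Or.inr ((h i).1 ⟨h1, h3⟩)
      · left; ext; exact h3
    · rintro (rfl | h1)
      · exact ⟨hA, by simp⟩
      · have := (h i).2 h1
        exact ⟨this.1, by omega⟩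

/-- Once the part below `e` is fixed to be `B`, a set is determined by its part from `e` on, which
may be any subset of the rest of `G` with the missing number of elements. -/
theorem card_extending_powersetCard {G B : Finset (Fin n)} {k e : ℕ} (hB : B ⊆ below e G)
    (hk : B.card ≤ k) :
    (extending (Finset.powersetCard k G) e B).card =
      (G.filter fun i : Fin n => e ≤ (i : ℕ)).card.choose (k - B.card) := by
  rw [← Finset.card_powersetCard]
  have hdisj : ∀ C ⊆ (G.filter fun i : Fin n => e ≤ (i : ℕ)), Disjoint C B := fun C hC => by
    rw [Finset.disjoint_left]
    intro i hi hi'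
    have h1 := (Finset.mem_filter.1 (hC hi)).2
    have h2 := (mem_below.1 (hB hi')).2
    omega
  refine Finset.card_nbij' (fun A => A.filter fun i : Fin n => e ≤ (i : ℕ)) (fun C => C ∪ B) ?_ ?_ ?_ ?_
  · intro A hA
    simp only [Finset.mem_coe, mem_extending, Finset.mem_powersetCard] at hA ⊢
    obtain ⟨⟨hA1, hA2⟩, rfl⟩ := hA
    refine ⟨Finset.filter_subset_filter _ hA1, ?_⟩
    have h := Finset.card_filter_add_card_filter_not (s := A) fun i => (i : ℕ) < e
    simp only [not_lt] at h
    rw [below, ← hA2, ← h]; omega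
  · intro C hC
    simp only [Finset.mem_coe, mem_extending, Finset.mem_powersetCard] at hC ⊢
    refine ⟨⟨Finset.union_subset (hC.1.trans (Finset.filter_subset _ _))
      (hB.trans (Finset.filter_subset _ _)), ?_⟩, ?_⟩
    · rw [Finset.card_union_of_disjoint (hdisj C hC.1), hC.2]; omega
    · ext i
      simp only [mem_below, Finset.mem_union]
      constructor
      · rintro ⟨h1 | h1, h2⟩
        · have := (Finset.mem_filter.1 (hC.1 h1)).2; omega
        · exact h1
      · intro h1
        exact ⟨Or.inr h1, (mem_below.1 (hB h1)).2⟩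
  · intro A hA
    simp only [Finset.mem_coe, mem_extending] at hA
    obtain ⟨_, rfl⟩ := hA
    ext i
    simp only [Finset.mem_union, Finset.mem_filter, mem_below]
    rcases lt_or_ge (i : ℕ) e with h | h
    · simp [h, Nat.not_le.2 h]
    · simp [h]
  · intro C hC
    simp only [Finset.mem_coe, Finset.mem_powersetCard] at hC
    ext i
    simp only [Finset.mem_union, Finset.mem_filter]
    constructor
    · rintro ⟨h1 | h1, h2⟩
      · exact h1
      · have := (mem_below.1 (hB h1)).2; omega
    · intro h1
      exact ⟨Or.inl h1, (Finset.mem_filter.1 (hC.1 h1)).2⟩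

end below

/-! ### Storing subsets of the ground set -/

section encode
variable {n : ℕ}

/-- A subset of the ground set, as a set of natural numbers. -/
def encode (A : Finset (Fin n)) : Finset ℕ := A.map Fin.valEmbedding

theorem mem_encode {A : Finset (Fin n)} {e : ℕ} (he : e < n) :
    e ∈ encode A ↔ (⟨e, he⟩ : Fin n) ∈ A := by
  simp only [encode, Finset.mem_map, Fin.valEmbedding_apply]
  constructor
  · rintro ⟨i, hi, rfl⟩; exact hi
  · intro h; exact ⟨_, h, rfl⟩

@[simp] theorem card_encode (A : Finset (Fin n)) : (encode A).card = A.card := by simp [encode]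

@[simp] theorem encode_empty : encode (∅ : Finset (Fin n)) = ∅ := by simp [encode]

theorem encode_union (A B : Finset (Fin n)) : encode A ∪ encode B = encode (A ∪ B) := by
  simp [encode, Finset.map_union]

theorem encode_insert (A : Finset (Fin n)) {e : ℕ} (he : e < n) :
    insert e (encode A) = encode (insert ⟨e, he⟩ A) := by
  simp [encode, Finset.map_insert]

theorem encode_erase (A : Finset (Fin n)) {e : ℕ} (he : e < n) :
    (encode A).erase e = encode (A.erase ⟨e, he⟩) := by
  simp [encode, Finset.map_erase]

theorem State.subset_of_encode {s : State} {k : ℕ} {A : Finset (Fin n)} (h : s.set k = encode A) :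
    s.subset n k = A := by
  ext i
  simp [State.subset, h, mem_encode i.2]

end encode

/-! ### The program -/

/-- The natural number in register `a`. -/
abbrev natReg (a : ℕ) : NatExpr := .get (.lit a)

/-- The real number in register `a`. -/
abbrev realReg (a : ℕ) : RealExpr := .get (.lit a)

/-- The address of the sampled set with number `a`. -/
abbrev sampleAddr (a : NatExpr) : NatExpr := .add (.lit 16) a

local notation:65 c:66 ";;" d:65 => Program.seq c d

/-- An instruction that only overwrites a register that is never read. -/
def skip : Program := .setNat (.lit 15) (.lit 0)

/-- Increment `nat[a]`. -/
def incr (a : ℕ) : Program := .setNat (.lit a) (.add (natReg a) (.lit 1))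

/-- `nat[7] := ⌈log₂ nat[5]⌉` -/
def clogProg : Program :=
  .setNat (.lit 6) (.lit 1) ;; .setNat (.lit 7) (.lit 0) ;;
  .loop (natReg 5) (.ite (.natLt (natReg 6) (natReg 5))
    (.setNat (.lit 6) (.add (natReg 6) (natReg 6)) ;; incr 7) skip)

/-- `nat[7] := ⌈log₂ (4 n)⌉` and `real[13] := max {2, 8 ν²}` -/
def paramInitProg : Program :=
  .setNat (.lit 5) (.add (.add (natReg 0) (natReg 0)) (.add (natReg 0) (natReg 0))) ;;
  clogProg ;;
  .setReal (.lit 13) (.mul (.lit 8) (.mul (realReg 1) (realReg 1))) ;;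
  .ite (.realLt (.lit 2) (realReg 13)) skip (.setReal (.lit 13) (.lit 2))

/-- The parameters `m, t, h` are stored in `nat[1], nat[2], nat[3]`. -/
def paramProg : Program :=
  paramInitProg ;;
  .setReal (.lit 14) (.div (.ofNat (natReg 0)) (realReg 0)) ;;
  .ceil (.lit 1) (.mul (.mul (realReg 13) (.mul (realReg 14) (realReg 14)))
    (.add (.ofNat (natReg 0)) (.ofNat (natReg 7)))) ;;
  .setNat (.lit 5) (.add (.add (natReg 1) (natReg 1)) (.add (natReg 1) (natReg 1))) ;;
  clogProg ;;
  .setNat (.lit 2) (natReg 7) ;;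
  .ceil (.lit 3) (.mul (.ofNat (natReg 2)) (.ofNat (natReg 2)))

/-- `real[5]` is the number of indices `i` in `set[3]` for which `nat[9]` is in the sampled set with
number `i`. -/
def countProg : Program :=
  .setReal (.lit 5) (.lit 0) ;; .setNat (.lit 10) (.lit 0) ;;
  .loop (natReg 13)
    (.ite (.mem (natReg 10) (.lit 3))
      (.ite (.mem (natReg 9) (sampleAddr (natReg 10)))
        (.setReal (.lit 5) (.add (realReg 5) (.lit 1))) skip) skip ;;
    incr 10)

/-- Remove from `set[3]` the indices `i` for which `nat[9]` is not in the sampled set with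
number `i`. -/
def keepProg : Program :=
  .setNat (.lit 10) (.lit 0) ;;
  .loop (natReg 13)
    (.ite (.mem (natReg 9) (sampleAddr (natReg 10))) skip (.erase (.lit 3) (natReg 10)) ;; incr 10)

/-- Remove from `set[3]` the indices `i` for which `nat[9]` is in the sampled set with number `i`. -/
def dropProg : Program :=
  .setNat (.lit 10) (.lit 0) ;;
  .loop (natReg 13)
    (.ite (.mem (natReg 9) (sampleAddr (natReg 10))) (.erase (.lit 3) (natReg 10)) skip ;; incr 10)

/-- Initialization of the sampler: `real[2]` is the number of all sets of size `nat[12]`, and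
`set[3]` and `real[3]` are the set and the number of the sets that are excluded. -/
def sampleInitProg : Program :=
  .union (.lit 2) (.lit 9) (.lit 9) ;; .union (.lit 3) (.lit 9) (.lit 9) ;;
  .setNat (.lit 10) (.lit 0) ;;
  .loop (natReg 13) (.insert (.lit 3) (natReg 10) ;; incr 10) ;;
  .setReal (.lit 3) (.ofNat (natReg 13)) ;;
  .setReal (.lit 2) (.lit 1) ;; .setNat (.lit 10) (.lit 0) ;;
  .loop (natReg 12)
    (incr 10 ;; .setReal (.lit 2) (.div (.mul (realReg 2)
      (.ofNat (.add (.sub (natReg 11) (natReg 12)) (natReg 10)))) (.ofNat (natReg 10)))) ;;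
  .setNat (.lit 9) (.lit 0)

/-- Put the element `nat[9]` into the sample. -/
def acceptProg : Program :=
  .insert (.lit 2) (natReg 9) ;; keepProg ;; .setReal (.lit 2) (realReg 4) ;;
  .setReal (.lit 3) (realReg 5) ;; .setNat (.lit 12) (.sub (natReg 12) (.lit 1))

/-- Leave the element `nat[9]` out of the sample. -/
def rejectProg : Program :=
  dropProg ;; .setReal (.lit 2) (.sub (realReg 2) (realReg 4)) ;;
  .setReal (.lit 3) (.sub (realReg 3) (realReg 5))

/-- The probability of putting the element `nat[9]` into the sample is stored in `real[6]`. -/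
def sampleProbProg : Program :=
  countProg ;;
  .setReal (.lit 4) (.div (.mul (realReg 2) (.ofNat (natReg 12))) (.ofNat (natReg 11))) ;;
  .setReal (.lit 6) (.div (.sub (realReg 4) (realReg 5)) (.sub (realReg 2) (realReg 3)))

/-- Decide about the element `nat[9]`. -/
def sampleStepProg : Program :=
  sampleProbProg ;; (.flip (.lit 8) (realReg 6) ;;
  (.ite (.natLt (.lit 0) (natReg 8)) acceptProg rejectProg ;;
  .setNat (.lit 11) (.sub (natReg 11) (.lit 1))))

/-- `set[2]` is a uniformly random subset of `set[1]` of size `nat[12]` that is none of the sampled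
sets with numbers less than `nat[13]`. The size of `set[1]` is expected in `nat[11]`. -/
def sampleProg : Program :=
  sampleInitProg ;;
  .loop (natReg 0) (.ite (.mem (natReg 9) (.lit 1)) sampleStepProg skip ;; incr 9)

/-- `real[7]` is the surrogate function at `set[7]`. -/
def surrogateProg : Program :=
  .setReal (.lit 7) (.lit 0) ;; .setNat (.lit 10) (.lit 0) ;;
  .loop (natReg 1)
    (.union (.lit 8) (.lit 7) (sampleAddr (natReg 10)) ;; .query (.lit 8) (.lit 8) ;;
    .setReal (.lit 7) (.add (realReg 7) (realReg 8)) ;; incr 10) ;;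
  .setReal (.lit 7) (.div (realReg 7) (.ofNat (natReg 1)))

/-- The marginal values of `nat[9]` are stored in `real[9]` and `real[11]`. -/
def marginalProg : Program :=
  .union (.lit 7) (.lit 5) (.lit 5) ;; surrogateProg ;; .setReal (.lit 10) (realReg 7) ;;
  .insert (.lit 7) (natReg 9) ;; surrogateProg ;;
  .setReal (.lit 9) (.sub (realReg 7) (realReg 10)) ;;
  .union (.lit 7) (.lit 6) (.lit 6) ;; surrogateProg ;; .setReal (.lit 10) (realReg 7) ;;
  .erase (.lit 7) (natReg 9) ;; surrogateProg ;;
  .setReal (.lit 11) (.sub (realReg 7) (realReg 10))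

/-- The acceptance probability is stored in `real[12]`. -/
def acceptProbProg : Program :=
  .ite (.realLt (.lit 0) (realReg 9))
    (.ite (.realLt (.lit 0) (realReg 11))
      (.setReal (.lit 12) (.div (realReg 9) (.add (realReg 9) (realReg 11))))
      (.setReal (.lit 12) (.lit 1)))
    (.setReal (.lit 12) (.lit 0))

/-- One step of double greedy, with the current sets in `set[5]` and `set[6]`. -/
def greedyStepProg : Program :=
  marginalProg ;; acceptProbProg ;; (.flip (.lit 8) (realReg 12) ;;
  .ite (.natLt (.lit 0) (natReg 8)) (.insert (.lit 5) (natReg 9)) (.erase (.lit 6) (natReg 9)))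

/-- Double greedy on the complement of `set[4]`. -/
def greedyProg : Program :=
  .setNat (.lit 9) (.lit 0) ;;
  .loop (natReg 0) (.ite (.mem (natReg 9) (.lit 4)) skip greedyStepProg ;; incr 9)

/-- `set[6]` is the complement of `set[4]`. -/
def complProg : Program :=
  .setNat (.lit 9) (.lit 0) ;;
  .loop (natReg 0) (.ite (.mem (natReg 9) (.lit 4)) skip (.insert (.lit 6) (natReg 9)) ;; incr 9)

/-- `set[1]` is the ground set. -/
def groundProg : Program :=
  .setNat (.lit 9) (.lit 0) ;; .loop (natReg 0) (.insert (.lit 1) (natReg 9) ;; incr 9)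

/-- Sample a set of size `nat[2]` from `set[1]`, which has size `nat[3]`. -/
def drawProg : Program :=
  (.setNat (.lit 11) (natReg 3) ;; .setNat (.lit 12) (natReg 2)) ;; sampleProg

/-- Draw the smoothing set into `set[4]` and `set[1]`. -/
def smoothingProg : Program :=
  (groundProg ;; .setNat (.lit 11) (natReg 0) ;; .setNat (.lit 12) (natReg 3) ;;
    .setNat (.lit 13) (.lit 0)) ;;
  (sampleProg ;; (.union (.lit 4) (.lit 2) (.lit 2) ;; .union (.lit 1) (.lit 2) (.lit 2)))

/-- Draw the family of sampled sets. -/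
def familyProg : Program :=
  .loop (natReg 1)
    (drawProg ;; (.union (sampleAddr (natReg 13)) (.lit 2) (.lit 2) ;; incr 13))

/-- Draw the final set and store the output. -/
def outputProg : Program :=
  .setNat (.lit 13) (.lit 0) ;; (drawProg ;; .union (.lit 0) (.lit 5) (.lit 2))

/-- The meta-algorithm with double greedy. -/
def mainProg : Program :=
  paramProg ;; .ite (.natLt (natReg 0) (natReg 3)) skip
    (smoothingProg ;; (familyProg ;; (complProg ;; (greedyProg ;; outputProg))))

/-! ### Correctness of the deterministic parts -/

attribute [local simp] State.tick NatExpr.eval RealExpr.eval Test.eval Function.update_apply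

section det
variable {n : ℕ} {g : Finset (Fin n) → ℝ} {s : State} {Q : State → Prop}

/-- Register 6 holds 2 to the power of register 7 and is doubled until it reaches N, the value of
register 5. N passes are enough because ⌈log₂ N⌉ ≤ N; the later passes do nothing. -/
theorem clogProg_ensures
    (hQ : ∀ s', s'.nat 7 = Nat.clog 2 (s.nat 5) → (∀ a, a ≤ 5 → s'.nat a = s.nat a) →
      s'.real = s.real → s'.set = s.set → s'.steps ≤ s.steps + 4 * s.nat 5 + 3 → Q s') :
    clogProg.Ensures g s Q := by
  simp only [clogProg, ensures_seq, ensures_setNat]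
  refine Program.Ensures.loop (s.nat 5) (fun i s' => s'.nat 7 = min i (Nat.clog 2 (s.nat 5)) ∧
    s'.nat 6 = 2 ^ s'.nat 7 ∧ (∀ a, a ≤ 5 → s'.nat a = s.nat a) ∧
      s'.real = s.real ∧ s'.set = s.set ∧ s'.steps ≤ s.steps + 3 + 4 * i) (by simp) ?_ ?_ ?_
  · simp
    intro a ha; split_ifs <;> first | rfl | omega
  · rintro i - s' ⟨h1, h2, h3, h4, h5, h6⟩
    rw [ensures_ite]
    have h7 : s'.nat 6 < s'.nat 5 ↔ s'.nat 7 < Nat.clog 2 (s.nat 5) := by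
      rw [h2, h3 5 le_rfl, Nat.lt_clog_iff_pow_lt (by norm_num)]
    constructor
    · intro h
      simp at h
      simp only [incr, ensures_seq, ensures_setNat]
      refine ⟨by simp; omega, by simp [pow_succ]; omega, fun a ha => ?_, h4, h5, by simp; omega⟩
      simp [h3 a ha, show a ≠ 6 by omega, show a ≠ 7 by omega]
    · intro h
      simp at h
      simp only [skip, ensures_setNat]
      refine ⟨by simp; omega, by simp; omega, fun a ha => ?_, h4, h5, by simp; omega⟩
      simp [h3 a ha, show a ≠ 15 by omega]
  · rintro s' ⟨h1, h2, h3, h4, h5, h6⟩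
    refine hQ s' ?_ h3 h4 h5 (by omega)
    rw [h1]
    simpa using Nat.clog_le_of_le_pow (Nat.lt_pow_self (by norm_num)).le

theorem countProg_ensures (h3 : s.set 3 ⊆ Finset.range (s.nat 13))
    (hQ : ∀ s', s'.real 5 = (((s.set 3).filter fun i => s.nat 9 ∈ s.set (16 + i)).card : ℝ) →
      (∀ a, a ≠ 10 → a ≠ 15 → s'.nat a = s.nat a) → (∀ a, a ≠ 5 → s'.real a = s.real a) →
      s'.set = s.set → s'.steps ≤ s.steps + 5 * s.nat 13 + 3 → Q s') :
    countProg.Ensures g s Q := by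
  simp only [countProg, ensures_seq, ensures_setNat, ensures_setReal]
  refine Program.Ensures.loop (s.nat 13) (fun i s' => s'.nat 10 = i ∧
    s'.real 5 = (((s.set 3).filter fun x => x < i ∧ s.nat 9 ∈ s.set (16 + x)).card : ℝ) ∧
    (∀ a, a ≠ 10 → a ≠ 15 → s'.nat a = s.nat a) ∧ (∀ a, a ≠ 5 → s'.real a = s.real a) ∧
      s'.set = s.set ∧ s'.steps ≤ s.steps + 3 + 5 * i) (by simp) ?_ ?_ ?_
  · simp +contextual
  · rintro i - s' ⟨h1, h2, hn, hr, hs, ht⟩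
    have hsucc : ((s.set 3).filter fun x => x < i + 1 ∧ s.nat 9 ∈ s.set (16 + x)).card =
        ((s.set 3).filter fun x => x < i ∧ s.nat 9 ∈ s.set (16 + x)).card +
          if i ∈ s.set 3 ∧ s.nat 9 ∈ s.set (16 + i) then 1 else 0 := by
      split_ifs with h
      · rw [← Finset.card_insert_of_notMem (a := i) (by simp)]
        congr 1
        ext x
        simp only [Finset.mem_filter, Finset.mem_insert]
        constructor
        · rintro ⟨a, b, d⟩
          rcases Nat.lt_succ_iff_lt_or_eq.1 b with h | h
          · exact Or.inr ⟨a, h, d⟩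
          · exact Or.inl h
        · rintro (rfl | ⟨a, b, d⟩)
          · exact ⟨h.1, by omega, h.2⟩
          · exact ⟨a, by omega, d⟩
      · rw [add_zero]
        congr 1
        ext x
        simp only [Finset.mem_filter]
        refine ⟨fun ⟨a, b, d⟩ => ⟨a, ?_, d⟩, fun ⟨a, b, d⟩ => ⟨a, by omega, d⟩⟩
        have : x ≠ i := fun hx => h (hx ▸ ⟨a, d⟩)
        omega
    have e9 := hn 9 (by norm_num) (by norm_num)
    simp only [ensures_seq, ensures_ite, incr, skip, ensures_setNat, ensures_setReal]
    simp only [Test.eval, NatExpr.eval, State.tick, RealExpr.eval, h1, hs, e9]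
    refine ⟨fun h4 => ⟨fun h5 => ?_, fun h5 => ?_⟩, fun h4 => ?_⟩
    all_goals
      simp only [h4, true_and, and_true, if_true, and_false, false_and, if_false] at hsucc
      try simp only [h5, if_true, if_false] at hsucc
      refine ⟨by simp [h1], ?_, fun a ha hb => by simp [ha, hb, hn], fun a ha => by simp [ha, hr],
        trivial, by simp; omega⟩
      rw [hsucc]
      simp [h2]
  · rintro s' ⟨h1, h2, hn, hr, hs, ht⟩
    refine hQ s' ?_ hn hr hs (by omega)
    rw [h2]
    congr 2
    refine Finset.filter_congr fun x hx => ?_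
    simpa using fun _ => Finset.mem_range.1 (h3 hx)

theorem keepProg_ensures (h3 : s.set 3 ⊆ Finset.range (s.nat 13))
    (hQ : ∀ s', s'.set 3 = (s.set 3).filter (fun i => s.nat 9 ∈ s.set (16 + i)) →
      (∀ a, a ≠ 10 → a ≠ 15 → s'.nat a = s.nat a) → s'.real = s.real →
      (∀ a, a ≠ 3 → s'.set a = s.set a) → s'.steps ≤ s.steps + 4 * s.nat 13 + 2 → Q s') :
    keepProg.Ensures g s Q := by
  simp only [keepProg, ensures_seq, ensures_setNat]
  refine Program.Ensures.loop (s.nat 13) (fun i s' => s'.nat 10 = i ∧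
    s'.set 3 = (s.set 3).filter (fun x => x < i → s.nat 9 ∈ s.set (16 + x)) ∧
    (∀ a, a ≠ 10 → a ≠ 15 → s'.nat a = s.nat a) ∧ s'.real = s.real ∧
      (∀ a, a ≠ 3 → s'.set a = s.set a) ∧ s'.steps ≤ s.steps + 2 + 4 * i) (by simp) ?_ ?_ ?_
  · simp +contextual
  · rintro i - s' ⟨h1, h2, hn, hr, hs, ht⟩
    have e9 := hn 9 (by norm_num) (by norm_num)
    simp only [ensures_seq, ensures_ite, incr, skip, ensures_setNat, ensures_erase]
    simp only [Test.eval, NatExpr.eval, State.tick, h1, hs (16 + i) (by omega), e9]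
    refine ⟨fun h4 => ?_, fun h4 => ?_⟩
    · refine ⟨by simp [h1], ?_, fun a ha hb => by simp [ha, hb, hn], hr, hs, by simp; omega⟩
      rw [h2]
      refine Finset.filter_congr fun x hx => ?_
      refine ⟨fun h hxi => ?_, fun h hxi => h (by omega)⟩
      rcases Nat.lt_succ_iff_lt_or_eq.1 hxi with h' | rfl
      · exact h h'
      · exact h4
    · refine ⟨by simp [h1], ?_, fun a ha hb => by simp [ha, hb, hn], hr,
        fun a ha => by simp [ha, hs], by simp; omega⟩
      simp only [Function.update_self, h2]
      ext x
      simp only [Finset.mem_erase, Finset.mem_filter]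
      refine ⟨fun ⟨hxi, hx, h⟩ => ⟨hx, fun h' => h (by omega)⟩, fun ⟨hx, h⟩ => ⟨?_, hx, fun h' =>
        h (by omega)⟩⟩
      rintro rfl
      exact h4 (h (by omega))
  · rintro s' ⟨h1, h2, hn, hr, hs, ht⟩
    refine hQ s' ?_ hn hr hs (by omega)
    rw [h2]
    refine Finset.filter_congr fun x hx => ?_
    simp [Finset.mem_range.1 (h3 hx)]

theorem dropProg_ensures (h3 : s.set 3 ⊆ Finset.range (s.nat 13))
    (hQ : ∀ s', s'.set 3 = (s.set 3).filter (fun i => s.nat 9 ∉ s.set (16 + i)) →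
      (∀ a, a ≠ 10 → a ≠ 15 → s'.nat a = s.nat a) → s'.real = s.real →
      (∀ a, a ≠ 3 → s'.set a = s.set a) → s'.steps ≤ s.steps + 4 * s.nat 13 + 2 → Q s') :
    dropProg.Ensures g s Q := by
  simp only [dropProg, ensures_seq, ensures_setNat]
  refine Program.Ensures.loop (s.nat 13) (fun i s' => s'.nat 10 = i ∧
    s'.set 3 = (s.set 3).filter (fun x => x < i → s.nat 9 ∉ s.set (16 + x)) ∧
    (∀ a, a ≠ 10 → a ≠ 15 → s'.nat a = s.nat a) ∧ s'.real = s.real ∧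
      (∀ a, a ≠ 3 → s'.set a = s.set a) ∧ s'.steps ≤ s.steps + 2 + 4 * i) (by simp) ?_ ?_ ?_
  · simp +contextual
  · rintro i - s' ⟨h1, h2, hn, hr, hs, ht⟩
    have e9 := hn 9 (by norm_num) (by norm_num)
    simp only [ensures_seq, ensures_ite, incr, skip, ensures_setNat, ensures_erase]
    simp only [Test.eval, NatExpr.eval, State.tick, h1, hs (16 + i) (by omega), e9]
    refine ⟨fun h4 => ?_, fun h4 => ?_⟩
    · refine ⟨by simp [h1], ?_, fun a ha hb => by simp [ha, hb, hn], hr,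
        fun a ha => by simp [ha, hs], by simp; omega⟩
      simp only [Function.update_self, h2]
      ext x
      simp only [Finset.mem_erase, Finset.mem_filter]
      refine ⟨fun ⟨hxi, hx, h⟩ => ⟨hx, fun h' => h (by omega)⟩, fun ⟨hx, h⟩ => ⟨?_, hx, fun h' =>
        h (by omega)⟩⟩
      rintro rfl
      exact h (by omega) h4
    · refine ⟨by simp [h1], ?_, fun a ha hb => by simp [ha, hb, hn], hr, hs, by simp; omega⟩
      rw [h2]
      refine Finset.filter_congr fun x hx => ?_
      refine ⟨fun h hxi => ?_, fun h hxi => h (by omega)⟩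
      rcases Nat.lt_succ_iff_lt_or_eq.1 hxi with h' | rfl
      · exact h h'
      · exact h4
  · rintro s' ⟨h1, h2, hn, hr, hs, ht⟩
    refine hQ s' ?_ hn hr hs (by omega)
    rw [h2]
    refine Finset.filter_congr fun x hx => ?_
    simp [Finset.mem_range.1 (h3 hx)]

theorem sampleInitProg_ensures (h9 : s.set 9 = ∅) (hk : s.nat 12 ≤ s.nat 11)
    (hQ : ∀ s', s'.set 2 = ∅ → s'.set 3 = Finset.range (s.nat 13) → s'.real 3 = (s.nat 13 : ℝ) →
      s'.real 2 = ((s.nat 11).choose (s.nat 12) : ℝ) → s'.nat 9 = 0 →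
      (∀ a, a ≠ 9 → a ≠ 10 → s'.nat a = s.nat a) →
      (∀ a, a ≠ 2 → a ≠ 3 → s'.set a = s.set a) →
      s'.steps ≤ s.steps + 3 * s.nat 13 + 3 * s.nat 12 + 9 → Q s') :
    sampleInitProg.Ensures g s Q := by
  simp only [sampleInitProg, ensures_seq, ensures_setNat, ensures_setReal, ensures_union]
  refine Program.Ensures.loop (s.nat 13) (fun i s' => s'.nat 10 = i ∧ s'.set 2 = ∅ ∧
    s'.set 3 = Finset.range i ∧ (∀ a, a ≠ 10 → s'.nat a = s.nat a) ∧
      (∀ a, a ≠ 2 → a ≠ 3 → s'.set a = s.set a) ∧ s'.steps ≤ s.steps + 4 + 3 * i)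
    (by simp) ?_ ?_ ?_
  · simp +contextual [h9]
  · rintro i - s' ⟨h1, h2, h3, hn, hs, ht⟩
    simp only [ensures_seq, incr, ensures_setNat, ensures_insert]
    refine ⟨by simp [h1], by simp [h2], by simp [h1, h3, Finset.range_add_one],
      fun a ha => by simp [ha, hn], fun a ha hb => by simp [hb, hs a ha hb], by simp; omega⟩
  · rintro s₁ ⟨h1, h2, h3, hn, hs, ht⟩
    -- The binomial coefficient is built as C(d+i, i) with d the difference of registers 11 and 12,
    -- multiplying by (d+i+1)/(i+1) in each pass. This takes linearly many exact real operations and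
    -- needs no factorials.
    refine Program.Ensures.loop (s.nat 12) (fun i s' => s'.nat 10 = i ∧ s'.set 2 = ∅ ∧
      s'.set 3 = Finset.range (s.nat 13) ∧ s'.real 3 = s.nat 13 ∧
      s'.real 2 = ((s.nat 11 - s.nat 12 + i).choose i : ℝ) ∧
      (∀ a, a ≠ 10 → s'.nat a = s.nat a) ∧
      (∀ a, a ≠ 2 → a ≠ 3 → s'.set a = s.set a) ∧
      s'.steps ≤ s.steps + 8 + 3 * s.nat 13 + 3 * i) (by simp [hn]) ?_ ?_ ?_
    · simp +contextual [h2, h3, hn, hs]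
      omega
    · rintro i - s' ⟨h1, h2, h3, h4, h5, hn, hs, ht⟩
      simp only [ensures_seq, incr, ensures_setNat, ensures_setReal]
      refine ⟨by simp [h1], by simp [h2], by simp [h3], by simp [h4], ?_,
        fun a ha => by simp [ha, hn], fun a ha hb => by simp [hs a ha hb], by simp; omega⟩
      have e := Nat.add_one_mul_choose_eq (s.nat 11 - s.nat 12 + i) i
      have e' : ((s.nat 11 - s.nat 12 + i : ℕ) + 1 : ℝ) * ((s.nat 11 - s.nat 12 + i).choose i : ℝ) =
          ((s.nat 11 - s.nat 12 + i + 1).choose (i + 1) : ℝ) * (i + 1 : ℝ) := by exact_mod_cast e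
      simp [h1, h5, hn]
      rw [div_eq_iff (by positivity), ← add_assoc (s.nat 11 - s.nat 12) i 1, ← e']
      push_cast
      ring
    · rintro s' ⟨h1, h2, h3, h4, h5, hn, hs, ht⟩
      refine hQ _ (by simpa using h2) (by simpa using h3) (by simpa using h4) ?_ (by simp)
        (fun a ha hb => by simp [ha, hn a hb]) (fun a ha hb => by simp [hs a ha hb]) (by simp; omega)
      simp [h5, Nat.sub_add_cancel hk]

end det

/-! ### Correctness of the sampler -/

section sampler
variable {n : ℕ} {g : Finset (Fin n) → ℝ}

/-- The subsets of `G` of size `k` that are none of the first `j` sets of the sequence `D`. -/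
def remaining (G : Finset (Fin n)) (k j : ℕ) (D : ℕ → Finset (Fin n)) : Finset (Finset (Fin n)) :=
  Finset.powersetCard k G \ (Finset.range j).image D

/-- The input conditions of the sampler. -/
structure SampleEnv (G : Finset (Fin n)) (k j : ℕ) (D : ℕ → Finset (Fin n)) (s : State) : Prop where
  nat0 : s.nat 0 = n
  nat11 : s.nat 11 = G.card
  nat12 : s.nat 12 = k
  nat13 : s.nat 13 = j
  set1 : s.set 1 = encode G
  set9 : s.set 9 = ∅
  sets : ∀ i < j, s.set (16 + i) = encode (D i)
  mem : ∀ i < j, D i ∈ Finset.powersetCard k G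
  inj : Set.InjOn D (Finset.range j)
  nonempty : (remaining G k j D).Nonempty

/-- The invariant of the sampler, when the elements below `e` have been decided and `B` is the set
of those that are in the sample. -/
structure SampleInv (G : Finset (Fin n)) (k j : ℕ) (D : ℕ → Finset (Fin n)) (s₀ : State)
    (x T e : ℕ) (B : Finset (Fin n)) (s : State) : Prop where
  nonempty : (extending (remaining G k j D) e B).Nonempty
  nat9 : s.nat 9 = x
  nat11 : s.nat 11 = (G.filter fun i : Fin n => e ≤ i).card
  nat12 : s.nat 12 = k - B.card
  real2 : s.real 2 = ((s.nat 11).choose (s.nat 12) : ℝ)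
  set2 : s.set 2 = encode B
  set3 : s.set 3 = (Finset.range j).filter fun i => below e (D i) = B
  real3 : s.real 3 = (s.set 3).card
  nat : ∀ a, a ≤ 3 ∨ a = 13 → s.nat a = s₀.nat a
  set : ∀ a, a ≠ 2 → a ≠ 3 → s.set a = s₀.set a
  steps : s.steps ≤ T

variable {G B : Finset (Fin n)} {k j e x T : ℕ} {D : ℕ → Finset (Fin n)} {s₀ s : State}

theorem subset_of_extending_nonempty (h : (extending (remaining G k j D) e B).Nonempty) :
    B ⊆ below e G ∧ B.card ≤ k := by
  obtain ⟨A, hA⟩ := h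
  simp only [mem_extending, remaining, Finset.mem_sdiff, Finset.mem_powersetCard] at hA
  obtain ⟨⟨⟨h1, h2⟩, _⟩, rfl⟩ := hA
  exact ⟨Finset.filter_subset_filter _ h1, h2 ▸ Finset.card_filter_le _ _⟩

/-- The excluded sets are distinct and of the right kind, so those with prefix `B` can be subtracted
from the binomial coefficient one for one, counted by their indices. -/
theorem card_extending_remaining (env : SampleEnv G k j D s₀) (hB : B ⊆ below e G)
    (hk : B.card ≤ k) :
    ((extending (remaining G k j D) e B).card : ℝ) =
      ((G.filter fun i : Fin n => e ≤ i).card.choose (k - B.card) : ℝ) -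
        (((Finset.range j).filter fun i => below e (D i) = B).card : ℝ) := by
  have h1 : extending (remaining G k j D) e B = extending (Finset.powersetCard k G) e B \
      ((Finset.range j).filter fun i => below e (D i) = B).image D := by
    ext A
    simp only [mem_extending, remaining, Finset.mem_sdiff, Finset.mem_image, Finset.mem_filter]
    constructor
    · rintro ⟨⟨h1, h2⟩, h3⟩
      exact ⟨⟨h1, h3⟩, fun ⟨i, hi, h⟩ => h2 ⟨i, hi.1, h⟩⟩
    · rintro ⟨⟨h1, h3⟩, h2⟩
      exact ⟨⟨h1, fun ⟨i, hi, h⟩ => h2 ⟨i, ⟨hi, h ▸ h3⟩, h⟩⟩, h3⟩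
  have h2 : ((Finset.range j).filter fun i => below e (D i) = B).image D ⊆
      extending (Finset.powersetCard k G) e B := by
    intro A
    simp only [mem_extending, Finset.mem_image, Finset.mem_filter, Finset.mem_range]
    rintro ⟨i, ⟨hi, h⟩, rfl⟩
    exact ⟨env.mem i hi, h⟩
  have h3 : (((Finset.range j).filter fun i => below e (D i) = B).image D).card =
      ((Finset.range j).filter fun i => below e (D i) = B).card :=
    Finset.card_image_of_injOn (env.inj.mono (by
      intro i hi; exact (Finset.mem_filter.1 hi).1))
  have h4 := Finset.card_le_card h2
  rw [h1, Finset.card_sdiff_of_subset h2, Nat.cast_sub h4, h3, card_extending_powersetCard hB hk]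

theorem extending_succ_insert {U : Finset (Finset (Fin n))} (he : e < n)
    (hB : ∀ i ∈ B, (i : ℕ) < e) :
    extending U (e + 1) (insert ⟨e, he⟩ B) = (extending U e B).filter fun A => ⟨e, he⟩ ∈ A := by
  ext A
  simp only [mem_extending, Finset.mem_filter, below_succ_eq_insert_iff he hB, and_assoc]

theorem extending_succ {U : Finset (Finset (Fin n))} (he : e < n)
    (hB : ∀ i ∈ B, (i : ℕ) < e) :
    extending U (e + 1) B = (extending U e B).filter fun A => ⟨e, he⟩ ∉ A := by
  ext A
  simp only [mem_extending, Finset.mem_filter, below_succ_eq_iff he hB, and_assoc]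

theorem card_filter_le_succ (he : e < n) (heG : (⟨e, he⟩ : Fin n) ∈ G) :
    (G.filter fun i : Fin n => e ≤ i).card = (G.filter fun i : Fin n => e + 1 ≤ i).card + 1 := by
  rw [← Finset.card_insert_of_notMem (a := (⟨e, he⟩ : Fin n)) (by simp)]
  congr 1
  ext i
  simp only [Finset.mem_filter, Finset.mem_insert, Fin.ext_iff]
  constructor
  · rintro ⟨h1, h2⟩
    by_cases h : (i : ℕ) = e
    · exact Or.inl h
    · exact Or.inr ⟨h1, by omega⟩
  · rintro (h | ⟨h1, h2⟩)
    · have : i = ⟨e, he⟩ := Fin.ext h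
      exact ⟨this ▸ heG, by omega⟩
    · exact ⟨h1, by omega⟩

theorem card_filter_le_succ_of_notMem (he : e < n) (heG : (⟨e, he⟩ : Fin n) ∉ G) :
    (G.filter fun i : Fin n => e ≤ i).card = (G.filter fun i : Fin n => e + 1 ≤ i).card := by
  congr 1
  refine Finset.filter_congr fun i hi => ?_
  have : (i : ℕ) ≠ e := fun h => heG (by
    have : i = ⟨e, he⟩ := Fin.ext h
    exact this ▸ hi)
  omega

theorem filter_below_insert (he : e < n) (hB : ∀ i ∈ B, (i : ℕ) < e) :
    ((Finset.range j).filter fun i => below (e + 1) (D i) = insert ⟨e, he⟩ B) =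
      ((Finset.range j).filter fun i => below e (D i) = B).filter fun i => ⟨e, he⟩ ∈ D i := by
  rw [Finset.filter_filter]
  exact Finset.filter_congr fun i _ => below_succ_eq_insert_iff he hB

theorem filter_below_succ (he : e < n) (hB : ∀ i ∈ B, (i : ℕ) < e) :
    ((Finset.range j).filter fun i => below (e + 1) (D i) = B) =
      ((Finset.range j).filter fun i => below e (D i) = B).filter fun i => ⟨e, he⟩ ∉ D i := by
  rw [Finset.filter_filter]
  exact Finset.filter_congr fun i _ => below_succ_eq_iff he hB

theorem SampleInv.filter_eq (inv : SampleInv G k j D s₀ e T e B s) (env : SampleEnv G k j D s₀)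
    (he : e < n) : ((s.set 3).filter fun i => s.nat 9 ∈ s.set (16 + i)) =
      ((Finset.range j).filter fun i => below e (D i) = B).filter fun i => ⟨e, he⟩ ∈ D i := by
  rw [inv.set3]
  refine Finset.filter_congr fun i hi => ?_
  have hi' : i < j := Finset.mem_range.1 (Finset.mem_filter.1 hi).1
  rw [inv.set (16 + i) (by omega) (by omega), env.sets i hi', inv.nat9, mem_encode he]

theorem SampleInv.filter_not_eq (inv : SampleInv G k j D s₀ e T e B s)
    (env : SampleEnv G k j D s₀) (he : e < n) :
    ((s.set 3).filter fun i => s.nat 9 ∉ s.set (16 + i)) =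
      ((Finset.range j).filter fun i => below e (D i) = B).filter fun i => ⟨e, he⟩ ∉ D i := by
  rw [inv.set3]
  refine Finset.filter_congr fun i hi => ?_
  have hi' : i < j := Finset.mem_range.1 (Finset.mem_filter.1 hi).1
  rw [inv.set (16 + i) (by omega) (by omega), env.sets i hi', inv.nat9, mem_encode he]

theorem add_one_mul_choose_cast (m d : ℕ) :
    ((m : ℝ) + 1) * (m.choose d : ℝ) = ((m + 1).choose (d + 1) : ℝ) * ((d : ℝ) + 1) := by
  exact_mod_cast Nat.add_one_mul_choose_eq m d

/-- The number of sets that contain the current element. -/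
theorem card_filter_mem_extending (env : SampleEnv G k j D s₀)
    (hne : (extending (remaining G k j D) e B).Nonempty) (he : e < n)
    (heG : (⟨e, he⟩ : Fin n) ∈ G) :
    (((extending (remaining G k j D) e B).filter fun A => ⟨e, he⟩ ∈ A).card : ℝ) =
      ((G.filter fun i : Fin n => e ≤ i).card.choose (k - B.card) : ℝ) * (k - B.card : ℕ) /
        (G.filter fun i : Fin n => e ≤ i).card -
      ((((Finset.range j).filter fun i => below e (D i) = B).filter
        fun i => ⟨e, he⟩ ∈ D i).card : ℝ) := by
  obtain ⟨h1, h2⟩ := subset_of_extending_nonempty hne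
  have hB : ∀ i ∈ B, (i : ℕ) < e := fun i hi => (mem_below.1 (h1 hi)).2
  have heB : (⟨e, he⟩ : Fin n) ∉ B := fun h => by simpa using hB _ h
  -- If `B` is not yet full, use C(r+1,d+1)(d+1)/(r+1) = C(r,d). If it has already `k` elements, no
  -- set of size `k` with prefix `B` contains the new element, and both sides vanish.
  rcases h2.lt_or_eq with h3 | h3
  · have h4 : insert (⟨e, he⟩ : Fin n) B ⊆ below (e + 1) G := by
      intro i hi
      rcases Finset.mem_insert.1 hi with rfl | hi
      · simp [heG]
      · have := mem_below.1 (h1 hi)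
        exact mem_below.2 ⟨this.1, by omega⟩
    have h5 : (insert (⟨e, he⟩ : Fin n) B).card = B.card + 1 := Finset.card_insert_of_notMem heB
    rw [← extending_succ_insert he hB, card_extending_remaining env h4 (by omega),
      filter_below_insert he hB, h5, card_filter_le_succ he heG]
    congr 1
    obtain ⟨d, hd⟩ : ∃ d, k - B.card = d + 1 := ⟨k - B.card - 1, by omega⟩
    rw [hd, show k - (B.card + 1) = d by omega]
    have e2 := add_one_mul_choose_cast (G.filter fun i : Fin n => e + 1 ≤ i).card d
    rw [eq_div_iff (by positivity)]
    push_cast at e2 ⊢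
    linarith
  · have h6 : ((extending (remaining G k j D) e B).filter fun A => ⟨e, he⟩ ∈ A) = ∅ := by
      rw [Finset.filter_eq_empty_iff]
      intro A hA hAe
      simp only [mem_extending, remaining, Finset.mem_sdiff, Finset.mem_powersetCard] at hA
      have : insert ⟨e, he⟩ B ⊆ A := Finset.insert_subset hAe
        (hA.2 ▸ Finset.filter_subset _ _)
      have := Finset.card_le_card this
      rw [Finset.card_insert_of_notMem heB] at this
      omega
    have h7 : (((Finset.range j).filter fun i => below e (D i) = B).filter
        fun i => ⟨e, he⟩ ∈ D i) = ∅ := by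
      rw [Finset.filter_eq_empty_iff]
      intro i hi hAe
      rw [Finset.mem_filter, Finset.mem_range] at hi
      have h8 := Finset.mem_powersetCard.1 (env.mem i hi.1)
      have : insert ⟨e, he⟩ B ⊆ D i := Finset.insert_subset hAe
        (hi.2 ▸ Finset.filter_subset _ _)
      have := Finset.card_le_card this
      rw [Finset.card_insert_of_notMem heB] at this
      omega
    rw [h6, h7, h3]
    simp

/-- The coin has the exact conditional probability that a uniform admissible set with prefix `B`
contains the current element: registers real 4 and real 5 count all and the excluded such sets, real
2 and real 3 all and the excluded sets with prefix `B`. The invariant is claimed only if the new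
prefix can still be completed, since otherwise the counts have no meaning. -/
theorem sampleStepProg_coupled (env : SampleEnv G k j D s₀) (inv : SampleInv G k j D s₀ e T e B s)
    (he : e < n) (heG : (⟨e, he⟩ : Fin n) ∈ G) :
    Coupled (coin ((((extending (remaining G k j D) e B).filter fun A => ⟨e, he⟩ ∈ A).card : ℝ) /
        (extending (remaining G k j D) e B).card)) (sampleStepProg.run g s)
      fun b s' => (extending (remaining G k j D) (e + 1)
          (if b then insert ⟨e, he⟩ B else B)).Nonempty →
        SampleInv G k j D s₀ e (T + 9 * j + 14) (e + 1) (if b then insert ⟨e, he⟩ B else B) s' := by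
  obtain ⟨h1, h2⟩ := subset_of_extending_nonempty inv.nonempty
  have hB : ∀ i ∈ B, (i : ℕ) < e := fun i hi => (mem_below.1 (h1 hi)).2
  have heB : (⟨e, he⟩ : Fin n) ∉ B := fun h => by simpa using hB _ h
  have hj : s.nat 13 = j := (inv.nat 13 (Or.inr rfl)).trans env.nat13
  have h3 : s.set 3 ⊆ Finset.range (s.nat 13) := by
    rw [inv.set3, hj]; exact Finset.filter_subset _ _
  have hin := card_filter_mem_extending env inv.nonempty he heG
  have hall := card_extending_remaining env h1 h2
  have hr := card_filter_le_succ he heG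
  rw [← inv.nat11, ← inv.nat12, ← inv.real2, ← inv.filter_eq env he] at hin
  rw [← inv.nat11, ← inv.nat12, ← inv.real2, ← inv.set3, ← inv.real3] at hall
  rw [← inv.nat11] at hr
  have hr0 : (s.nat 11 : ℝ) ≠ 0 := by rw [hr]; positivity
  rw [sampleStepProg]
  refine Coupled.seq_det ?_
  simp only [sampleProbProg, ensures_seq]
  refine countProg_ensures h3 fun s₁ a5 an ar as at' => ?_
  simp only [ensures_setReal]
  rw [hin, hall]
  set s₂ : State := { nat := s₁.nat
                      real := Function.update (Function.update s₁.real 4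
                        (s.real 2 * s.nat 12 / s.nat 11)) 6
                        ((s.real 2 * s.nat 12 / s.nat 11 -
                          (((s.set 3).filter fun i => s.nat 9 ∈ s.set (16 + i)).card : ℝ)) /
                          (s.real 2 - s.real 3))
                      set := s₁.set
                      steps := s₁.steps + 2 } with hs₂
  have hgoal : ∀ t : State, t = s₂ → Coupled (coin ((s.real 2 * s.nat 12 / s.nat 11 -
                          (((s.set 3).filter fun i => s.nat 9 ∈ s.set (16 + i)).card : ℝ)) /
                          (s.real 2 - s.real 3)))
      ((Program.flip (.lit 8) (realReg 6) ;;
        (.ite (.natLt (.lit 0) (natReg 8)) acceptProg rejectProg ;;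
        .setNat (.lit 11) (.sub (natReg 11) (.lit 1)))).run g t)
      fun b s' => (extending (remaining G k j D) (e + 1)
          (if b then insert ⟨e, he⟩ B else B)).Nonempty →
        SampleInv G k j D s₀ e (T + 9 * j + 14) (e + 1)
          (if b then insert ⟨e, he⟩ B else B) s' := by
    rintro t rfl
    rw [Program.run, ← PMF.bind_pure (coin _)]
    have hf := Coupled.flip (g := g) (s := s₂) (.lit 8) (realReg 6)
    have hp : (realReg 6).eval s₂ = (s.real 2 * s.nat 12 / s.nat 11 -
                          (((s.set 3).filter fun i => s.nat 9 ∈ s.set (16 + i)).card : ℝ)) /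
                          (s.real 2 - s.real 3) := by simp [hs₂]
    rw [hp] at hf
    refine hf.bind fun b s₃ hs₃ => Coupled.of_ensures ?_
    have c9 : s₃.nat 9 = s.nat 9 := by simp [hs₃, hs₂, an]
    have c11 : s₃.nat 11 = s.nat 11 := by simp [hs₃, hs₂, an]
    have c12 : s₃.nat 12 = s.nat 12 := by simp [hs₃, hs₂, an]
    have cn : ∀ a, a ≤ 3 ∨ a = 13 → s₃.nat a = s.nat a := fun a ha => by
      simp [hs₃, hs₂, show a ≠ 8 by omega]
      exact an a (by omega) (by omega)
    have c13 : s₃.nat 13 = j := (cn 13 (Or.inr rfl)).trans hj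
    have cs : s₃.set = s.set := by simp [hs₃, hs₂, as]
    have c2 : s₃.real 2 = s.real 2 := by simp [hs₃, hs₂, ar]
    have c3 : s₃.real 3 = s.real 3 := by simp [hs₃, hs₂, ar]
    have c4 : s₃.real 4 = s.real 2 * s.nat 12 / s.nat 11 := by simp [hs₃, hs₂]
    have c5 : s₃.real 5 = (((s.set 3).filter fun i => s.nat 9 ∈ s.set (16 + i)).card : ℝ) := by
      simp [hs₃, hs₂, a5]
    have ct : s₃.steps ≤ T + 5 * j + 6 := by
      have := inv.steps
      simp [hs₃, hs₂]; omega
    have c8 : s₃.nat 8 = if b then 1 else 0 := by simp [hs₃]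
    clear_value s₂
    clear hs₃ hs₂ hf hp
    simp only [ensures_seq, ensures_ite]
    cases b
    · simp only [Bool.false_eq_true, if_false] at c8 ⊢
      refine ⟨fun h => absurd h (by simp [c8]), fun _ => ?_⟩
      simp only [rejectProg, ensures_seq]
      refine dropProg_ensures (by simpa [cs, c13, ← hj] using h3) fun s₄ b3 bn br bs bt => ?_
      simp [c9, cs] at b3 bn br bs bt
      simp only [ensures_setReal, ensures_setNat]
      intro hne
      rw [inv.filter_not_eq env he, ← filter_below_succ he hB] at b3
      have n11 : s₄.nat 11 = s.nat 11 := by rw [bn 11 (by omega) (by omega), c11]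
      have n12 : s₄.nat 12 = s.nat 12 := by rw [bn 12 (by omega) (by omega), c12]
      refine ⟨hne, ?_, ?_, ?_, ?_, ?_, ?_, ?_, ?_, ?_, ?_⟩
      · simp [bn, c9, inv.nat9]
      · simp [n11, hr]
      · simp [n12, inv.nat12]
      · simp [n11, n12, br, c2, c4, inv.real2]
        rw [hr]
        simp only [Nat.add_sub_cancel]
        rcases Nat.eq_zero_or_pos (s.nat 12) with h0 | h0
        · simp [h0]
        · obtain ⟨d, hd⟩ : ∃ d, s.nat 12 = d + 1 := ⟨s.nat 12 - 1, by omega⟩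
          rw [hd]
          -- On rejection the count follows Pascal's rule, C(r+1,d+1) - C(r,d) = C(r,d+1); the
          -- subtracted term was computed as C(r+1,d+1)(d+1)/(r+1).
          have e2 := add_one_mul_choose_cast (G.filter fun i : Fin n => e + 1 ≤ i).card d
          rw [sub_eq_iff_eq_add, Nat.choose_succ_succ]
          rw [Nat.choose_succ_succ] at e2
          push_cast at e2 ⊢
          rw [← e2]
          field_simp
          ring
      · simp [bs, inv.set2]
      · simp [b3]
      · simp [br, c3, c5, b3]
        rw [inv.real3, inv.filter_eq env he, inv.set3, filter_below_succ he hB, sub_eq_iff_eq_add,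
          ← Finset.card_filter_add_card_filter_not (s := Finset.filter _ _)
            (fun i => (⟨e, he⟩ : Fin n) ∈ D i)]
        push_cast; ring
      · intro a ha
        simp [show a ≠ 11 by omega, bn a (by omega) (by omega), cn a ha, inv.nat a ha]
      · intro a ha hb
        simp [bs a hb, inv.set a ha hb]
      · simp [c13] at bt ⊢; omega
    · simp only [if_true] at c8 ⊢
      refine ⟨fun _ => ?_, fun h => absurd (by simp [c8]) h⟩
      simp only [acceptProg, ensures_seq, ensures_insert]
      refine keepProg_ensures (by simpa [cs, c13, ← hj] using h3) fun s₄ b3 bn br bs bt => ?_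
      have hcond : ∀ i : ℕ, (16 + i = 2) = False := fun i => by simp; omega
      simp [c9, cs, hcond] at b3 bn br bs bt
      rw [inv.filter_eq env he, ← filter_below_insert he hB] at b3
      have n11 : s₄.nat 11 = s.nat 11 := by rw [bn 11 (by omega) (by omega), c11]
      have n12 : s₄.nat 12 = s.nat 12 := by rw [bn 12 (by omega) (by omega), c12]
      have hcard : (insert (⟨e, he⟩ : Fin n) B).card = B.card + 1 :=
        Finset.card_insert_of_notMem heB
      simp only [ensures_setReal, ensures_setNat]
      intro hne
      have hle := (subset_of_extending_nonempty hne).2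
      refine ⟨hne, ?_, ?_, ?_, ?_, ?_, ?_, ?_, ?_, ?_, ?_⟩
      · simp [bn, c9, inv.nat9]
      · simp [n11, hr]
      · simp [n12, inv.nat12, hcard]; omega
      · simp [n11, n12, br, c2, c4, inv.real2]
        rw [hr]
        simp only [Nat.add_sub_cancel]
        obtain ⟨d, hd⟩ : ∃ d, s.nat 12 = d + 1 := ⟨s.nat 12 - 1, by rw [inv.nat12]; omega⟩
        rw [hd]
        have e2 := add_one_mul_choose_cast (G.filter fun i : Fin n => e + 1 ≤ i).card d
        push_cast at e2 ⊢
        rw [← e2]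
        field_simp
      · simp [bs, inv.set2, inv.nat9, encode_insert _ he]
      · simp [b3]
      · simp [br, c5, b3]
        rw [inv.filter_eq env he, filter_below_insert he hB]
      · intro a ha
        simp [show a ≠ 11 by omega, show a ≠ 12 by omega, bn a (by omega) (by omega), cn a ha,
          inv.nat a ha]
      · intro a ha hb
        simp [ha, bs a hb, inv.set a ha hb]
      · simp [c13] at bt ⊢; omega
  refine hgoal _ ?_
  have e2 : s₁.real 2 = s.real 2 := ar 2 (by norm_num)
  have e3 : s₁.real 3 = s.real 3 := ar 3 (by norm_num)
  have e11 : s₁.nat 11 = s.nat 11 := an 11 (by norm_num) (by norm_num)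
  have e12 : s₁.nat 12 = s.nat 12 := an 12 (by norm_num) (by norm_num)
  simp [hs₂, e2, e3, e11, e12, a5]

theorem coin_support_true {p : ℝ} (h : true ∈ (coin p).support) : 0 < p := by
  by_contra hp
  refine (PMF.mem_support_iff _ _).1 h ?_
  simp [coin]
  exact not_lt.1 hp

theorem coin_support_false {p : ℝ} (h : false ∈ (coin p).support) : p < 1 := by
  by_contra hp
  refine (PMF.mem_support_iff _ _).1 h ?_
  simp [coin]
  exact Or.inr (not_lt.1 hp)

/-- The final condition of the sampler. -/
structure SamplePost (s₀ : State) (T : ℕ) (A : Finset (Fin n)) (s : State) : Prop where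
  set2 : s.set 2 = encode A
  nat : ∀ a, a ≤ 3 ∨ a = 13 → s.nat a = s₀.nat a
  set : ∀ a, a ≠ 2 → a ≠ 3 → s.set a = s₀.set a
  steps : s.steps ≤ T

/-- One pass followed by an arbitrary continuation `F`: a uniform admissible set is drawn by first
deciding whether it contains `e`. If `e` is outside the ground set of the sampler, nothing is random
and only the prefix bound advances. -/
theorem sampleBody_coupled (env : SampleEnv G k j D s₀) (inv : SampleInv G k j D s₀ e T e B s)
    (he : e < n) {p' : Finset (Fin n) → PMF (Finset (Fin n))}
    {F : State → PMF State} {R : Finset (Fin n) → State → Prop}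
    (hp' : ∀ B', (extending (remaining G k j D) (e + 1) B').Nonempty →
      p' B' = uniform (extending (remaining G k j D) (e + 1) B'))
    (hF : ∀ B' s', SampleInv G k j D s₀ (e + 1) (T + 9 * j + 17) (e + 1) B' s' →
      Coupled (p' B') (F s') R) :
    Coupled (uniform (extending (remaining G k j D) e B))
      (((Program.ite (.mem (natReg 9) (.lit 1)) sampleStepProg skip ;; incr 9).run g
        (s.tick 1)).bind F) R := by
  obtain ⟨h1, h2⟩ := subset_of_extending_nonempty inv.nonempty
  have hB : ∀ i ∈ B, (i : ℕ) < e := fun i hi => (mem_below.1 (h1 hi)).2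
  have hmem : (Test.mem (natReg 9) (.lit 1)).eval (s.tick 1) ↔ (⟨e, he⟩ : Fin n) ∈ G := by
    simp only [Test.eval, NatExpr.eval, State.tick]
    rw [inv.nat9, inv.set 1 (by norm_num) (by norm_num), env.set1, mem_encode he]
  by_cases heG : (⟨e, he⟩ : Fin n) ∈ G
  · have inv' : SampleInv G k j D s₀ e (T + 2) e B ((s.tick 1).tick 1) :=
      { inv with steps := by have := inv.steps; simp; omega }
    have hc := (sampleStepProg_coupled (g := g) env inv' he heG).and_mem_support
    have hrun : (Program.ite (.mem (natReg 9) (.lit 1)) sampleStepProg skip ;; incr 9).run g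
        (s.tick 1) = (sampleStepProg.run g ((s.tick 1).tick 1)).bind ((incr 9).run g) := by
      rw [Program.run, Program.run, if_pos (hmem.2 heG)]
    rw [hrun, PMF.bind_bind,
      uniform_eq_coin_bind inv.nonempty fun A => (⟨e, he⟩ : Fin n) ∈ A]
    refine hc.bind fun b s₁ hs₁ => ?_
    -- An outcome of positive probability leaves at least one completion: the coin's bias is a ratio
    -- of cardinalities, so bias > 0 or bias < 1 says that the chosen half is nonempty.
    have hne : (extending (remaining G k j D) (e + 1)
        (if b then insert ⟨e, he⟩ B else B)).Nonempty := by
      have hpos : (0 : ℝ) < (extending (remaining G k j D) e B).card := by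
        exact_mod_cast Finset.card_pos.2 inv.nonempty
      cases b
      · have := coin_support_false hs₁.2
        rw [div_lt_one hpos] at this
        have h4 := Finset.card_filter_add_card_filter_not
          (s := extending (remaining G k j D) e B) fun A => (⟨e, he⟩ : Fin n) ∈ A
        simp only [Bool.false_eq_true, if_false]
        rw [extending_succ he hB, ← Finset.card_pos]
        have h5 : ((extending (remaining G k j D) e B).filter
          fun A => (⟨e, he⟩ : Fin n) ∈ A).card < (extending (remaining G k j D) e B).card := by
          exact_mod_cast this
        omega
      · have := coin_support_true hs₁.2
        rw [div_pos_iff_of_pos_right hpos] at this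
        simp only [if_true]
        rw [extending_succ_insert he hB, ← Finset.card_pos]
        exact_mod_cast this
    have hU : (if b then (extending (remaining G k j D) e B).filter fun A => (⟨e, he⟩ : Fin n) ∈ A
        else (extending (remaining G k j D) e B).filter fun A => (⟨e, he⟩ : Fin n) ∉ A) =
        extending (remaining G k j D) (e + 1) (if b then insert ⟨e, he⟩ B else B) := by
      cases b
      · simp [extending_succ he hB]
      · simp [extending_succ_insert he hB]
    rw [hU, ← hp' _ hne]
    have inv₁ := hs₁.1 hne
    simp only [incr, Program.run, PMF.pure_bind]
    refine hF _ _ { inv₁ with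
      nat9 := by simp [inv₁.nat9], nat11 := by simp [inv₁.nat11], nat12 := by simp [inv₁.nat12]
      real2 := by simp [inv₁.real2], nat := ?_, steps := ?_ }
    · intro a ha
      simp [show a ≠ 9 by omega, inv₁.nat a ha]
    · have := inv₁.steps
      simp; omega
  · have hrun : (Program.ite (.mem (natReg 9) (.lit 1)) sampleStepProg skip ;; incr 9).run g
        (s.tick 1) = (skip.run g ((s.tick 1).tick 1)).bind ((incr 9).run g) := by
      rw [Program.run, Program.run, if_neg (fun h => heG (hmem.1 h))]
    have hU : extending (remaining G k j D) (e + 1) B = extending (remaining G k j D) e B := by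
      rw [extending_succ he hB, Finset.filter_eq_self]
      intro A hA hA'
      simp only [mem_extending, remaining, Finset.mem_sdiff, Finset.mem_powersetCard] at hA
      exact heG (hA.1.1.1 hA')
    have hD : ∀ i < j, (⟨e, he⟩ : Fin n) ∉ D i := fun i hi h =>
      heG ((Finset.mem_powersetCard.1 (env.mem i hi)).1 h)
    rw [hrun, ← hU, ← hp' B (hU ▸ inv.nonempty)]
    simp only [incr, skip, Program.run, PMF.pure_bind]
    refine hF _ _ ⟨hU ▸ inv.nonempty, by simp [inv.nat9], ?_, by simp [inv.nat12],
      by simp [inv.real2], inv.set2, ?_, inv.real3, ?_, inv.set, ?_⟩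
    · simp [inv.nat11, card_filter_le_succ_of_notMem he heG]
    · rw [filter_below_succ he hB, Finset.filter_true_of_mem
        (fun i hi => hD i (Finset.mem_range.1 (Finset.mem_filter.1 hi).1))]
      exact inv.set3
    · intro a ha
      simp [show a ≠ 9 by omega, show a ≠ 15 by omega, inv.nat a ha]
    · have := inv.steps
      simp; omega

/-- The first pass is peeled off, as the conditional laws refine from the front. After all n
elements the prefix is the set itself, so the remaining law is a point mass. -/
theorem sampleLoop_coupled (env : SampleEnv G k j D s₀) {c : ℕ} (hc : e + c = n)
    (inv : SampleInv G k j D s₀ e T e B s) :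
    Coupled (uniform (extending (remaining G k j D) e B))
      (iterate (fun s' => (Program.ite (.mem (natReg 9) (.lit 1)) sampleStepProg skip ;;
        incr 9).run g (s'.tick 1)) c s) (SamplePost s₀ (T + c * (9 * j + 17))) := by
  induction c generalizing e T B s with
  | zero =>
    obtain rfl : e = n := by omega
    have h1 : extending (remaining G k j D) e B = {B} := by
      have hne := inv.nonempty
      have hsub : extending (remaining G k j D) e B ⊆ {B} := by
        intro A hA
        rw [mem_extending, below_of_le le_rfl] at hA
        simp [hA.2]
      exact (Finset.subset_singleton_iff.1 hsub).resolve_left hne.ne_empty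
    rw [h1, uniform_singleton]
    refine Coupled.of_support fun s' hs' => ?_
    simp only [iterate, PMF.support_pure, Set.mem_singleton_iff] at hs'
    subst hs'
    exact ⟨inv.set2, inv.nat, inv.set, by have := inv.steps; omega⟩
  | succ c ih =>
    rw [iterate]
    refine sampleBody_coupled env inv (by omega)
      (p' := fun B' => uniform (extending (remaining G k j D) (e + 1) B')) (fun _ _ => rfl)
      fun B' s' inv' => ?_
    refine (ih (by omega) inv').mono fun A s'' h => { h with steps := h.steps.trans ?_ }
    ring_nf
    omega

/-- The sampler draws a uniformly random set. -/
theorem sampleProg_coupled (env : SampleEnv G k j D s) :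
    Coupled (uniform (remaining G k j D)) (sampleProg.run g s)
      fun A s' => A ∈ remaining G k j D ∧
        SamplePost s (s.steps + 3 * j + 3 * k + 10 + n * (9 * j + 17)) A s' := by
  have hne := env.nonempty
  have hk : s.nat 12 ≤ s.nat 11 := by
    rw [env.nat11, env.nat12]
    obtain ⟨A, hA⟩ := hne
    have := Finset.mem_powersetCard.1 (Finset.mem_sdiff.1 hA).1
    exact this.2 ▸ Finset.card_le_card this.1
  refine (Coupled.and_mem_support ?_).mono fun A s' h =>
    ⟨mem_of_mem_support_uniform hne h.2, h.1⟩
  rw [sampleProg]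
  refine Coupled.seq_det (sampleInitProg_ensures env.set9 hk
    fun s₁ b2 b3 r3 r2 n9 hn hs ht => ?_)
  have e0 : (natReg 0).eval s₁ = n := by
    simp only [NatExpr.eval]
    rw [hn 0 (by norm_num) (by norm_num), env.nat0]
  rw [Program.run, e0]
  have inv : SampleInv G k j D s 0 (s.steps + 3 * j + 3 * k + 10) 0 ∅ (s₁.tick 1) := by
    have n11 : s₁.nat 11 = G.card := by rw [hn 11 (by norm_num) (by norm_num), env.nat11]
    have n12 : s₁.nat 12 = k := by rw [hn 12 (by norm_num) (by norm_num), env.nat12]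
    refine ⟨by rwa [extending_zero], n9, ?_, ?_, ?_, ?_, ?_, ?_, ?_, hs, ?_⟩
    · simp [n11]
    · simp [n12]
    · simp [r2, n11, n12, env.nat11, env.nat12]
    · simp [b2]
    · simp [b3, below_zero, env.nat13]
    · simp [b3, r3]
    · intro a ha
      exact hn a (by omega) (by omega)
    · rw [env.nat13, env.nat12] at ht
      simp; omega
  have := sampleLoop_coupled (g := g) env (zero_add n) inv
  rwa [extending_zero] at this

end sampler

/-! ### Correctness of the smoothing set and the sampled family -/

section family
variable {n : ℕ} {g : Finset (Fin n) → ℝ} {s : State} {Q : State → Prop}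

/-- The memory when the smoothing set `H` and the first `j` sampled sets `D` have been drawn. -/
structure FamilyEnv (m t h : ℕ) (H : Finset (Fin n)) (j : ℕ) (D : ℕ → Finset (Fin n))
    (s : State) : Prop where
  nat0 : s.nat 0 = n
  nat1 : s.nat 1 = m
  nat2 : s.nat 2 = t
  nat3 : s.nat 3 = h
  card : H.card = h
  set1 : s.set 1 = encode H
  set4 : s.set 4 = encode H
  set9 : s.set 9 = ∅
  sets : ∀ i < j, s.set (16 + i) = encode (D i)
  mem : ∀ i < j, D i ∈ Finset.powersetCard t H
  inj : Set.InjOn D (Finset.range j)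

variable {m t h j T : ℕ} {H : Finset (Fin n)} {D : ℕ → Finset (Fin n)}

theorem card_remaining (mem : ∀ i < j, D i ∈ Finset.powersetCard t H)
    (inj : Set.InjOn D (Finset.range j)) :
    (remaining H t j D).card = H.card.choose t - j := by
  rw [remaining, Finset.card_sdiff_of_subset, Finset.card_image_of_injOn inj,
    Finset.card_powersetCard, Finset.card_range]
  intro A hA
  obtain ⟨i, hi, rfl⟩ := Finset.mem_image.1 hA
  exact mem i (Finset.mem_range.1 hi)

theorem remaining_zero : remaining H t 0 D = Finset.powersetCard t H := by
  simp [remaining]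

theorem FamilyEnv.mono {j' : ℕ} (env : FamilyEnv m t h H j D s) (hj : j' ≤ j) :
    FamilyEnv m t h H j' D s :=
  { env with
    sets := fun i hi => env.sets i (by omega)
    mem := fun i hi => env.mem i (by omega)
    inj := env.inj.mono (by intro i; simp; omega) }

theorem drawProg_coupled (env : FamilyEnv m t h H j D s) (hj : s.nat 13 = j)
    (hjt : j < h.choose t) :
    Coupled (uniform (remaining H t j D)) (drawProg.run g s)
      fun A s' => A ∈ remaining H t j D ∧
        SamplePost s (s.steps + 3 * j + 3 * t + 12 + n * (9 * j + 17)) A s' := by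
  rw [drawProg]
  refine Coupled.seq_det ?_
  simp only [ensures_seq, ensures_setNat]
  refine (sampleProg_coupled (G := H) (k := t) (j := j) (D := D) ?_).mono ?_
  · refine ⟨by simp [env.nat0], by simp [env.nat3, env.card], by simp [env.nat2], by simp [hj],
      by simp [env.set1], by simp [env.set9], by simpa using env.sets, env.mem, env.inj, ?_⟩
    rw [← Finset.card_pos, card_remaining env.mem env.inj, env.card]
    omega
  · rintro A s' ⟨hA, post⟩
    refine ⟨hA, post.set2, fun a ha => ?_, fun a ha hb => by simp [post.set a ha hb], ?_⟩
    · rw [post.nat a ha]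
      simp [show a ≠ 11 by omega, show a ≠ 12 by omega]
    · refine post.steps.trans (le_of_eq ?_)
      simp
      ring

theorem FamilyEnv.of_samplePost (env : FamilyEnv m t h H j D s) {A : Finset (Fin n)} {s' : State}
    (post : SamplePost s T A s') : FamilyEnv m t h H j D s' :=
  { env with
    nat0 := (post.nat 0 (by norm_num)).trans env.nat0
    nat1 := (post.nat 1 (by norm_num)).trans env.nat1
    nat2 := (post.nat 2 (by norm_num)).trans env.nat2
    nat3 := (post.nat 3 (by norm_num)).trans env.nat3
    set1 := (post.set 1 (by norm_num) (by norm_num)).trans env.set1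
    set4 := (post.set 4 (by norm_num) (by norm_num)).trans env.set4
    set9 := (post.set 9 (by norm_num) (by norm_num)).trans env.set9
    sets := fun i hi => (post.set (16 + i) (by omega) (by omega)).trans (env.sets i hi) }

theorem card_fin_le (A : Finset (Fin n)) : A.card ≤ n := by
  simpa using Finset.card_le_univ A

/-- The new set is stored under index `j`. It avoids the image of the earlier indices, which is what
keeps the sequence injective and hence the family of the right size. -/
theorem familyBody_coupled (env : FamilyEnv m t h H j D s) (hj : s.nat 13 = j)
    (hjt : j < h.choose t) :
    Coupled ((uniform (Finset.powersetCard t H \ (Finset.range j).image D)).bind fun A =>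
        PMF.pure (insert A ((Finset.range j).image D)))
      ((drawProg ;; (.union (sampleAddr (natReg 13)) (.lit 2) (.lit 2) ;; incr 13)).run g s)
      fun F s' => ∃ D', FamilyEnv m t h H (j + 1) D' s' ∧ s'.nat 13 = j + 1 ∧
        F = (Finset.range (j + 1)).image D' ∧
        s'.steps ≤ s.steps + 3 * j + 3 * t + 14 + n * (9 * j + 19) ∧
        ∀ a, a < 16 → a ≠ 2 → a ≠ 3 → s'.set a = s.set a := by
  rw [Program.run]
  refine (drawProg_coupled env hj hjt).bind fun A s₁ h1 => Coupled.of_ensures ?_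
  obtain ⟨hA, post⟩ := h1
  have env₁ := env.of_samplePost post
  have n13 : s₁.nat 13 = j := (post.nat 13 (Or.inr rfl)).trans hj
  have hA' := Finset.mem_sdiff.1 hA
  simp only [ensures_seq, incr, ensures_union, ensures_setNat]
  have hDi : ∀ i < j, Function.update D j A i = D i := fun i hi =>
    Function.update_of_ne (by omega) _ _
  have himg : (Finset.range j).image (Function.update D j A) = (Finset.range j).image D :=
    Finset.image_congr fun i hi => hDi i (by simpa using hi)
  refine ⟨Function.update D j A, ?_, by simp [n13], ?_, ?_, ?_⟩
  · refine ⟨by simp [env₁.nat0], by simp [env₁.nat1], by simp [env₁.nat2], by simp [env₁.nat3],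
      env.card, ?_, ?_, ?_, ?_, ?_, ?_⟩
    · simp [show (1 : ℕ) ≠ 16 + s₁.nat 13 by omega, env₁.set1]
    · simp [show (4 : ℕ) ≠ 16 + s₁.nat 13 by omega, env₁.set4]
    · simp [show (9 : ℕ) ≠ 16 + s₁.nat 13 by omega, env₁.set9]
    · intro i hi
      rcases Nat.lt_succ_iff_lt_or_eq.1 hi with h' | rfl
      · rw [hDi i h']
        simp [n13, show i ≠ j by omega, env₁.sets i h']
      · simp [n13, post.set2]
    · intro i hi
      rcases Nat.lt_succ_iff_lt_or_eq.1 hi with h' | rfl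
      · rw [hDi i h']; exact env.mem i h'
      · simpa using hA'.1
    · intro a ha b hb hab
      simp only [Finset.coe_range, Set.mem_Iio] at ha hb
      rcases Nat.lt_succ_iff_lt_or_eq.1 ha with ha' | rfl <;>
      rcases Nat.lt_succ_iff_lt_or_eq.1 hb with hb' | rfl
      · rw [hDi a ha', hDi b hb'] at hab
        exact env.inj (by simpa using ha') (by simpa using hb') hab
      · rw [hDi a ha', Function.update_self] at hab
        exact absurd (Finset.mem_image.2 ⟨a, by simpa using ha', hab⟩) hA'.2
      · rw [hDi b hb', Function.update_self] at hab
        exact absurd (Finset.mem_image.2 ⟨b, by simpa using hb', hab.symm⟩) hA'.2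
      · rfl
  · rw [Finset.range_add_one, Finset.image_insert, himg, Function.update_self]
  · have h2 := post.steps
    have h3 : (s₁.set 2).card ≤ n := by rw [post.set2, card_encode]; exact card_fin_le A
    simp
    ring_nf at h2 ⊢
    omega
  · intro a ha hb hc
    simp [show a ≠ 16 + s₁.nat 13 by omega, post.set a hb hc]

/-- Here passes are appended at the end, unlike in the sampler: the law of an unordered i-family
becomes that of an (i+1)-family by adding one more set. -/
theorem Coupled.iterate {β : Type*} {F : State → PMF State} (p : ℕ → PMF β)
    (q : ℕ → β → PMF β) (R : ℕ → β → State → Prop) {k : ℕ}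
    (hp : ∀ i < k, (p i).bind (q i) = p (i + 1)) (h0 : Coupled (p 0) (PMF.pure s) (R 0))
    (hs : ∀ i < k, ∀ b s', R i b s' → Coupled (q i b) (F s') (R (i + 1))) :
    Coupled (p k) (NoisySubmodular.iterate F k s) (R k) := by
  induction k with
  | zero => exact h0
  | succ k ih =>
    rw [iterate_succ', ← hp k (by omega)]
    exact (ih (fun i hi => hp i (by omega)) (fun i hi => hs i (by omega))).bind (hs k (by omega))

theorem familyProg_coupled (env : FamilyEnv m t h H 0 D s) (hj : s.nat 13 = 0)
    (hmt : m ≤ h.choose t) :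
    Coupled (uniform (Finset.powersetCard m (Finset.powersetCard t H))) (familyProg.run g s)
      fun F s' => ∃ D', FamilyEnv m t h H m D' s' ∧ F = (Finset.range m).image D' ∧
        s'.steps ≤ s.steps + 1 + m * (3 * m + 3 * t + 15 + n * (9 * m + 19)) ∧
        ∀ a, a < 16 → a ≠ 2 → a ≠ 3 → s'.set a = s.set a := by
  rw [familyProg, Program.run]
  have e1 : (natReg 1).eval s = m := env.nat1
  rw [e1]
  refine (Coupled.iterate (fun i => uniform (Finset.powersetCard i (Finset.powersetCard t H)))
    (fun i F => (uniform (Finset.powersetCard t H \ F)).bind fun A => PMF.pure (insert A F))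
    (fun i F s' => ∃ D', FamilyEnv m t h H i D' s' ∧ s'.nat 13 = i ∧
      F = (Finset.range i).image D' ∧
        s'.steps ≤ s.steps + 1 + i * (3 * m + 3 * t + 15 + n * (9 * m + 19)) ∧
        ∀ a, a < 16 → a ≠ 2 → a ≠ 3 → s'.set a = s.set a) ?_ ?_ ?_).mono ?_
  · intro i hi
    refine uniform_powersetCard_succ ?_
    rw [Finset.card_powersetCard, env.card]
    omega
  · rw [Finset.powersetCard_zero, uniform_singleton]
    refine Coupled.of_support fun s' hs' => ?_
    simp only [PMF.support_pure, Set.mem_singleton_iff] at hs'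
    subst hs'
    exact ⟨D, { env with }, hj, by simp, by simp, fun a _ _ _ => rfl⟩
  · rintro i hi F s' ⟨D', env', h13, rfl, ht, hset⟩
    have env'' : FamilyEnv m t h H i D' (s'.tick 1) := { env' with }
    refine (familyBody_coupled env'' h13 (by omega)).mono ?_
    rintro F s'' ⟨D'', a1, a2, a3, a4, a5⟩
    refine ⟨D'', a1, a2, a3, ?_, fun a ha hb hc => (a5 a ha hb hc).trans (hset a ha hb hc)⟩
    have hle : n * (9 * i + 19) ≤ n * (9 * m + 19) := Nat.mul_le_mul_left _ (by omega)
    have hle2 : 3 * i ≤ 3 * m := by omega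
    simp at a4
    rw [Nat.add_one_mul]
    omega
  · rintro F s' ⟨D', a1, a2, a3, a4, a5⟩
    exact ⟨D', a1, a3, a4, a5⟩

theorem encode_univ : encode (Finset.univ : Finset (Fin n)) = Finset.range n := by
  ext i
  simp only [encode, Finset.mem_map, Finset.mem_univ, true_and, Finset.mem_range,
    Fin.valEmbedding_apply]
  exact ⟨fun ⟨x, hx⟩ => hx ▸ x.2, fun h => ⟨⟨i, h⟩, rfl⟩⟩

theorem groundProg_ensures (h0 : s.nat 0 = n) (h1 : s.set 1 = ∅)
    (hQ : ∀ s', s'.set 1 = encode (Finset.univ : Finset (Fin n)) →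
      (∀ a, a ≠ 9 → s'.nat a = s.nat a) → (∀ a, a ≠ 1 → s'.set a = s.set a) →
      s'.steps ≤ s.steps + 2 + 3 * n → Q s') :
    groundProg.Ensures g s Q := by
  simp only [groundProg, ensures_seq, ensures_setNat]
  refine Program.Ensures.loop n (fun i s' => s'.nat 9 = i ∧ s'.set 1 = Finset.range i ∧
      (∀ a, a ≠ 9 → s'.nat a = s.nat a) ∧ (∀ a, a ≠ 1 → s'.set a = s.set a) ∧
      s'.steps ≤ s.steps + 2 + 3 * i) (by simp [h0]) ?_ ?_ ?_
  · simp +contextual [h1]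
  · rintro i - s' ⟨a1, a2, a3, a4, a5⟩
    simp only [ensures_seq, incr, ensures_insert, ensures_setNat]
    refine ⟨by simp [a1], by simp [a1, a2, Finset.range_add_one], fun a ha => by simp [ha, a3],
      fun a ha => by simp [ha, a4], by simp; omega⟩
  · rintro s' ⟨a1, a2, a3, a4, a5⟩
    exact hQ s' (a2.trans encode_univ.symm) a3 a4 a5

theorem smoothingProg_coupled (h0 : s.nat 0 = n) (h1 : s.nat 1 = m) (h2 : s.nat 2 = t)
    (h3 : s.nat 3 = h) (hs : ∀ a, s.set a = ∅) (hh : h ≤ n) :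
    Coupled (uniform (Finset.powersetCard h (Finset.univ : Finset (Fin n)))) (smoothingProg.run g s)
      fun H s' => FamilyEnv m t h H 0 (fun _ => ∅) s' ∧ s'.nat 13 = 0 ∧
        s'.set 5 = ∅ ∧ s'.set 6 = ∅ ∧ s'.steps ≤ s.steps + 24 * n + 3 * h + 17 := by
  rw [smoothingProg]
  refine Coupled.seq_det ?_
  simp only [ensures_seq]
  refine groundProg_ensures h0 (hs 1) fun s₁ g1 gn gs gt => ?_
  simp only [ensures_setNat]
  rw [Program.run, ← PMF.bind_pure (uniform _),
    ← remaining_zero (D := fun _ => (∅ : Finset (Fin n)))]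
  refine (sampleProg_coupled (G := Finset.univ) (k := h) (j := 0) (D := fun _ => ∅) ?_).bind ?_
  · refine ⟨by simp [gn, h0], by simp [gn, h0], by simp [gn, h3], by simp, by simp [g1],
      by simp [gs, hs], by simp, by simp, by simp, ?_⟩
    rw [remaining_zero]
    exact Finset.powersetCard_nonempty.2 (by simpa using hh)
  · rintro H s₂ ⟨hH, post⟩
    rw [remaining_zero, Finset.mem_powersetCard] at hH
    refine Coupled.of_ensures ?_
    simp only [ensures_seq, ensures_union]
    have p0 := post.nat 0 (by norm_num)
    have p1 := post.nat 1 (by norm_num)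
    have p2 := post.nat 2 (by norm_num)
    have p3 := post.nat 3 (by norm_num)
    have p13 := post.nat 13 (by norm_num)
    have q5 := post.set 5 (by norm_num) (by norm_num)
    have q6 := post.set 6 (by norm_num) (by norm_num)
    have q9 := post.set 9 (by norm_num) (by norm_num)
    simp [gn, gs, hs] at p0 p1 p2 p3 p13 q5 q6 q9
    refine ⟨⟨?_, ?_, ?_, ?_, hH.2, ?_, ?_, ?_, by simp, by simp, by simp⟩, ?_, ?_, ?_, ?_⟩
    · simp [p0, h0]
    · simp [p1, h1]
    · simp [p2, h2]
    · simp [p3, h3]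
    · simp [post.set2]
    · simp [post.set2]
    · simp [q9]
    · simp [p13]
    · simp [q5]
    · simp [q6]
    · have a1 := post.steps
      have a2 := card_fin_le H
      simp [post.set2] at a1 ⊢
      omega

end family

/-! ### Correctness of double greedy -/

section greedy
variable {n : ℕ} {g : Finset (Fin n) → ℝ} {s s' : State} {Q : State → Prop}
variable {m t h j e : ℕ} {H S X Y : Finset (Fin n)} {D : ℕ → Finset (Fin n)}

theorem FamilyEnv.congr (env : FamilyEnv m t h H j D s) (hn : ∀ a, a ≤ 3 → s'.nat a = s.nat a)
    (hs : ∀ a, a ≠ 5 → a ≠ 6 → a ≠ 7 → a ≠ 8 → s'.set a = s.set a) :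
    FamilyEnv m t h H j D s' :=
  { env with
    nat0 := (hn 0 (by norm_num)).trans env.nat0
    nat1 := (hn 1 (by norm_num)).trans env.nat1
    nat2 := (hn 2 (by norm_num)).trans env.nat2
    nat3 := (hn 3 (by norm_num)).trans env.nat3
    set1 := (hs 1 (by norm_num) (by norm_num) (by norm_num) (by norm_num)).trans env.set1
    set4 := (hs 4 (by norm_num) (by norm_num) (by norm_num) (by norm_num)).trans env.set4
    set9 := (hs 9 (by norm_num) (by norm_num) (by norm_num) (by norm_num)).trans env.set9
    sets := fun i hi =>
      (hs (16 + i) (by omega) (by omega) (by omega) (by omega)).trans (env.sets i hi) }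

/-- The program sums over indices and divides by m; injectivity of `D` identifies this with the
average over the family as a set. -/
theorem surrogateProg_ensures (env : FamilyEnv m t h H m D s) (h7 : s.set 7 = encode S)
    (hQ : ∀ s', s'.real 7 = surrogate g ((Finset.range m).image D) S →
      (∀ a, a ≠ 10 → s'.nat a = s.nat a) → (∀ a, a ≠ 7 → a ≠ 8 → s'.real a = s.real a) →
      (∀ a, a ≠ 8 → s'.set a = s.set a) → s'.steps ≤ s.steps + 4 + m * (2 * n + 5) → Q s') :
    surrogateProg.Ensures g s Q := by
  simp only [surrogateProg, ensures_seq, ensures_setNat, ensures_setReal]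
  refine Program.Ensures.loop m (fun i s' => s'.nat 10 = i ∧
      s'.real 7 = ∑ x ∈ Finset.range i, g (S ∪ D x) ∧
      (∀ a, a ≠ 10 → s'.nat a = s.nat a) ∧ (∀ a, a ≠ 7 → a ≠ 8 → s'.real a = s.real a) ∧
      (∀ a, a ≠ 8 → s'.set a = s.set a) ∧
      s'.steps ≤ s.steps + 3 + i * (2 * n + 5)) (by simp [env.nat1]) ?_ ?_ ?_
  · simp +contextual
  · rintro i hi s' ⟨a1, a2, a3, a4, a5, a6⟩
    have e7 : s'.set 7 = encode S := by rw [a5 7 (by norm_num), h7]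
    have ei : s'.set (16 + i) = encode (D i) := by rw [a5 (16 + i) (by omega), env.sets i hi]
    simp only [ensures_seq, incr, ensures_union, ensures_query, ensures_setNat, ensures_setReal]
    simp only [State.tick, NatExpr.eval, RealExpr.eval, a1, e7, ei, encode_union, card_encode]
    refine ⟨by simp [a1], ?_, fun a ha => by simp [ha, a3], fun a ha hb => by simp [ha, hb, a4],
      fun a ha => by simp [ha, a5], ?_⟩
    · rw [Finset.sum_range_succ, ← a2]
      simp only [Function.update_apply, if_true]
      rw [State.subset_of_encode (A := S ∪ D i) (by simp)]
      simp
    · have h1 := card_fin_le S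
      have h2 := card_fin_le (D i)
      rw [Nat.add_one_mul]
      simp
      omega
  · rintro s' ⟨a1, a2, a3, a4, a5, a6⟩
    refine hQ _ ?_ (fun a ha => by simp [ha, a3]) (fun a ha hb => by simp [ha, hb, a4])
      (fun a ha => by simp [ha, a5]) (by simp; omega)
    simp [a2, a3, env.nat1]
    rw [surrogate, Finset.sum_image (fun a ha b hb hab => env.inj ha hb hab),
      Finset.card_image_of_injOn env.inj, Finset.card_range]

/-- The condition between two steps of double greedy. -/
structure GreedyEnv (m t h : ℕ) (H : Finset (Fin n)) (D : ℕ → Finset (Fin n)) (e T : ℕ)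
    (X Y : Finset (Fin n)) (s : State) : Prop where
  env : FamilyEnv m t h H m D s
  nat9 : s.nat 9 = e
  set5 : s.set 5 = encode X
  set6 : s.set 6 = encode Y
  steps : s.steps ≤ T

theorem marginalProg_ensures {T : ℕ} (env : GreedyEnv m t h H D e T X Y s) (he : e < n)
    (hQ : ∀ s', GreedyEnv m t h H D e (T + 4 * (m * (2 * n + 5)) + 4 * n + 24) X Y s' →
      s'.real 9 = surrogate g ((Finset.range m).image D) (insert ⟨e, he⟩ X) -
        surrogate g ((Finset.range m).image D) X →
      s'.real 11 = surrogate g ((Finset.range m).image D) (Y.erase ⟨e, he⟩) -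
        surrogate g ((Finset.range m).image D) Y → Q s') :
    marginalProg.Ensures g s Q := by
  simp only [marginalProg, ensures_seq, ensures_union]
  refine surrogateProg_ensures (S := X) (env.env.congr (by simp)
    fun a _ _ h7 _ => by simp [h7]) (by simp [env.set5]) fun s₁ r7 hn hr hs ht => ?_
  simp [env.set5] at hn hr hs ht
  simp only [ensures_setReal, ensures_insert]
  have env₁ := env.env.congr (s' := s₁) (fun a ha => hn a (by omega))
    (fun a _ _ h7 h8 => by simp [hs a h8, h7])
  have x7 : s₁.set 7 = encode X := by simp [hs 7 (by norm_num)]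
  have x5 : s₁.set 5 = encode X := by simp [hs 5 (by norm_num), env.set5]
  have x6 : s₁.set 6 = encode Y := by simp [hs 6 (by norm_num), env.set6]
  have n9 : s₁.nat 9 = e := by simp [hn 9 (by norm_num), env.nat9]
  refine surrogateProg_ensures (S := insert ⟨e, he⟩ X) (env₁.congr (by simp)
    fun a _ _ h7 _ => by simp [h7]) (by simp [x7, n9, encode_insert _ he])
    fun s₂ r7' hn' hr' hs' ht' => ?_
  simp at hn' hr' hs' ht'
  have env₂ := env₁.congr (s' := s₂) (fun a ha => hn' a (by omega))
    (fun a _ _ h7 h8 => by simp [hs' a h8, h7])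
  have y5 : s₂.set 5 = encode X := by simp [hs' 5 (by norm_num), x5]
  have y6 : s₂.set 6 = encode Y := by simp [hs' 6 (by norm_num), x6]
  have m9 : s₂.nat 9 = e := by simp [hn' 9 (by norm_num), n9]
  have q10 : s₂.real 10 = surrogate g ((Finset.range m).image D) X := by
    simp [hr' 10 (by norm_num) (by norm_num), r7]
  refine surrogateProg_ensures (S := Y) (env₂.congr (by simp)
    fun a _ _ h7 _ => by simp [h7]) (by simp [y6]) fun s₃ r7'' hn'' hr'' hs'' ht'' => ?_
  simp [y6] at hn'' hr'' hs'' ht''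
  simp only [ensures_setReal, ensures_erase]
  have env₃ := env₂.congr (s' := s₃) (fun a ha => hn'' a (by omega))
    (fun a _ _ h7 h8 => by simp [hs'' a h8, h7])
  have z7 : s₃.set 7 = encode Y := by simp [hs'' 7 (by norm_num)]
  have z5 : s₃.set 5 = encode X := by simp [hs'' 5 (by norm_num), y5]
  have z6 : s₃.set 6 = encode Y := by simp [hs'' 6 (by norm_num), y6]
  have l9 : s₃.nat 9 = e := by simp [hn'' 9 (by norm_num), m9]
  have p9 : s₃.real 9 = surrogate g ((Finset.range m).image D) (insert ⟨e, he⟩ X) -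
        surrogate g ((Finset.range m).image D) X := by
    simp [hr'' 9 (by norm_num) (by norm_num), r7', q10]
  refine surrogateProg_ensures (S := Y.erase ⟨e, he⟩) (env₃.congr (by simp)
    fun a _ _ h7 _ => by simp [h7]) (by simp [z7, l9, encode_erase _ he])
    fun s₄ r7₄ hn₄ hr₄ hs₄ ht₄ => ?_
  simp at hn₄ hr₄ hs₄ ht₄
  refine hQ _ ⟨env₃.congr (fun a ha => ?_) (fun a _ _ h7 h8 => ?_), ?_, ?_, ?_, ?_⟩ ?_ ?_
  · exact hn₄ a (by omega)
  · simp [hs₄ a h8, h7]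
  · simp [hn₄ 9 (by norm_num), l9]
  · simp [hs₄ 5 (by norm_num), z5]
  · simp [hs₄ 6 (by norm_num), z6]
  · have h1 := card_fin_le X
    have h2 := card_fin_le Y
    have h3 := env.steps
    simp
    omega
  · simp [hr₄ 9 (by norm_num) (by norm_num), p9]
  · simp [hr₄ 10 (by norm_num) (by norm_num), r7₄, r7'']

theorem greedyStepProg_coupled {T : ℕ} (env : GreedyEnv m t h H D e T X Y s) (he : e < n) :
    Coupled (coin (acceptProb (surrogate g ((Finset.range m).image D) (insert ⟨e, he⟩ X) -
        surrogate g ((Finset.range m).image D) X)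
        (surrogate g ((Finset.range m).image D) (Y.erase ⟨e, he⟩) -
        surrogate g ((Finset.range m).image D) Y))) (greedyStepProg.run g s)
      fun b s' => GreedyEnv m t h H D e (T + 4 * (m * (2 * n + 5)) + 4 * n + 30)
        (if b then insert ⟨e, he⟩ X else X) (if b then Y else Y.erase ⟨e, he⟩) s' := by
  rw [greedyStepProg]
  refine Coupled.seq_det (marginalProg_ensures env he fun s₁ env₁ r9 r11 => ?_)
  rw [← r9, ← r11]
  refine Coupled.seq_det ?_
  have key : acceptProbProg.Ensures g s₁ fun s₂ =>
      GreedyEnv m t h H D e (T + 4 * (m * (2 * n + 5)) + 4 * n + 27) X Y s₂ ∧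
        s₂.real 12 = acceptProb (s₁.real 9) (s₁.real 11) := by
    have ht := env₁.steps
    simp only [acceptProbProg, ensures_ite, ensures_setReal, acceptProb]
    refine ⟨fun h1 => ⟨fun h2 => ?_, fun h2 => ?_⟩, fun h1 => ?_⟩ <;>
      simp at h1
    · simp at h2
      exact ⟨{ env₁ with env := { env₁.env with }, steps := by simp; omega }, by simp [h1, h2]⟩
    · simp at h2
      exact ⟨{ env₁ with env := { env₁.env with }, steps := by simp; omega },
        by simp [h1, not_lt.2 h2]⟩
    · exact ⟨{ env₁ with env := { env₁.env with }, steps := by simp; omega },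
        by simp [not_lt.2 h1]⟩
  refine key.mono ?_
  rintro s₂ ⟨env₂, r12⟩
  rw [Program.run, ← PMF.bind_pure (coin _), ← r12]
  have hf := Coupled.flip (g := g) (s := s₂) (.lit 8) (realReg 12)
  refine hf.bind fun b s₃ hs₃ => Coupled.of_ensures ?_
  have ht := env₂.steps
  have n9 : s₃.nat 9 = e := by simp [hs₃, env₂.nat9]
  have x5 : s₃.set 5 = encode X := by simp [hs₃, env₂.set5]
  have x6 : s₃.set 6 = encode Y := by simp [hs₃, env₂.set6]
  have env₃ : FamilyEnv m t h H m D s₃ := env₂.env.congr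
    (fun a ha => by simp [hs₃, show a ≠ 8 by omega]) (fun a _ _ _ _ => by simp [hs₃])
  have t3 : s₃.steps = s₂.steps + 1 := by simp [hs₃]
  have n8 : s₃.nat 8 = if b then 1 else 0 := by simp [hs₃]
  simp only [ensures_ite, ensures_insert, ensures_erase]
  cases b
  · refine ⟨fun h1 => absurd h1 (by simp [n8]), fun _ => ⟨env₃.congr (fun a ha => by simp)
      (fun a _ h6 _ _ => by simp [h6]), by simp [n9], by simp [x5], ?_, by simp; omega⟩⟩
    simp [x6, n9, encode_erase _ he]
  · refine ⟨fun _ => ⟨env₃.congr (fun a ha => by simp)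
      (fun a h5 _ _ _ => by simp [h5]), by simp [n9], ?_, by simp [x6], by simp; omega⟩,
      fun h1 => absurd (by simp [n8]) h1⟩
    simp [x5, n9, encode_insert _ he]

/-- The elements outside `H` that are not less than `e`, in increasing order. -/
def restList (H : Finset (Fin n)) (e : ℕ) : List (Fin n) :=
  ((List.finRange n).drop e).filter fun i => i ∉ H

theorem restList_eq (he : e < n) : restList H e =
    if (⟨e, he⟩ : Fin n) ∈ H then restList H (e + 1) else ⟨e, he⟩ :: restList H (e + 1) := by
  unfold restList
  rw [List.drop_eq_getElem_cons (by simpa using he)]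
  simp only [List.filter_cons, List.getElem_finRange, Fin.cast_mk]
  by_cases hH : (⟨e, he⟩ : Fin n) ∈ H <;> simp [hH]

/-- Scanning 0, ..., n-1 and skipping `H` visits the elements in the order in which the algorithm
processes them. -/
theorem sort_compl : (Finset.univ \ H).sort (· ≤ ·) = restList H 0 := by
  have h1 : (restList H 0).toFinset = Finset.univ \ H := by
    ext i; simp [restList]
  rw [← h1]
  refine (List.toFinset_sort (· ≤ ·) ?_).2 ?_
  · exact ((List.nodup_finRange n).sublist (List.drop_sublist _ _)).filter _
  · have : (List.finRange n).Pairwise (· ≤ ·) := (List.pairwise_lt_finRange n).imp le_of_lt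
    exact (this.sublist (List.drop_sublist _ _)).sublist List.filter_sublist

theorem greedyLoop_coupled {c T : ℕ} (hc : e + c = n) (env : GreedyEnv m t h H D e T X Y s) :
    Coupled (doubleGreedyFrom (surrogate g ((Finset.range m).image D)) (restList H e) X Y)
      (iterate (fun s' => (Program.ite (.mem (natReg 9) (.lit 4)) skip greedyStepProg ;;
        incr 9).run g (s'.tick 1)) c s)
      fun S s' => FamilyEnv m t h H m D s' ∧ s'.set 5 = encode S ∧
        s'.steps ≤ T + c * (4 * (m * (2 * n + 5)) + 4 * n + 33) := by
  induction c generalizing e T X Y s with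
  | zero =>
    have hl : restList H e = [] := by
      simp [restList, List.drop_eq_nil_of_le, show n ≤ e by omega]
    rw [hl, doubleGreedyFrom]
    refine Coupled.of_support fun s' hs' => ?_
    simp only [iterate, PMF.support_pure, Set.mem_singleton_iff] at hs'
    subst hs'
    exact ⟨env.env, env.set5, by simpa using env.steps⟩
  | succ c ih =>
    have he : e < n := by omega
    have hmem : (Test.mem (natReg 9) (.lit 4)).eval (s.tick 1) ↔ (⟨e, he⟩ : Fin n) ∈ H := by
      simp only [Test.eval, NatExpr.eval, State.tick]
      rw [env.nat9, env.env.set4, mem_encode he]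
    have ht := env.steps
    rw [iterate, Program.run, Program.run, restList_eq he]
    by_cases hH : (⟨e, he⟩ : Fin n) ∈ H
    · rw [if_pos (hmem.2 hH), if_pos hH]
      refine Coupled.support_bind (show (skip ;; incr 9).Ensures g ((s.tick 1).tick 1) _ from ?_)
      simp only [skip, incr, ensures_seq, ensures_setNat]
      refine (ih (e := e + 1) (T := T + 4) (X := X) (Y := Y) (by omega) ?_).mono ?_
      · exact ⟨env.env.congr (fun a ha => by simp [show a ≠ 9 by omega, show a ≠ 15 by omega])
          (fun a _ _ _ _ => by simp), by simp [env.nat9], by simp [env.set5], by simp [env.set6],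
          by simp; omega⟩
      · rintro S s' ⟨h1, h2, h3⟩
        refine ⟨h1, h2, h3.trans ?_⟩
        rw [Nat.add_one_mul c]
        omega
    · rw [if_neg (fun h => hH (hmem.1 h)), if_neg hH, doubleGreedyFrom, PMF.bind_bind]
      have env' : GreedyEnv m t h H D e (T + 2) X Y ((s.tick 1).tick 1) :=
        { env with env := { env.env with }, steps := by simp; omega }
      refine (greedyStepProg_coupled env' he).bind fun b s₁ env₁ => ?_
      have hdg : (if b then doubleGreedyFrom (surrogate g ((Finset.range m).image D))
            (restList H (e + 1)) (insert ⟨e, he⟩ X) Y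
          else doubleGreedyFrom (surrogate g ((Finset.range m).image D))
            (restList H (e + 1)) X (Y.erase ⟨e, he⟩)) =
          doubleGreedyFrom (surrogate g ((Finset.range m).image D)) (restList H (e + 1))
            (if b then insert ⟨e, he⟩ X else X) (if b then Y else Y.erase ⟨e, he⟩) := by
        cases b <;> simp
      rw [hdg]
      refine Coupled.support_bind (show (incr 9).Ensures g s₁ _ from ?_)
      rw [incr, ensures_setNat]
      refine (ih (e := e + 1) (T := T + (4 * (m * (2 * n + 5)) + 4 * n + 33)) (by omega)
        ⟨env₁.env.congr (fun a ha => by simp [show a ≠ 9 by omega])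
          (fun a _ _ _ _ => by simp), by simp [env₁.nat9], by simp [env₁.set5],
          by simp [env₁.set6], by have := env₁.steps; simp; omega⟩).mono ?_
      rintro S s' ⟨h1, h2, h3⟩
      refine ⟨h1, h2, h3.trans ?_⟩
      rw [Nat.add_one_mul c]
      omega

theorem complProg_ensures (env : FamilyEnv m t h H m D s) (h6 : s.set 6 = ∅)
    (hQ : ∀ s', FamilyEnv m t h H m D s' → s'.set 6 = encode (Finset.univ \ H) →
      s'.set 5 = s.set 5 → s'.steps ≤ s.steps + 2 + 4 * n → Q s') :
    complProg.Ensures g s Q := by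
  simp only [complProg, ensures_seq, ensures_setNat]
  refine Program.Ensures.loop n (fun i s' => s'.nat 9 = i ∧
      s'.set 6 = encode (below i (Finset.univ \ H)) ∧
      (∀ a, a ≤ 3 → s'.nat a = s.nat a) ∧ (∀ a, a ≠ 6 → s'.set a = s.set a) ∧
      s'.steps ≤ s.steps + 2 + 4 * i) (by simp [env.nat0]) ?_ ?_ ?_
  · refine ⟨by simp, by simp [h6, below_zero], fun a ha => by simp [show a ≠ 9 by omega],
      fun a ha => by simp, by simp⟩
  · rintro i hi s' ⟨a1, a2, a3, a4, a5⟩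
    have e4 : s'.set 4 = encode H := by rw [a4 4 (by norm_num), env.set4]
    have hB : ∀ x ∈ below i (Finset.univ \ H), (x : ℕ) < i := fun x hx => (mem_below.1 hx).2
    simp only [ensures_seq, ensures_ite, incr, skip, ensures_setNat, ensures_insert]
    simp only [Test.eval, NatExpr.eval, State.tick, a1, e4, mem_encode hi]
    refine ⟨fun hH => ⟨by simp [a1], ?_, fun a ha => ?_, fun a ha => by simp [a4 a ha],
      by simp; omega⟩, fun hH => ⟨by simp [a1], ?_, fun a ha => ?_,
      fun a ha => by simp [ha, a4 a ha], by simp; omega⟩⟩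
    · rw [(below_succ_eq_iff hi hB).2 ⟨rfl, by simp [hH]⟩]
      simp [a2]
    · simp [show a ≠ 9 by omega, show a ≠ 15 by omega, a3 a ha]
    · rw [(below_succ_eq_insert_iff hi hB).2 ⟨rfl, by simp [hH]⟩]
      simp [a2, encode_insert _ hi]
    · simp [show a ≠ 9 by omega, a3 a ha]
  · rintro s' ⟨a1, a2, a3, a4, a5⟩
    rw [below_of_le le_rfl] at a2
    exact hQ s' (env.congr a3 fun a _ ha _ _ => a4 a ha) a2 (a4 5 (by norm_num)) a5

theorem greedyProg_coupled (env : FamilyEnv m t h H m D s) (h5 : s.set 5 = ∅)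
    (h6 : s.set 6 = encode (Finset.univ \ H)) :
    Coupled (doubleGreedy (surrogate g ((Finset.range m).image D)) (Finset.univ \ H))
      (greedyProg.run g s)
      fun S s' => FamilyEnv m t h H m D s' ∧ s'.set 5 = encode S ∧
        s'.steps ≤ s.steps + 2 + n * (4 * (m * (2 * n + 5)) + 4 * n + 33) := by
  rw [greedyProg]
  refine Coupled.seq_det ?_
  simp only [ensures_setNat]
  rw [doubleGreedy, sort_compl, Program.run]
  have e0 : ∀ s₁ : State, s₁.nat 0 = n → (natReg 0).eval s₁ = n := fun s₁ h => h
  rw [e0 _ (by simp [env.nat0])]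
  refine greedyLoop_coupled (zero_add n) ⟨env.congr (fun a ha => by simp [show a ≠ 9 by omega])
    (fun a _ _ _ _ => by simp), by simp, by simp [h5], by simp [h6], by simp⟩

theorem outputProg_coupled (env : FamilyEnv m t h H m D s) (h5 : s.set 5 = encode S)
    (hht : t ≤ h) :
    Coupled ((uniform (Finset.powersetCard t H)).bind fun H' => PMF.pure (S ∪ H'))
      (outputProg.run g s)
      fun A s' => s'.set 0 = encode A ∧ s'.steps ≤ s.steps + 14 + 3 * t + 19 * n := by
  rw [outputProg]
  refine Coupled.seq_det ?_
  simp only [ensures_setNat]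
  rw [Program.run, ← remaining_zero (D := D)]
  refine (drawProg_coupled (m := m) (t := t) (h := h) (H := H) (j := 0) (D := D)
    ((env.mono (Nat.zero_le m)).congr (fun a ha => by simp [show a ≠ 13 by omega])
      (fun a _ _ _ _ => by simp)) (by simp) (Nat.choose_pos hht)).bind ?_
  rintro A s₁ ⟨-, post⟩
  refine Coupled.of_ensures ?_
  simp only [ensures_union]
  have p5 := post.set 5 (by norm_num) (by norm_num)
  simp [h5] at p5
  have ht := post.steps
  have h1 := card_fin_le A
  have h2 := card_fin_le S
  refine ⟨by simp [p5, post.set2, encode_union], ?_⟩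
  simp [p5, post.set2] at ht ⊢
  omega

end greedy

/-! ### The parameters -/

/-- Compare the falling factorial of ak with a^k k! factor by factor: ak - i ≥ a(k - i). -/
theorem pow_le_choose_mul (a k : ℕ) (ha : 1 ≤ a) : a ^ k ≤ (a * k).choose k := by
  have h1 : a ^ k * k.factorial ≤ (a * k).descFactorial k := by
    rw [Nat.descFactorial_eq_prod_range, ← Nat.descFactorial_self, Nat.descFactorial_eq_prod_range,
      ← Finset.card_range k, ← Finset.prod_const, Finset.card_range, ← Finset.prod_mul_distrib]
    refine Finset.prod_le_prod' fun i _ => ?_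
    rw [Nat.mul_sub]
    have : i ≤ a * i := Nat.le_mul_of_pos_left i ha
    omega
  rw [Nat.descFactorial_eq_factorial_mul_choose, mul_comm] at h1
  exact Nat.le_of_mul_le_mul_left h1 (Nat.factorial_pos k)

theorem two_le_paramT {n : ℕ} {ν ε : ℝ} (hm : paramM n ν ε ≠ 0) : 2 ≤ paramT n ν ε := by
  rw [paramT]
  by_contra h
  have h1 : 4 * paramM n ν ε ≤ 2 ^ Nat.clog 2 (4 * paramM n ν ε) :=
    Nat.le_pow_clog (by norm_num) _
  have h2 : 2 ^ Nat.clog 2 (4 * paramM n ν ε) ≤ 2 ^ 1 :=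
    Nat.pow_le_pow_right (by norm_num) (by omega)
  omega

/-- Guarantees that m distinct t-subsets exist for all inputs, not only for large n, so that the
sampler never runs out: C(t²,t) ≥ t^t ≥ 2^t ≥ 4m if m > 0. -/
theorem paramM_le_choose (n : ℕ) (ν ε : ℝ) :
    paramM n ν ε ≤ (paramH n ν ε).choose (paramT n ν ε) := by
  rcases Nat.eq_zero_or_pos (paramM n ν ε) with h0 | h0
  · rw [h0]; exact Nat.zero_le _
  · have h2 := two_le_paramT h0.ne'
    rw [paramH, sq]
    refine le_trans ?_ (pow_le_choose_mul _ _ (by omega))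
    refine le_trans ?_ (Nat.pow_le_pow_left h2 _)
    have h1 : 4 * paramM n ν ε ≤ 2 ^ paramT n ν ε := Nat.le_pow_clog (by norm_num) _
    omega

theorem paramT_le (n : ℕ) (ν ε : ℝ) : paramT n ν ε ≤ 4 * paramM n ν ε :=
  Nat.clog_le_of_le_pow (Nat.lt_pow_self (by norm_num)).le

theorem paramT_le_paramH (n : ℕ) (ν ε : ℝ) : paramT n ν ε ≤ paramH n ν ε :=
  Nat.le_self_pow (by norm_num) _

theorem paramInitProg_ensures {n : ℕ} {g : Finset (Fin n) → ℝ} {ν ε : ℝ} {Q : State → Prop}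
    (hQ : ∀ s, s.nat 0 = n → s.nat 7 = Nat.clog 2 (4 * n) → s.real 0 = ε →
      s.real 13 = max 2 (8 * ν ^ 2) → (∀ a, s.set a = ∅) → s.steps ≤ 16 * n + 7 → Q s) :
    paramInitProg.Ensures g (State.init n ν ε) Q := by
  simp only [paramInitProg, ensures_seq]
  rw [ensures_setNat]
  refine clogProg_ensures fun s₁ b7 bn br bs bt => ?_
  simp [State.init] at b7 bn br bs bt
  have c7 : s₁.nat 7 = Nat.clog 2 (4 * n) := by rw [b7]; congr 1; ring
  have e1 : s₁.real 1 = ν := by rw [br]; simp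
  have e0 : s₁.real 0 = ε := by rw [br]; simp
  have n0 : s₁.nat 0 = n := by rw [bn 0 (by norm_num)]; simp
  simp only [ensures_setReal, ensures_ite]
  refine ⟨fun h => ?_, fun h => ?_⟩
  · simp [e1] at h
    rw [skip, ensures_setNat]
    refine hQ _ (by simp [n0]) (by simp [c7]) (by simp [e0]) ?_ (by simp [bs]) (by simp; omega)
    simp [e1]
    rw [max_eq_right (by nlinarith), sq]
  · simp [e1] at h
    refine hQ _ (by simp [n0]) (by simp [c7]) (by simp [e0]) ?_ (by simp [bs]) (by simp; omega)
    simp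
    nlinarith

theorem paramProg_ensures {n : ℕ} {g : Finset (Fin n) → ℝ} {ν ε : ℝ} {Q : State → Prop}
    (hQ : ∀ s, s.nat 0 = n → s.nat 1 = paramM n ν ε → s.nat 2 = paramT n ν ε →
      s.nat 3 = paramH n ν ε → (∀ a, s.set a = ∅) →
      s.steps ≤ 16 * n + 17 * paramM n ν ε + paramH n ν ε + 25 → Q s) :
    paramProg.Ensures g (State.init n ν ε) Q := by
  simp only [paramProg, ensures_seq]
  refine paramInitProg_ensures fun s₂ e0 b7 h0 h13 hs ht => ?_
  simp only [ensures_setReal, ensures_ceil, ensures_setNat]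
  have hM : ⌈max 2 (8 * ν ^ 2) * (((n : ℝ) / ε) * ((n : ℝ) / ε)) *
      ((n : ℝ) + (Nat.clog 2 (4 * n) : ℝ))⌉₊ = paramM n ν ε := by
    rw [paramM, sq ((n : ℝ) / ε)]
  refine clogProg_ensures fun s₃ c7 cn cr cs ct => ?_
  simp [e0, h0, h13, b7, hM] at c7 cn cr cs ct
  have hT : s₃.nat 7 = paramT n ν ε := by
    rw [c7, paramT]; congr 1; ring
  have hH : ⌈(paramT n ν ε : ℝ) * (paramT n ν ε : ℝ)⌉₊ = paramH n ν ε := by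
    rw [← Nat.cast_mul, Nat.ceil_natCast, paramH, sq]
  refine hQ _ ?_ ?_ ?_ ?_ ?_ ?_
  · simp [cn 0 (by norm_num), e0]
  · simp [cn 1 (by norm_num)]
  · simp [hT]
  · simp [hT, hH]
  · intro a; simp [cs, hs]
  · simp [hT, hH]
    omega

/-! ### Correctness and running time of the program -/

/-- A bound for the number of steps, in terms of the parameters. -/
def stepBound (n m t h : ℕ) : ℕ :=
  (16 * n + 17 * m + h + 27) + (24 * n + 3 * h + 17) +
    (1 + m * (3 * m + 3 * t + 15 + n * (9 * m + 19))) + (2 + 4 * n) +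
    (2 + n * (4 * (m * (2 * n + 5)) + 4 * n + 33)) + (14 + 3 * t + 19 * n)

/-- The couplings of the phases are chained in the order of the random choices of the algorithm. The
output law and the cost of every run both follow from this statement. -/
theorem mainProg_coupled (n : ℕ) (ν ε : ℝ) (g : Finset (Fin n) → ℝ) :
    Coupled (noisyDoubleGreedy n ν ε g) (mainProg.run g (State.init n ν ε))
      fun A s => s.set 0 = encode A ∧
        s.steps ≤ stepBound n (paramM n ν ε) (paramT n ν ε) (paramH n ν ε) := by
  rw [mainProg]
  refine Coupled.seq_det (paramProg_ensures fun s h0 h1 h2 h3 hs ht => ?_)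
  have hlt : (Test.natLt (natReg 0) (natReg 3)).eval s ↔ n < paramH n ν ε := by
    simp [h0, h3]
  rw [noisyDoubleGreedy, metaAlgorithm]
  refine Coupled.ite (fun h => ?_) (fun h => ?_) <;> rw [hlt] at h
  · rw [if_neg (by omega)]
    refine Coupled.of_ensures ?_
    rw [skip, ensures_setNat]
    refine ⟨by simp [hs], ?_⟩
    simp only [stepBound, State.tick]
    omega
  · rw [if_pos (by omega)]
    set m := paramM n ν ε
    set t := paramT n ν ε
    set H₀ := paramH n ν ε
    have hmt : m ≤ H₀.choose t := paramM_le_choose n ν ε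
    have hth : t ≤ H₀ := paramT_le_paramH n ν ε
    rw [Program.run]
    refine (smoothingProg_coupled (m := m) (t := t) (s := s.tick 1) h0 h1 h2 h3 hs
      (by omega)).bind ?_
    rintro H s₁ ⟨env₁, n13, x5, x6, t1⟩
    rw [Program.run]
    refine (familyProg_coupled env₁ n13 hmt).bind ?_
    rintro F s₂ ⟨D, env₂, rfl, t2, hset⟩
    have y5 : s₂.set 5 = ∅ := (hset 5 (by norm_num) (by norm_num) (by norm_num)).trans x5
    have y6 : s₂.set 6 = ∅ := (hset 6 (by norm_num) (by norm_num) (by norm_num)).trans x6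
    refine Coupled.seq_det (complProg_ensures env₂ y6 fun s₃ env₃ z6 z5 t3 => ?_)
    rw [Program.run]
    refine (greedyProg_coupled env₃ (z5.trans y5) z6).bind ?_
    rintro S s₄ ⟨env₄, w5, t4⟩
    refine (outputProg_coupled env₄ w5 hth).mono ?_
    rintro A s₅ ⟨v0, t5⟩
    refine ⟨v0, ?_⟩
    simp only [State.tick] at t1
    unfold stepBound
    omega

theorem mainProg_computes : Computes mainProg noisyDoubleGreedy := fun n ν ε _ _ g =>
  (mainProg_coupled n ν ε g).map_eq _ fun _ _ h => State.subset_of_encode h.1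

theorem stepBound_le {n m t h W : ℕ} (hn : n ≤ W) (hm : m ≤ W) (ht : t ≤ W) (hh : h ≤ W)
    (hW : 1 ≤ W) : stepBound n m t h ≤ 300 * W ^ 3 := by
  have h1 : stepBound n m t h ≤ stepBound W W W W := by
    unfold stepBound
    gcongr
  refine h1.trans ?_
  have h2 : W ^ 2 ≤ W ^ 3 := Nat.pow_le_pow_right hW (by norm_num)
  have h3 : W ≤ W ^ 3 := Nat.le_self_pow (by norm_num) W
  have h4 : 1 ≤ W ^ 3 := Nat.one_le_pow _ _ hW
  unfold stepBound
  ring_nf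
  omega

theorem paramM_le {n : ℕ} {ν ε : ℝ} (hν : 0 < ν) (hε : 0 < ε) :
    (paramM n ν ε : ℝ) ≤ 41 * ((n : ℝ) + 1 / ε + ν + 1) ^ 7 := by
  set z := (n : ℝ) + 1 / ε + ν + 1 with hz
  have hn : (0 : ℝ) ≤ n := Nat.cast_nonneg n
  have hε' : 0 < 1 / ε := by positivity
  have hz1 : 1 ≤ z := by rw [hz]; linarith
  have hc : (Nat.clog 2 (4 * n) : ℝ) ≤ 4 * n := by
    exact_mod_cast Nat.clog_le_of_le_pow (Nat.lt_pow_self (by norm_num)).le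
  have h1 : max 2 (8 * ν ^ 2) ≤ 8 * z ^ 2 := by
    have hνz : ν ≤ z := by rw [hz]; linarith
    refine max_le (by nlinarith) (by gcongr)
  have h2 : (n : ℝ) / ε ≤ z * z := by
    rw [div_eq_mul_one_div]
    gcongr <;> rw [hz] <;> linarith
  have h3 : (n : ℝ) + (Nat.clog 2 (4 * n) : ℝ) ≤ 5 * z := by
    have : (n : ℝ) ≤ z := by rw [hz]; linarith
    linarith
  have h4 : max 2 (8 * ν ^ 2) * ((n : ℝ) / ε) ^ 2 * ((n : ℝ) + (Nat.clog 2 (4 * n) : ℝ)) ≤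
      8 * z ^ 2 * (z * z) ^ 2 * (5 * z) := by
    gcongr
  have h5 : (paramM n ν ε : ℝ) < _ + 1 := Nat.ceil_lt_add_one (by positivity)
  have h6 : 1 ≤ z ^ 7 := one_le_pow₀ hz1
  have h7 : 8 * z ^ 2 * (z * z) ^ 2 * (5 * z) = 40 * z ^ 7 := by ring
  linarith

theorem mainProg_steps_le {n : ℕ} {ν ε : ℝ} (hν : 0 < ν) (hε : 0 < ε) {g : Finset (Fin n) → ℝ}
    {s : State} (hs : s ∈ (mainProg.run g (State.init n ν ε)).support) :
    (s.steps : ℝ) ≤ 300 * (27062 * ((n : ℝ) + 1 / ε + ν + 1) ^ 14) ^ 3 := by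
  obtain ⟨A, -, -, hsteps⟩ := (mainProg_coupled n ν ε g).of_mem_support hs
  have ht : paramT n ν ε ≤ 4 * paramM n ν ε := paramT_le n ν ε
  have hh : paramH n ν ε ≤ 16 * paramM n ν ε ^ 2 := by
    rw [paramH]
    calc _ ≤ (4 * paramM n ν ε) ^ 2 := Nat.pow_le_pow_left ht 2
      _ = _ := by ring
  have hM : (paramM n ν ε : ℝ) ≤ 41 * ((n : ℝ) + 1 / ε + ν + 1) ^ 7 := paramM_le hν hε
  generalize paramM n ν ε = m at *
  -- W dominates n, m, t ≤ 4m and h ≤ 16m² at once; the crude bound ⌈log₂ N⌉ ≤ N is enough for a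
  -- polynomial.
  have h1 := hsteps.trans (stepBound_le (W := n + 16 * m ^ 2 + 4 * m + 1) (by omega) (by omega)
    (by omega) (by omega) (by omega))
  have hn : (0 : ℝ) ≤ n := Nat.cast_nonneg n
  have hε' : 0 < 1 / ε := by positivity
  have hz1 : 1 ≤ (n : ℝ) + 1 / ε + ν + 1 := by linarith
  have hnz : (n : ℝ) ≤ (n : ℝ) + 1 / ε + ν + 1 := by linarith
  generalize (n : ℝ) + 1 / ε + ν + 1 = z at *
  have h14 : z ^ 7 ≤ z ^ 14 := pow_le_pow_right₀ hz1 (by norm_num)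
  have h14' : z ≤ z ^ 14 := le_self_pow₀ hz1 (by norm_num)
  have hm2 : (m : ℝ) ^ 2 ≤ 1681 * z ^ 14 := by
    calc (m : ℝ) ^ 2 ≤ (41 * z ^ 7) ^ 2 := by gcongr
      _ = _ := by ring
  -- 27062 = 1 + 16·41² + 4·41 + 1.
  have hW : (n : ℝ) + 16 * m ^ 2 + 4 * m + 1 ≤ 27062 * z ^ 14 := by linarith
  calc (s.steps : ℝ) ≤ ((300 * (n + 16 * m ^ 2 + 4 * m + 1) ^ 3 : ℕ) : ℝ) := by exact_mod_cast h1
    _ = 300 * ((n : ℝ) + 16 * m ^ 2 + 4 * m + 1) ^ 3 := by push_cast; ring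
    _ ≤ 300 * (27062 * z ^ 14) ^ 3 := by gcongr

theorem mainProg_runsInPolyTime : RunsInPolyTime mainProg := by
  refine ⟨14 * 3, 300 * 27062 ^ 3, fun n ν ε hν hε g s hs => ?_⟩
  rw [mul_assoc, pow_mul, ← mul_pow]
  exact mainProg_steps_le hν hε hs

/-! ### Means of finite distributions -/

section mean
variable {β γ : Type*} [Fintype β] [Fintype γ]

/-- The mean of `f` under the distribution `p`. -/
def mean (p : PMF β) (f : β → ℝ) : ℝ := ∑ a, (p a).toReal * f a

theorem sum_toReal (p : PMF β) : ∑ a, (p a).toReal = 1 := by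
  have h := p.tsum_coe
  rw [tsum_fintype] at h
  rw [← ENNReal.toReal_sum (fun a _ => p.apply_ne_top a), h, ENNReal.toReal_one]

theorem mean_const (p : PMF β) (c : ℝ) : mean p (fun _ => c) = c := by
  rw [mean, ← Finset.sum_mul, sum_toReal, one_mul]

theorem mean_mono {p : PMF β} {f g : β → ℝ} (h : ∀ a ∈ p.support, f a ≤ g a) :
    mean p f ≤ mean p g := by
  refine Finset.sum_le_sum fun a _ => ?_
  by_cases ha : a ∈ p.support
  · exact mul_le_mul_of_nonneg_left (h a ha) ENNReal.toReal_nonneg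
  · simp [(PMF.apply_eq_zero_iff _ _).2 ha]

theorem mean_add (p : PMF β) (f g : β → ℝ) : mean p (fun a => f a + g a) = mean p f + mean p g := by
  simp only [mean, mul_add, Finset.sum_add_distrib]

theorem mean_sub (p : PMF β) (f g : β → ℝ) : mean p (fun a => f a - g a) = mean p f - mean p g := by
  simp only [mean, mul_sub, Finset.sum_sub_distrib]

theorem mean_const_mul (p : PMF β) (c : ℝ) (f : β → ℝ) :
    mean p (fun a => c * f a) = c * mean p f := by
  simp only [mean, Finset.mul_sum, mul_left_comm]

theorem mean_mul_const (p : PMF β) (c : ℝ) (f : β → ℝ) :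
    mean p (fun a => f a * c) = mean p f * c := by
  simp only [mean, Finset.sum_mul, mul_assoc]

theorem mean_sum {ι : Type*} (p : PMF β) (s : Finset ι) (f : ι → β → ℝ) :
    mean p (fun a => ∑ i ∈ s, f i a) = ∑ i ∈ s, mean p (f i) := by
  simp only [mean, Finset.mul_sum]
  exact Finset.sum_comm

theorem mean_pure (a : β) (f : β → ℝ) : mean (PMF.pure a) f = f a := by
  classical
  rw [mean, Finset.sum_eq_single a]
  · simp
  · intro b _ hb; simp [PMF.pure_apply, hb]
  · simp

theorem mean_bind (p : PMF β) (q : β → PMF γ) (f : γ → ℝ) :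
    mean (p.bind q) f = mean p fun a => mean (q a) f := by
  have h : ∀ c, ((p.bind q) c).toReal = ∑ a, (p a).toReal * (q a c).toReal := fun c => by
    rw [PMF.bind_apply, tsum_fintype, ENNReal.toReal_sum]
    · simp only [ENNReal.toReal_mul]
    · exact fun a _ => ENNReal.mul_ne_top (p.apply_ne_top a) ((q a).apply_ne_top c)
  simp only [mean, h, Finset.sum_mul, Finset.mul_sum]
  rw [Finset.sum_comm]
  simp only [mul_assoc]

theorem mean_uniform [Inhabited β] {s : Finset β} (hs : s.Nonempty) (f : β → ℝ) :
    mean (uniform s) f = (∑ a ∈ s, f a) / s.card := by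
  classical
  rw [mean, ← Finset.sum_subset (Finset.subset_univ s), div_eq_mul_inv, Finset.sum_mul]
  · refine Finset.sum_congr rfl fun a ha => ?_
    rw [uniform_apply_of_mem ha, ENNReal.toReal_inv, ENNReal.toReal_natCast, mul_comm]
  · intro a _ ha
    rw [uniform_apply_of_notMem hs ha]; simp

theorem mean_coin {p : ℝ} (h0 : 0 ≤ p) (h1 : p ≤ 1) (f : Bool → ℝ) :
    mean (coin p) f = p * f true + (1 - p) * f false := by
  rw [mean, Fintype.sum_bool, coin_apply_true h0 h1, coin_apply_false h0 h1,
    ENNReal.toReal_ofReal h0, ENNReal.toReal_ofReal (by linarith)]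

end mean

/-! ### Double greedy with an approximate oracle -/

theorem acceptProb_nonneg (a b : ℝ) : 0 ≤ acceptProb a b := by
  unfold acceptProb
  split_ifs with h1
  · have := h1.1; have := h1.2; positivity
  · exact zero_le_one
  · exact le_rfl

theorem acceptProb_le_one (a b : ℝ) : acceptProb a b ≤ 1 := by
  unfold acceptProb
  split_ifs with h1
  · rw [div_le_one (by linarith [h1.1, h1.2])]; linarith [h1.2]
  · exact le_rfl
  · exact zero_le_one

/-- The expected loss of the optimum is at most the expected gain of the two current solutions, up to
the error of the oracle. -/
theorem acceptProb_loss_le {a b a' b' η : ℝ} (ha : |a' - a| ≤ 2 * η) (hb : |b' - b| ≤ 2 * η)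
    (hab : 0 ≤ a + b) :
    acceptProb a' b' * b ≤ (acceptProb a' b' * a + (1 - acceptProb a' b') * b) / 2 + 3 * η ∧
      (1 - acceptProb a' b') * a ≤
        (acceptProb a' b' * a + (1 - acceptProb a' b') * b) / 2 + 3 * η := by
  obtain ⟨ha1, ha2⟩ := abs_le.1 ha
  obtain ⟨hb1, hb2⟩ := abs_le.1 hb
  have hη : 0 ≤ η := by linarith
  by_cases h1 : 0 < a' ∧ 0 < b'
  · have hp : acceptProb a' b' = a' / (a' + b') := if_pos h1
    have h0 := acceptProb_nonneg a' b'
    have h2 := acceptProb_le_one a' b'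
    have hpos : 0 < a' + b' := by linarith [h1.1, h1.2]
    rw [hp] at h0 h2 ⊢
    set p := a' / (a' + b') with hpdef
    have e1 : p * (a' + b') = a' := div_mul_cancel₀ _ hpos.ne'
    have e2 : (1 - p) * a' = p * b' := by linarith
    -- This is 2a'b' ≤ a'² + b'² divided by a' + b'. Passing from a', b' to a, b then costs at most
    -- 2η for the loss and η for half of the gain.
    have e3 : p * b' ≤ (p * a' + (1 - p) * b') / 2 := by
      have : (a' + b') * (p * a' + (1 - p) * b' - 2 * (p * b')) = (a' - b') ^ 2 := by
        have : p * a' + (1 - p) * b' - 2 * (p * b') = p * (a' + b') + b' - 4 * (p * b') := by ring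
        rw [this, e1]
        have : (a' + b') * (a' + b' - 4 * (p * b')) =
          (a' + b') ^ 2 - 4 * (p * (a' + b')) * b' := by ring
        rw [this, e1]; ring
      have h3 : 0 ≤ (a' + b') * (p * a' + (1 - p) * b' - 2 * (p * b')) := by
        rw [this]; positivity
      have := nonneg_of_mul_nonneg_right h3 hpos
      linarith
    have f1 : p * (a - a') ≥ p * (-(2 * η)) := mul_le_mul_of_nonneg_left (by linarith) h0
    have f2 : (1 - p) * (b - b') ≥ (1 - p) * (-(2 * η)) :=
      mul_le_mul_of_nonneg_left (by linarith) (by linarith)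
    have f3 : p * (b - b') ≤ p * (2 * η) := mul_le_mul_of_nonneg_left (by linarith) h0
    have f4 : (1 - p) * (a - a') ≤ (1 - p) * (2 * η) :=
      mul_le_mul_of_nonneg_left (by linarith) (by linarith)
    have f5 : p * η ≤ 1 * η := mul_le_mul_of_nonneg_right h2 hη
    have f6 : (1 - p) * η ≤ 1 * η := mul_le_mul_of_nonneg_right (by linarith) hη
    constructor <;> linarith
  · by_cases h2 : 0 < a'
    · have hp : acceptProb a' b' = 1 := by rw [acceptProb, if_neg h1, if_pos h2]
      have h3 : b' ≤ 0 := by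
        by_contra h; exact h1 ⟨h2, not_le.1 h⟩
      rw [hp]
      constructor <;> linarith
    · have hp : acceptProb a' b' = 0 := by simp [acceptProb, h2]
      rw [hp]
      constructor <;> linarith

section greedyValue
variable {N : Type*} [Fintype N] [DecidableEq N]

/-- The potential is F(O) + (F(X) + F(Y))/2, where X ⊆ O ⊆ Y is the optimum corrected by the
decisions made so far. Its expectation drops by at most 3η per element, and at the end X = O = Y, so
that it equals 2F(X). -/
theorem two_mul_mean_doubleGreedyFrom_ge {F F' : Finset N → ℝ} (hF : Submodular F) {η : ℝ}
    {G : Finset N} (hη : ∀ S ⊆ G, |F' S - F S| ≤ η) (l : List N) (X Y O : Finset N)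
    (hl : l.Nodup) (hX : ∀ u ∈ l, u ∉ X) (hY : ∀ u ∈ l, u ∈ Y) (hXY : ∀ u ∈ Y, u ∈ X ∨ u ∈ l)
    (hXO : X ⊆ O) (hOY : O ⊆ Y) (hYG : Y ⊆ G) :
    F O + (F X + F Y) / 2 - 3 * η * l.length ≤ 2 * mean (doubleGreedyFrom F' l X Y) F := by
  induction l generalizing X Y O with
  | nil =>
    have h1 : Y ⊆ X := fun u hu => (hXY u hu).resolve_right (by simp)
    obtain rfl : X = Y := (hXO.trans hOY).antisymm h1
    obtain rfl : O = X := hOY.antisymm hXO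
    rw [doubleGreedyFrom, mean_pure]
    simp
    linarith
  | cons u l ih =>
    have huX : u ∉ X := hX u (by simp)
    have huY : u ∈ Y := hY u (by simp)
    have hul : u ∉ l := (List.nodup_cons.1 hl).1
    set a := F (insert u X) - F X with ha
    set b := F (Y.erase u) - F Y with hb
    set a' := F' (insert u X) - F' X with ha'
    set b' := F' (Y.erase u) - F' Y with hb'
    have hXY' : X ⊆ Y := hXO.trans hOY
    have e1 := hη (insert u X) ((Finset.insert_subset huY hXY').trans hYG)
    have e2 := hη X (hXY'.trans hYG)
    have e3 := hη (Y.erase u) ((Finset.erase_subset _ _).trans hYG)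
    have e4 := hη Y hYG
    have haa : |a' - a| ≤ 2 * η := by
      rw [abs_le] at *; constructor <;> linarith [e1.1, e1.2, e2.1, e2.2]
    have hbb : |b' - b| ≤ 2 * η := by
      rw [abs_le] at *; constructor <;> linarith [e3.1, e3.2, e4.1, e4.2]
    have hXe : X ⊆ Y.erase u := fun v hv =>
      Finset.mem_erase.2 ⟨fun h => huX (h ▸ hv), hXY' hv⟩
    have hab : 0 ≤ a + b := by
      have := hF X (Y.erase u) hXe u (Finset.notMem_erase _ _)
      rw [Finset.insert_erase huY] at this
      linarith
    have h0 := acceptProb_nonneg a' b'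
    have h1 := acceptProb_le_one a' b'
    obtain ⟨l1, l2⟩ := acceptProb_loss_le haa hbb hab
    rw [doubleGreedyFrom, mean_bind, mean_coin h0 h1]
    simp only [if_true, Bool.false_eq_true, if_false]
    -- The intermediate optimum follows the decision: it gains `u` on acceptance and loses `u` on
    -- rejection, and so stays between the two current sets.
    have i1 := ih (insert u X) Y (insert u O) (List.nodup_cons.1 hl).2
      (fun v hv => by
        rw [Finset.mem_insert, not_or]
        exact ⟨fun h => hul (h ▸ hv), hX v (by simp [hv])⟩)
      (fun v hv => hY v (by simp [hv]))
      (fun v hv => by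
        rcases hXY v hv with h | h
        · exact Or.inl (Finset.mem_insert_of_mem h)
        · rcases List.mem_cons.1 h with rfl | h
          · exact Or.inl (Finset.mem_insert_self _ _)
          · exact Or.inr h)
      (Finset.insert_subset_insert _ hXO) (Finset.insert_subset huY hOY) hYG
    have i2 := ih X (Y.erase u) (O.erase u) (List.nodup_cons.1 hl).2
      (fun v hv => hX v (by simp [hv]))
      (fun v hv => Finset.mem_erase.2 ⟨fun h => hul (h ▸ hv), hY v (by simp [hv])⟩)
      (fun v hv => by
        rcases hXY v (Finset.mem_of_mem_erase hv) with h | h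
        · exact Or.inl h
        · rcases List.mem_cons.1 h with rfl | h
          · exact absurd hv (Finset.notMem_erase _ _)
          · exact Or.inr h)
      (fun v hv => Finset.mem_erase.2 ⟨fun h => huX (h ▸ hv), hXO hv⟩)
      (Finset.erase_subset_erase _ hOY) ((Finset.erase_subset _ _).trans hYG)
    -- Only one outcome changes `O`. If u ∈ O, rejection costs at most a by comparison with X ⊆ O \
    -- {u}; if u ∉ O, acceptance costs at most b by comparison with O ⊆ Y \ {u}.
    have hO : F O - (acceptProb a' b' * a + (1 - acceptProb a' b') * b) / 2 - 3 * η ≤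
        acceptProb a' b' * F (insert u O) + (1 - acceptProb a' b') * F (O.erase u) := by
      by_cases huO : u ∈ O
      · have h3 := hF X (O.erase u)
          (fun v hv => Finset.mem_erase.2 ⟨fun h => huX (h ▸ hv), hXO hv⟩) u
          (Finset.notMem_erase _ _)
        rw [Finset.insert_erase huO] at h3
        rw [Finset.insert_eq_of_mem huO]
        have := mul_le_mul_of_nonneg_left h3 (by linarith : 0 ≤ 1 - acceptProb a' b')
        rw [← ha] at this
        linarith
      · have h3 := hF O (Y.erase u)
          (fun v hv => Finset.mem_erase.2 ⟨fun h => huO (h ▸ hv), hOY hv⟩) u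
          (Finset.notMem_erase _ _)
        rw [Finset.insert_erase huY] at h3
        rw [Finset.erase_eq_of_notMem huO]
        have := mul_le_mul_of_nonneg_left h3 h0
        have h4 : F Y - F (Y.erase u) = - b := by rw [hb]; ring
        rw [h4] at this
        linarith
    have j1 := mul_le_mul_of_nonneg_left i1 h0
    have j2 := mul_le_mul_of_nonneg_left i2 (by linarith : 0 ≤ 1 - acceptProb a' b')
    have k1 : F (insert u X) = F X + a := by rw [ha]; ring
    have k2 : F (Y.erase u) = F Y + b := by rw [hb]; ring
    rw [k1] at j1
    rw [k2] at j2
    rw [List.length_cons]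
    push_cast
    linarith

end greedyValue

theorem two_mul_mean_doubleGreedy_ge {n : ℕ} {F F' : Finset (Fin n) → ℝ} (hF : Submodular F)
    (hF0 : ∀ S, 0 ≤ F S) {η : ℝ} {G : Finset (Fin n)} (hη : ∀ S ⊆ G, |F' S - F S| ≤ η)
    {O : Finset (Fin n)} (hO : O ⊆ G) :
    F O - 3 * η * n ≤ 2 * mean (doubleGreedy F' G) F := by
  have h := two_mul_mean_doubleGreedyFrom_ge hF hη (G.sort (· ≤ ·)) ∅ G O (G.sort_nodup _)
    (by simp) (by simp) (by simp) (by simp) hO le_rfl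
  rw [Finset.length_sort] at h
  have hη0 : 0 ≤ η := (abs_nonneg _).trans (hη ∅ (by simp))
  have hc : (G.card : ℝ) ≤ n := by exact_mod_cast card_fin_le G
  have h2 : 3 * η * G.card ≤ 3 * η * n := by gcongr
  have := hF0 ∅
  have := hF0 G
  rw [doubleGreedy]
  linarith

/-! ### Random sets and submodular functions -/

section randomSet
variable {N : Type*} [DecidableEq N] {f : Finset N → ℝ}

/-- Diminishing returns for a whole set C, added one element at a time. The condition on C ∩ B
ensures that an element which is free for `B` is also free for `A`. -/
theorem Submodular.union_sub_le (hf : Submodular f) {A B C : Finset N} (hAB : A ⊆ B)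
    (hC : C ∩ B ⊆ A) : f (B ∪ C) - f B ≤ f (A ∪ C) - f A := by
  induction C using Finset.induction_on with
  | empty => simp
  | insert x C hx ih =>
    have h1 := ih ((Finset.inter_subset_inter_right (Finset.subset_insert x C)).trans hC)
    rw [Finset.union_insert, Finset.union_insert]
    by_cases hxB : x ∈ B
    · have hxA : x ∈ A := hC (by simp [hxB])
      rw [Finset.insert_eq_of_mem (Finset.mem_union_left _ hxB),
        Finset.insert_eq_of_mem (Finset.mem_union_left _ hxA)]
      exact h1
    · have := hf (A ∪ C) (B ∪ C) (Finset.union_subset_union_left hAB) x (by simp [hxB, hx])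
      linarith

theorem Submodular.comp_union (hf : Submodular f) (A : Finset N) :
    Submodular fun R => f (R ∪ A) := by
  intro S T hST x hx
  simp only [Finset.insert_union]
  by_cases hxA : x ∈ A
  · rw [Finset.insert_eq_of_mem (Finset.mem_union_right _ hxA),
      Finset.insert_eq_of_mem (Finset.mem_union_right _ hxA)]
    simp
  · exact hf _ _ (Finset.union_subset_union_left hST) x (by simp [hx, hxA])

theorem Submodular.comp_sdiff (hf : Submodular f) (A : Finset N) :
    Submodular fun R => f (A \ R) := by
  intro S T hST x hx
  simp only [Finset.sdiff_insert]
  by_cases hxA : x ∈ A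
  · have h1 : x ∈ A \ T := Finset.mem_sdiff.2 ⟨hxA, hx⟩
    have h2 : x ∈ A \ S := Finset.mem_sdiff.2 ⟨hxA, fun h => hx (hST h)⟩
    have h := hf ((A \ T).erase x) ((A \ S).erase x)
      (Finset.erase_subset_erase _ (Finset.sdiff_subset_sdiff le_rfl hST)) x
      (Finset.notMem_erase _ _)
    rw [Finset.insert_erase h1, Finset.insert_erase h2] at h
    linarith
  · have h1 : x ∉ A \ T := fun h => hxA (Finset.mem_sdiff.1 h).1
    have h2 : x ∉ A \ S := fun h => hxA (Finset.mem_sdiff.1 h).1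
    rw [Finset.erase_eq_of_notMem h1, Finset.erase_eq_of_notMem h2]
    simp

/-- A submodular function dominates a modular one that agrees with it on `∅` and on `A`. -/
theorem Submodular.exists_modular_le (hf : Submodular f) (A : Finset N) :
    ∃ w : N → ℝ, ∑ x ∈ A, w x = f A - f ∅ ∧ ∀ R ⊆ A, ∑ x ∈ R, w x ≤ f R - f ∅ := by
  induction A using Finset.induction_on with
  | empty => exact ⟨0, by simp, fun R hR => by simp [Finset.subset_empty.1 hR]⟩
  | insert y A hy ih =>
    obtain ⟨w, h1, h2⟩ := ih
    have hne : ∀ R ⊆ A, ∑ x ∈ R, Function.update w y (f (insert y A) - f A) x = ∑ x ∈ R, w x :=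
      fun R hR => Finset.sum_congr rfl fun x hx =>
        Function.update_of_ne (ne_of_mem_of_not_mem (hR hx) hy) _ _
    -- The weight of each element is its marginal value along a fixed chain of sets (Edmonds' greedy
    -- vertex of the base polytope); on a smaller set the marginal can only be larger.
    refine ⟨Function.update w y (f (insert y A) - f A), ?_, fun R hR => ?_⟩
    · rw [Finset.sum_insert hy, hne A le_rfl, h1, Function.update_self]; ring
    · by_cases hyR : y ∈ R
      · have hRA : R.erase y ⊆ A := fun x hx =>
          (Finset.mem_insert.1 (hR (Finset.mem_of_mem_erase hx))).resolve_left
            (Finset.ne_of_mem_erase hx)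
        rw [← Finset.add_sum_erase R _ hyR, hne _ hRA, Function.update_self]
        have h3 := h2 _ hRA
        have h4 := hf (R.erase y) A hRA y hy
        rw [Finset.insert_erase hyR] at h4
        linarith
      · have hRA : R ⊆ A := (Finset.subset_insert_iff_of_notMem hyR).1 hR
        rw [hne R hRA]
        exact h2 R hRA

/-- A modular minorant tight at the empty and at the full set has mean f(∅) + p(f(N) - f(∅));
non-negativity allows f(N) to be dropped. Equal inclusion probabilities suffice, independence is not
needed. -/
theorem Submodular.mean_ge [Fintype N] (hf : Submodular f) (hf0 : ∀ S, 0 ≤ f S)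
    (μ : PMF (Finset N)) {p : ℝ} (hp0 : 0 ≤ p)
    (hp : ∀ x, mean μ (fun R => if x ∈ R then 1 else 0) = p) : (1 - p) * f ∅ ≤ mean μ f := by
  obtain ⟨w, h1, h2⟩ := hf.exists_modular_le Finset.univ
  have h3 : mean μ (fun R => f ∅ + ∑ x, w x * if x ∈ R then 1 else 0) ≤ mean μ f := by
    refine mean_mono fun R _ => ?_
    have := h2 R (Finset.subset_univ R)
    simp only [mul_ite, mul_one, mul_zero, Finset.sum_ite_mem, Finset.univ_inter]
    linarith
  rw [mean_add, mean_const, mean_sum] at h3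
  simp only [mean_const_mul, hp] at h3
  rw [← Finset.sum_mul, h1] at h3
  have := mul_nonneg (hf0 Finset.univ) hp0
  linarith

end randomSet

section smoothing
variable {n h t : ℕ}

theorem mean_uniform_mem {N : Type*} [Fintype N] [DecidableEq N] {G : Finset N} {k : ℕ}
    (hk : k ≤ G.card) (x : N) :
    mean (uniform (Finset.powersetCard k G)) (fun R => if x ∈ R then (1 : ℝ) else 0) =
      if x ∈ G then (k : ℝ) / G.card else 0 := by
  rw [mean_uniform (Finset.powersetCard_nonempty.2 hk), Finset.sum_boole, Finset.card_powersetCard]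
  split_ifs with hx
  · rcases Nat.eq_zero_or_pos k with rfl | hk0
    · simp
    · have h1 := Finset.card_filter_powersetCard_subset {x} G k (by simpa using hx) (by simpa)
      simp only [Finset.singleton_subset_iff, Finset.card_singleton] at h1
      rw [h1]
      obtain ⟨d, rfl⟩ : ∃ d, k = d + 1 := ⟨k - 1, by omega⟩
      obtain ⟨c, hc⟩ : ∃ c, G.card = c + 1 := ⟨G.card - 1, by omega⟩
      rw [hc]
      have h2 := add_one_mul_choose_cast c d
      have h3 : 0 < (c + 1).choose (d + 1) := Nat.choose_pos (by omega)
      have h4 : (0 : ℝ) < (c + 1).choose (d + 1) := by exact_mod_cast h3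
      simp only [Nat.add_sub_cancel]
      rw [div_eq_div_iff h4.ne' (by positivity)]
      push_cast
      linarith
  · rw [Finset.filter_false_of_mem, Finset.card_empty]
    · simp
    · intro R hR hxR
      exact hx ((Finset.mem_powersetCard.1 hR).1 hxR)

/-- Replacing the part of `O` in a random set `H` by a random subset of `H` costs little. -/
theorem mean_smoothing_ge {f : Finset (Fin n) → ℝ} (hf : Submodular f) (hf0 : ∀ S, 0 ≤ f S)
    (hh : h ≤ n) (hn : 0 < n) (hh0 : 0 < h) (ht : t ≤ h) (O : Finset (Fin n)) :
    (1 - (h : ℝ) / n) * f O ≤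
      mean (uniform (Finset.powersetCard h (Finset.univ : Finset (Fin n)))) fun H =>
        mean (uniform (Finset.powersetCard t H)) fun H' => f ((Finset.univ \ H) ∩ O ∪ H') := by
  set P := uniform (Finset.powersetCard h (Finset.univ : Finset (Fin n))) with hP
  have hne : (Finset.powersetCard h (Finset.univ : Finset (Fin n))).Nonempty :=
    Finset.powersetCard_nonempty.2 (by simpa using hh)
  have hcard : ∀ H ∈ P.support, H.card = h := fun H hH =>
    (Finset.mem_powersetCard.1 (mem_of_mem_support_uniform hne hH)).2
  have hsub : ∀ H ∈ P.support, ∀ H' ∈ (uniform (Finset.powersetCard t H)).support, H' ⊆ H :=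
    fun H hH H' hH' => (Finset.mem_powersetCard.1 (mem_of_mem_support_uniform
      (Finset.powersetCard_nonempty.2 (by rw [hcard H hH]; exact ht)) hH')).1
  have mean_congr : ∀ {β : Type} [Fintype β] (p : PMF β) (a b : β → ℝ),
      (∀ x ∈ p.support, a x = b x) → mean p a = mean p b := fun p a b hab =>
    le_antisymm (mean_mono fun x hx => (hab x hx).le) (mean_mono fun x hx => (hab x hx).ge)
  -- An element lies in H' with probability (h/n)(t/h) = t/n, and therefore in H \ H' with
  -- probability (h-t)/n.
  have hin : ∀ x, (mean P fun H => mean (uniform (Finset.powersetCard t H))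
      fun H' => if x ∈ H' then (1 : ℝ) else 0) = (t : ℝ) / n := by
    intro x
    have h1 : (mean P fun H => mean (uniform (Finset.powersetCard t H))
      fun H' => if x ∈ H' then (1 : ℝ) else 0) =
      mean P fun H => (t : ℝ) / h * if x ∈ H then 1 else 0 := by
      refine mean_congr _ _ _ fun H hH => ?_
      rw [mean_uniform_mem (by rw [hcard H hH]; exact ht), hcard H hH]
      split_ifs <;> simp
    rw [h1, mean_const_mul, hP, mean_uniform_mem (by simpa using hh)]
    have : (h : ℝ) ≠ 0 := by positivity
    simp
    field_simp
  have hout : ∀ x, (mean P fun H => mean (uniform (Finset.powersetCard t H))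
      fun H' => if x ∈ H \ H' then (1 : ℝ) else 0) = (h : ℝ) / n - (t : ℝ) / n := by
    intro x
    have h1 : (mean P fun H => mean (uniform (Finset.powersetCard t H))
      fun H' => if x ∈ H \ H' then (1 : ℝ) else 0) =
      mean P fun H => (if x ∈ H then 1 else 0) - mean (uniform (Finset.powersetCard t H))
        fun H' => if x ∈ H' then (1 : ℝ) else 0 := by
      refine mean_congr _ _ _ fun H hH => ?_
      rw [← mean_const (uniform (Finset.powersetCard t H)) (if x ∈ H then (1 : ℝ) else 0),
        ← mean_sub]
      refine mean_congr _ _ _ fun H' hH' => ?_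
      have := @hsub H hH H' hH' x
      by_cases a1 : x ∈ H <;> by_cases a2 : x ∈ H' <;> simp [a1, a2]
      exact a1 (this a2)
    rw [h1, mean_sub, hin, hP, mean_uniform_mem (by simpa using hh)]
    simp
  have hth : (t : ℝ) / n ≤ (h : ℝ) / n := by gcongr
  have k1 := (hf.comp_union O).mean_ge (fun S => hf0 _)
    (P.bind fun H => uniform (Finset.powersetCard t H)) (p := (t : ℝ) / n) (by positivity)
    (fun x => by rw [mean_bind]; exact hin x)
  have k2 := (hf.comp_sdiff O).mean_ge (fun S => hf0 _)
    (P.bind fun H => (uniform (Finset.powersetCard t H)).bind fun H' => PMF.pure (H \ H'))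
    (p := (h : ℝ) / n - (t : ℝ) / n) (by linarith)
    (fun x => by simp only [mean_bind, mean_pure]; exact hout x)
  simp only [mean_bind, mean_pure, Finset.empty_union, Finset.sdiff_empty] at k1 k2
  have k3 : (mean P fun H => mean (uniform (Finset.powersetCard t H)) fun H' =>
      f (H' ∪ O) + f (O \ (H \ H')) - f O) ≤ mean P fun H =>
        mean (uniform (Finset.powersetCard t H)) fun H' => f ((Finset.univ \ H) ∩ O ∪ H') := by
    refine mean_mono fun H hH => mean_mono fun H' hH' => ?_
    have hs := hsub H hH H' hH'
    -- Adding H' helps O \ (H \ H') at least as much as it helps O. Since (O \ (H \ H')) ∪ H' = (O \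
    -- H) ∪ H', the two estimates `k1` and `k2` add up to a loss of t/n + (h-t)/n = h/n.
    have h1 := hf.union_sub_le (A := O \ (H \ H')) (B := O) (C := H') Finset.sdiff_subset
      (fun x hx => by
        rw [Finset.mem_inter] at hx
        simp [hx.1, hx.2])
    have h2 : O \ (H \ H') ∪ H' = (Finset.univ \ H) ∩ O ∪ H' := by
      ext x
      simp only [Finset.mem_union, Finset.mem_sdiff, Finset.mem_inter, Finset.mem_univ, true_and]
      tauto
    rw [h2, Finset.union_comm O H'] at h1
    linarith
  simp only [mean_sub, mean_add, mean_const] at k3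
  linarith

end smoothing

/-! ### Concentration for sampling without replacement -/

/-- Every factor is at least K + 1 - m, and by Bernoulli (1 - (m-1)/K)^m ≥ 1 - m(m-1)/K ≥ 1/2.
Sampling without replacement thus costs only a factor 2 against independent sampling. -/
theorem pow_le_two_mul_descFactorial {K m : ℕ} (hK : 2 * m ^ 2 ≤ K) :
    (K : ℝ) ^ m ≤ 2 * K.descFactorial m := by
  rcases Nat.eq_zero_or_pos m with rfl | hm
  · simp
  have hmK : m ≤ K := by nlinarith
  have hK0 : (0 : ℝ) < K := by
    have : 0 < K := by omega
    exact_mod_cast this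
  have h1 : ((K + 1 - m : ℕ) : ℝ) ^ m ≤ K.descFactorial m := by
    exact_mod_cast Nat.pow_sub_le_descFactorial K m
  have h2 : ((K + 1 - m : ℕ) : ℝ) = K * (1 + (1 - m) / K) := by
    rw [Nat.cast_sub (by omega)]
    push_cast
    field_simp
    ring
  have hKm : 2 * (m : ℝ) ^ 2 ≤ K := by exact_mod_cast hK
  have hm1 : (1 : ℝ) ≤ m := by exact_mod_cast hm
  have h4 : -(1 / 2 : ℝ) ≤ m * ((1 - m) / K) := by
    rw [mul_div_assoc', le_div_iff₀ hK0]
    nlinarith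
  have h5 : (-2 : ℝ) ≤ (1 - m) / K := by
    rw [le_div_iff₀ hK0]
    nlinarith
  have h3 := one_add_mul_le_pow h5 m
  rw [h2, mul_pow] at h1
  have h6 : (K : ℝ) ^ m * (1 / 2) ≤ (K : ℝ) ^ m * (1 + (1 - m) / K) ^ m := by
    refine mul_le_mul_of_nonneg_left (by linarith) (by positivity)
  linarith

/-- The chord of the convex function exp over [-lM, lM]. When such bounds are summed for centred
values the sinh term disappears, which yields Hoeffding's lemma. -/
theorem exp_le_of_abs_le {z M l : ℝ} (hM : 0 < M) (hz : |z| ≤ M) :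
    Real.exp (l * z) ≤ Real.cosh (l * M) + z / M * Real.sinh (l * M) := by
  obtain ⟨h1, h2⟩ := abs_le.1 hz
  have h := convexOn_exp.2 (Set.mem_univ (l * M)) (Set.mem_univ (-(l * M)))
    (show 0 ≤ (M + z) / (2 * M) from div_nonneg (by linarith) (by linarith))
    (show 0 ≤ (M - z) / (2 * M) from div_nonneg (by linarith) (by linarith))
    (by field_simp; ring)
  simp only [smul_eq_mul] at h
  have e : (M + z) / (2 * M) * (l * M) + (M - z) / (2 * M) * -(l * M) = l * z := by
    field_simp; ring
  rw [e] at h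
  refine h.trans (le_of_eq ?_)
  rw [Real.cosh_eq, Real.sinh_eq]
  field_simp
  ring

theorem sum_exp_le {β : Type*} {P : Finset β} {z : β → ℝ} {M : ℝ} (hM : 0 < M) (hz : ∀ a ∈ P, |z a| ≤ M)
    (h0 : ∑ a ∈ P, z a = 0) (l : ℝ) :
    ∑ a ∈ P, Real.exp (l * z a) ≤ P.card * Real.exp ((l * M) ^ 2 / 2) := by
  calc ∑ a ∈ P, Real.exp (l * z a)
      ≤ ∑ a ∈ P, (Real.cosh (l * M) + z a / M * Real.sinh (l * M)) :=
        Finset.sum_le_sum fun a ha => exp_le_of_abs_le hM (hz a ha)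
    _ = P.card * Real.cosh (l * M) := by
        rw [Finset.sum_add_distrib, ← Finset.sum_mul, ← Finset.sum_div, h0]
        simp
    _ ≤ _ := by
        gcongr
        exact Real.cosh_le_exp_half_sq _

section sampling
variable {β : Type*} [Fintype β] [DecidableEq β] [Inhabited β]

/-- Draw the sample one element at a time: given the first m, the next factor has mean at most (∑
y)/(K - m), K being the size of `P`, because omitting the used elements only lowers a sum of
non-negative terms. -/
theorem mean_prod_powersetCard_le {P : Finset β} {y : β → ℝ} (hy : ∀ a, 0 ≤ y a) {m : ℕ}
    (hm : m ≤ P.card) :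
    mean (uniform (Finset.powersetCard m P)) (fun T => ∏ a ∈ T, y a) * (P.card.descFactorial m) ≤
      (∑ a ∈ P, y a) ^ m := by
  induction m with
  | zero => rw [Finset.powersetCard_zero, uniform_singleton, mean_pure]; simp
  | succ m ih =>
    have ih := ih (by omega)
    have hpos : (0 : ℝ) < (P.card - m : ℕ) := by
      have : 0 < P.card - m := by omega
      exact_mod_cast this
    have hS : 0 ≤ ∑ a ∈ P, y a := Finset.sum_nonneg fun a _ => hy a
    have hne : (Finset.powersetCard m P).Nonempty := Finset.powersetCard_nonempty.2 (by omega)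
    have h1 : mean (uniform (Finset.powersetCard (m + 1) P)) (fun T => ∏ a ∈ T, y a) ≤
        mean (uniform (Finset.powersetCard m P)) (fun T => ∏ a ∈ T, y a) *
          ((∑ a ∈ P, y a) / (P.card - m : ℕ)) := by
      rw [← uniform_powersetCard_succ hm, mean_bind, ← mean_mul_const]
      refine mean_mono fun T hT => ?_
      have hT := Finset.mem_powersetCard.1 (mem_of_mem_support_uniform hne hT)
      have hc : (P \ T).card = P.card - m := by rw [Finset.card_sdiff_of_subset hT.1, hT.2]
      rw [mean_bind, mean_uniform (by rw [← Finset.card_pos, hc]; omega), hc]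
      simp only [mean_pure]
      have h2 : ∑ a ∈ P \ T, ∏ b ∈ insert a T, y b = (∏ b ∈ T, y b) * ∑ a ∈ P \ T, y a := by
        rw [Finset.mul_sum]
        refine Finset.sum_congr rfl fun a ha => ?_
        rw [Finset.prod_insert (Finset.mem_sdiff.1 ha).2, mul_comm]
      rw [h2, mul_div_assoc]
      have h3 : ∑ a ∈ P \ T, y a ≤ ∑ a ∈ P, y a :=
        Finset.sum_le_sum_of_subset_of_nonneg Finset.sdiff_subset fun a _ _ => hy a
      have h4 : 0 ≤ ∏ b ∈ T, y b := Finset.prod_nonneg fun a _ => hy a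
      gcongr
    rw [Nat.descFactorial_succ]
    push_cast
    calc _ ≤ mean (uniform (Finset.powersetCard m P)) (fun T => ∏ a ∈ T, y a) *
          ((∑ a ∈ P, y a) / (P.card - m : ℕ)) *
            (((P.card - m : ℕ) : ℝ) * (P.card.descFactorial m)) := by gcongr
      _ = mean (uniform (Finset.powersetCard m P)) (fun T => ∏ a ∈ T, y a) *
          (P.card.descFactorial m) * ∑ a ∈ P, y a := by field_simp
      _ ≤ (∑ a ∈ P, y a) ^ m * ∑ a ∈ P, y a := by gcongr
      _ = _ := (pow_succ _ _).symm

/-- One-sided concentration of the sum of a sample without replacement. -/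
theorem mean_sample_tail_le {P : Finset β} {z : β → ℝ} {M δ : ℝ} {m : ℕ} (hM : 0 < M)
    (hz : ∀ a ∈ P, |z a| ≤ M) (h0 : ∑ a ∈ P, z a = 0) (hδ : 0 ≤ δ) (hm : m ≤ P.card)
    (hK : 2 * m ^ 2 ≤ P.card) (hP : P.Nonempty) :
    mean (uniform (Finset.powersetCard m P))
      (fun T => if m * δ * M ≤ ∑ a ∈ T, z a then 1 else 0) ≤ 2 * Real.exp (-(m * δ ^ 2 / 2)) := by
  -- The minimizer of -lmδM + m(lM)²/2 in Chernoff's bound.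
  set l := δ / M with hl
  have hl0 : 0 ≤ l := by positivity
  have hlM : l * M = δ := by rw [hl]; field_simp
  have hK0 : (0 : ℝ) < P.card := by exact_mod_cast Finset.card_pos.2 hP
  have h1 : mean (uniform (Finset.powersetCard m P))
      (fun T => if m * δ * M ≤ ∑ a ∈ T, z a then 1 else 0) ≤
      mean (uniform (Finset.powersetCard m P))
        (fun T => Real.exp (-(m * δ ^ 2)) * ∏ a ∈ T, Real.exp (l * z a)) := by
    refine mean_mono fun T _ => ?_
    rw [← Real.exp_sum, ← Real.exp_add, ← Finset.mul_sum]
    split_ifs with h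
    · rw [← Real.exp_zero]
      refine Real.exp_le_exp.2 ?_
      have := mul_le_mul_of_nonneg_left h hl0
      have e : l * (m * δ * M) = m * δ ^ 2 := by
        calc l * (m * δ * M) = m * δ * (l * M) := by ring
          _ = _ := by rw [hlM]; ring
      linarith
    · exact (Real.exp_pos _).le
  refine h1.trans ?_
  rw [mean_const_mul]
  set E := mean (uniform (Finset.powersetCard m P)) (fun T => ∏ a ∈ T, Real.exp (l * z a)) with hE
  have hE0 : 0 ≤ E := by
    rw [hE, ← mean_const (uniform (Finset.powersetCard m P)) 0]
    exact mean_mono fun T _ => Finset.prod_nonneg fun a _ => (Real.exp_pos _).le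
  have h2 : E * P.card.descFactorial m ≤ (∑ a ∈ P, Real.exp (l * z a)) ^ m :=
    mean_prod_powersetCard_le (fun a => (Real.exp_pos _).le) hm
  have h3 := sum_exp_le hM hz h0 l
  rw [hlM] at h3
  have h4 : (∑ a ∈ P, Real.exp (l * z a)) ^ m ≤ (P.card : ℝ) ^ m * Real.exp (m * δ ^ 2 / 2) := by
    calc _ ≤ (P.card * Real.exp (δ ^ 2 / 2)) ^ m := by
          gcongr
      _ = _ := by rw [mul_pow, ← Real.exp_nat_mul]; congr 2; ring
  have h5 := pow_le_two_mul_descFactorial hK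
  have hd : (0 : ℝ) < P.card.descFactorial m := by
    exact_mod_cast Nat.descFactorial_pos.2 hm
  have h6 : E ≤ 2 * Real.exp (m * δ ^ 2 / 2) := by
    have : E * P.card.descFactorial m ≤
        (2 * Real.exp (m * δ ^ 2 / 2)) * P.card.descFactorial m := by
      calc _ ≤ (P.card : ℝ) ^ m * Real.exp (m * δ ^ 2 / 2) := h2.trans h4
        _ ≤ (2 * P.card.descFactorial m) * Real.exp (m * δ ^ 2 / 2) := by gcongr
        _ = _ := by ring
    exact le_of_mul_le_mul_right this hd
  calc Real.exp (-(m * δ ^ 2)) * E ≤ Real.exp (-(m * δ ^ 2)) * (2 * Real.exp (m * δ ^ 2 / 2)) := by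
        gcongr
    _ = 2 * (Real.exp (-(m * δ ^ 2)) * Real.exp (m * δ ^ 2 / 2)) := by ring
    _ = _ := by rw [← Real.exp_add]; congr 2; ring

/-- Two-sided concentration of the average of a sample without replacement. -/
theorem mean_sample_abs_le {P : Finset β} {x : β → ℝ} {M δ : ℝ} {m : ℕ} (hM : 0 < M)
    (hx0 : ∀ a, 0 ≤ x a) (hx : ∀ a, x a ≤ M) (hδ : 0 ≤ δ) (hm0 : 0 < m) (hm : m ≤ P.card)
    (hK : 2 * m ^ 2 ≤ P.card) :
    mean (uniform (Finset.powersetCard m P))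
      (fun T => if δ * M < |(∑ a ∈ T, x a) / T.card - (∑ a ∈ P, x a) / P.card| then 1 else 0) ≤
      4 * Real.exp (-(m * δ ^ 2 / 2)) := by
  have hP : P.Nonempty := Finset.card_pos.1 (by omega)
  have hK0 : (0 : ℝ) < P.card := by exact_mod_cast Finset.card_pos.2 hP
  have hm0' : (0 : ℝ) < m := by exact_mod_cast hm0
  set b := (∑ a ∈ P, x a) / P.card with hb
  have hb0 : 0 ≤ b := div_nonneg (Finset.sum_nonneg fun a _ => hx0 a) hK0.le
  have hbM : b ≤ M := by
    rw [hb, div_le_iff₀ hK0, mul_comm, ← nsmul_eq_mul]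
    exact Finset.sum_le_card_nsmul _ _ _ fun a _ => hx a
  have hz : ∀ a ∈ P, |x a - b| ≤ M := fun a _ => abs_le.2
    ⟨by linarith [hx0 a], by linarith [hx a]⟩
  have hz' : ∀ a ∈ P, |b - x a| ≤ M := fun a ha => abs_sub_comm b (x a) ▸ hz a ha
  have hs : ∑ a ∈ P, (x a - b) = 0 := by
    rw [Finset.sum_sub_distrib, Finset.sum_const, nsmul_eq_mul, hb, mul_div_cancel₀ _ hK0.ne',
      sub_self]
  have hs' : ∑ a ∈ P, (b - x a) = 0 := by
    rw [Finset.sum_sub_distrib] at hs ⊢; linarith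
  have t1 := mean_sample_tail_le hM hz hs hδ hm hK hP
  have t2 := mean_sample_tail_le hM hz' hs' hδ hm hK hP
  have hne : (Finset.powersetCard m P).Nonempty := Finset.powersetCard_nonempty.2 hm
  refine le_trans ?_ ((add_le_add t1 t2).trans (by linarith))
  rw [← mean_add]
  refine mean_mono fun T hT => ?_
  have hTm : T.card = m := (Finset.mem_powersetCard.1 (mem_of_mem_support_uniform hne hT)).2
  have e1 : ∑ a ∈ T, (x a - b) = m * ((∑ a ∈ T, x a) / T.card - b) := by
    rw [Finset.sum_sub_distrib, Finset.sum_const, nsmul_eq_mul, hTm]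
    field_simp
  have e2 : ∑ a ∈ T, (b - x a) = -(m * ((∑ a ∈ T, x a) / T.card - b)) := by
    rw [← e1, ← Finset.sum_neg_distrib]; simp
  rw [e1, e2]
  split_ifs with h1 h2 h3 h3 h2 h3 <;> try norm_num
  rw [lt_abs] at h1
  rcases h1 with h1 | h1
  · refine h2 ?_
    rw [mul_assoc]; gcongr
  · refine h3 ?_
    rw [mul_assoc, ← mul_neg]; gcongr

end sampling

/-! ### Concentration of the noise -/

section noise
variable {Ω ι : Type*} [MeasurableSpace Ω] {P : Measure Ω}
  {D : Measure ℝ} {ν α : ℝ} {ξ : ι → Ω → ℝ}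

theorem IsNoise.mgf_le (hD : IsNoise D ν α) {X : Ω → ℝ} (hX : HasLaw X D P) {w l : ℝ}
    (hl : α * |l * w| ≤ 1) :
    Integrable (fun ω => Real.exp (l * (w * (X ω - 1)))) P ∧
      mgf (fun ω => w * (X ω - 1)) P l ≤ Real.exp (ν ^ 2 * (l * w) ^ 2 / 2) := by
  obtain ⟨h1, h2⟩ := hD.subExp (l * w) hl
  rw [hD.mean] at h1 h2
  have e : ∀ x : ℝ, l * (w * (x - 1)) = l * w * (x - 1) := fun x => by ring
  have hm : AEStronglyMeasurable (fun x : ℝ => Real.exp (l * w * (x - 1))) D := h1.1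
  simp only [mgf, e]
  constructor
  · rw [← hX.map_eq] at h1
    exact h1.comp_aemeasurable hX.aemeasurable
  · have := hX.integral_comp hm
    simp only [Function.comp_def] at this
    rw [this]
    exact h2

variable [IsProbabilityMeasure P]

theorem noise_tail_le (hD : IsNoise D ν α) (hν : 0 < ν) (hα : 0 ≤ α) (hξ : iIndepFun ξ P)
    (hlaw : ∀ i, HasLaw (ξ i) D P) (hmeas : ∀ i, Measurable (ξ i)) (I : Finset ι) {w : ι → ℝ}
    {M δ : ℝ} (hM : 0 < M) (hw : ∀ i, |w i| ≤ M) (hδ : 0 ≤ δ) (hαδ : α * δ ≤ ν ^ 2) :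
    P.real {ω | I.card * δ * M ≤ ∑ i ∈ I, w i * (ξ i ω - 1)} ≤
      Real.exp (-(I.card * δ ^ 2 / (2 * ν ^ 2))) := by
  -- The optimal Chernoff parameter. All arguments l·w i are at most δ/ν² in absolute value, so α·δ
  -- ≤ ν² keeps them in the range where the moment bound is assumed.
  set l := δ / (ν ^ 2 * M) with hl
  have hl0 : 0 ≤ l := by positivity
  have hlM : l * M = δ / ν ^ 2 := by rw [hl]; field_simp
  have hlw : ∀ i, |l * w i| ≤ δ / ν ^ 2 := fun i => by
    rw [abs_mul, abs_of_nonneg hl0, ← hlM]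
    exact mul_le_mul_of_nonneg_left (hw i) hl0
  have hcond : ∀ i, α * |l * w i| ≤ 1 := fun i => by
    calc α * |l * w i| ≤ α * (δ / ν ^ 2) := mul_le_mul_of_nonneg_left (hlw i) hα
      _ = α * δ / ν ^ 2 := by ring
      _ ≤ 1 := by rw [div_le_one (by positivity)]; exact hαδ
  set Y : ι → Ω → ℝ := fun i ω => w i * (ξ i ω - 1) with hY
  have hYm : ∀ i, Measurable (Y i) := fun i => ((hmeas i).sub_const 1).const_mul (w i)
  have hYi : iIndepFun Y P :=
    hξ.comp (fun i x => w i * (x - 1)) fun i => (measurable_id.sub_const 1).const_mul (w i)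
  have hint : Integrable (fun ω => Real.exp (l * (∑ i ∈ I, Y i) ω)) P :=
    hYi.integrable_exp_mul_sum hYm fun i _ => (hD.mgf_le (hlaw i) (hcond i)).1
  have h1 := measure_ge_le_exp_mul_mgf (X := ∑ i ∈ I, Y i) (I.card * δ * M) hl0 hint
  rw [hYi.mgf_sum hYm] at h1
  have h2 : ∏ i ∈ I, mgf (Y i) P l ≤ ∏ _i ∈ I, Real.exp (δ ^ 2 / (2 * ν ^ 2)) := by
    refine Finset.prod_le_prod (fun i _ => mgf_nonneg) fun i _ => ?_
    refine (hD.mgf_le (hlaw i) (hcond i)).2.trans (Real.exp_le_exp.2 ?_)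
    have h3 : (l * w i) ^ 2 ≤ (δ / ν ^ 2) ^ 2 := by
      rw [← sq_abs]
      gcongr
      exact hlw i
    calc ν ^ 2 * (l * w i) ^ 2 / 2 ≤ ν ^ 2 * (δ / ν ^ 2) ^ 2 / 2 := by gcongr
      _ = _ := by field_simp
  rw [Finset.prod_const, ← Real.exp_nat_mul] at h2
  have hset : {ω | I.card * δ * M ≤ ∑ i ∈ I, w i * (ξ i ω - 1)} =
      {ω | I.card * δ * M ≤ (∑ i ∈ I, Y i) ω} := by
    ext ω; simp [hY]
  rw [hset]
  calc _ ≤ Real.exp (-l * (I.card * δ * M)) * Real.exp (I.card * (δ ^ 2 / (2 * ν ^ 2))) :=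
        h1.trans (by gcongr)
    _ = _ := by
      rw [← Real.exp_add]
      congr 1
      have : -l * (I.card * δ * M) = -(I.card * δ * (l * M)) := by ring
      rw [this, hlM]
      field_simp
      ring

theorem noise_abs_le (hD : IsNoise D ν α) (hν : 0 < ν) (hα : 0 ≤ α) (hξ : iIndepFun ξ P)
    (hlaw : ∀ i, HasLaw (ξ i) D P) (hmeas : ∀ i, Measurable (ξ i)) (I : Finset ι) {w : ι → ℝ}
    {M δ : ℝ} (hM : 0 < M) (hw : ∀ i, |w i| ≤ M) (hδ : 0 ≤ δ) (hαδ : α * δ ≤ ν ^ 2) :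
    P.real {ω | I.card * δ * M ≤ |∑ i ∈ I, w i * (ξ i ω - 1)|} ≤
      2 * Real.exp (-(I.card * δ ^ 2 / (2 * ν ^ 2))) := by
  have h1 := noise_tail_le hD hν hα hξ hlaw hmeas I hM hw hδ hαδ
  have h2 := noise_tail_le (w := fun i => -w i) hD hν hα hξ hlaw hmeas I hM
    (fun i => by rw [abs_neg]; exact hw i) hδ hαδ
  have hsub : {ω | I.card * δ * M ≤ |∑ i ∈ I, w i * (ξ i ω - 1)|} ⊆
      {ω | I.card * δ * M ≤ ∑ i ∈ I, w i * (ξ i ω - 1)} ∪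
        {ω | I.card * δ * M ≤ ∑ i ∈ I, -w i * (ξ i ω - 1)} := by
    intro ω hω
    simp only [Set.mem_ofPred_eq, Set.mem_union, le_abs, neg_mul, Finset.sum_neg_distrib] at hω ⊢
    exact hω
  calc _ ≤ _ := measureReal_mono hsub
    _ ≤ _ := measureReal_union_le _ _
    _ ≤ _ := by linarith

end noise

/-! ### The parameters in the asymptotic regime -/

section params
variable {n : ℕ} {ν ε : ℝ}

theorem le_paramM (n : ℕ) (ν ε : ℝ) :
    max 2 (8 * ν ^ 2) * ((n : ℝ) / ε) ^ 2 * ((n : ℝ) + (Nat.clog 2 (4 * n) : ℝ)) ≤ paramM n ν ε :=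
  Nat.le_ceil _

theorem two_le_paramM (hn : 0 < n) (hε : 0 < ε) (hε1 : ε ≤ 1) : 2 ≤ paramM n ν ε := by
  have hn1 : (1 : ℝ) ≤ n := by exact_mod_cast hn
  have h1 : (1 : ℝ) ≤ (n : ℝ) / ε := by rw [le_div_iff₀ hε]; linarith
  have h2 : (2 : ℝ) * 1 ^ 2 * 1 ≤
      max 2 (8 * ν ^ 2) * ((n : ℝ) / ε) ^ 2 * ((n : ℝ) + (Nat.clog 2 (4 * n) : ℝ)) := by
    have : (0 : ℝ) ≤ Nat.clog 2 (4 * n) := Nat.cast_nonneg _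
    gcongr
    · exact le_max_left _ _
    · linarith
  have := h2.trans (le_paramM n ν ε)
  norm_num at this
  exact_mod_cast this

/-- If m > 2 then t ≥ 4, so C(t²,t) ≥ t^t ≥ 4^t = (2^t)² ≥ (4m)². The remaining case m = 2 has t = 3
and C(9,3) = 84. -/
theorem two_mul_paramM_sq_le (hn : 0 < n) (hε : 0 < ε) (hε1 : ε ≤ 1) :
    2 * paramM n ν ε ^ 2 ≤ (paramH n ν ε).choose (paramT n ν ε) := by
  have hm := two_le_paramM (ν := ν) hn hε hε1
  have h1 : 4 * paramM n ν ε ≤ 2 ^ paramT n ν ε := Nat.le_pow_clog (by norm_num) _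
  rcases Nat.lt_or_ge 2 (paramM n ν ε) with h3 | h3
  · have ht : 4 ≤ paramT n ν ε := (Nat.lt_clog_iff_pow_lt (by norm_num)).2 (by omega)
    rw [paramH, sq (paramT n ν ε)]
    refine le_trans ?_ (pow_le_choose_mul _ _ (by omega))
    refine le_trans ?_ (Nat.pow_le_pow_left ht _)
    have : (4 : ℕ) ^ paramT n ν ε = (2 ^ paramT n ν ε) ^ 2 := by
      rw [← pow_mul, mul_comm, pow_mul]; norm_num
    rw [this]
    nlinarith
  · have hm2 : paramM n ν ε = 2 := by omega
    have ht : paramT n ν ε = 3 := by rw [paramT, hm2]; norm_num [Nat.clog]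
    rw [paramH, ht, hm2]
    decide

/-- The constant in the lower bound for `n`. -/
def logConst (ν : ℝ) : ℝ := 1 + (Real.log (24 * max 2 (8 * ν ^ 2)) + 3) / Real.log 2

theorem one_le_logConst (ν : ℝ) : 1 ≤ logConst ν := by
  have h1 : (1 : ℝ) ≤ 24 * max 2 (8 * ν ^ 2) := by linarith [le_max_left 2 (8 * ν ^ 2)]
  have h2 := Real.log_nonneg h1
  have h3 : 0 < Real.log 2 := Real.log_pos (by norm_num)
  have : 0 ≤ (Real.log (24 * max 2 (8 * ν ^ 2)) + 3) / Real.log 2 := by positivity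
  unfold logConst
  linarith

/-- With x = n/ε and A = max {2, 8ν²}, one has 4m ≤ 24·A·x³, so t - 1 is at most log₂ of this; log x
≥ 1 absorbs the additive terms into the constant. -/
theorem paramT_le_log (hn : 0 < n) (hε : 0 < ε) (hε1 : ε ≤ 1)
    (hlog : 1 ≤ Real.log ((n : ℝ) / ε)) :
    (paramT n ν ε : ℝ) ≤ logConst ν * Real.log ((n : ℝ) / ε) := by
  have hn1 : (1 : ℝ) ≤ n := by exact_mod_cast hn
  set x := (n : ℝ) / ε with hx
  set A := max 2 (8 * ν ^ 2) with hA
  have hA2 : 2 ≤ A := le_max_left _ _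
  have hnx : (n : ℝ) ≤ x := by rw [hx, le_div_iff₀ hε]; nlinarith
  have hx1 : 1 ≤ x := hn1.trans hnx
  have hc : (Nat.clog 2 (4 * n) : ℝ) ≤ 4 * n := by
    exact_mod_cast Nat.clog_le_of_le_pow (Nat.lt_pow_self (by norm_num)).le
  have hm := two_le_paramM (ν := ν) hn hε hε1
  have h1 : (paramM n ν ε : ℝ) < A * x ^ 2 * ((n : ℝ) + (Nat.clog 2 (4 * n) : ℝ)) + 1 :=
    Nat.ceil_lt_add_one (by positivity)
  have h2 : A * x ^ 2 * ((n : ℝ) + (Nat.clog 2 (4 * n) : ℝ)) ≤ A * x ^ 2 * (5 * x) := by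
    gcongr
    linarith
  have h3 : 1 ≤ A * x ^ 3 := by
    have : 1 ≤ x ^ 3 := one_le_pow₀ hx1
    nlinarith
  have h4 : 4 * (paramM n ν ε : ℝ) ≤ 24 * A * x ^ 3 := by nlinarith
  have h5 : 2 ^ (paramT n ν ε - 1) < 4 * paramM n ν ε :=
    Nat.pow_pred_clog_lt_self (by norm_num) (by omega)
  have h6 : (2 : ℝ) ^ (paramT n ν ε - 1) ≤ 24 * A * x ^ 3 := by
    refine le_trans ?_ h4
    exact_mod_cast h5.le
  have h7 := Real.log_le_log (by positivity) h6
  have hT := two_le_paramT (n := n) (ν := ν) (ε := ε) (by omega)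
  rw [Real.log_pow, Real.log_mul (by positivity) (by positivity), Real.log_pow,
    Nat.cast_sub (by omega)] at h7
  push_cast at h7
  have h8 : 0 < Real.log 2 := Real.log_pos (by norm_num)
  have h9 : 0 ≤ Real.log (24 * A) := Real.log_nonneg (by linarith)
  have h10 : (paramT n ν ε : ℝ) ≤ 1 + (Real.log (24 * A) + 3 * Real.log x) / Real.log 2 := by
    rw [← sub_le_iff_le_add', le_div_iff₀ h8]
    exact h7
  refine h10.trans ?_
  rw [logConst, add_mul, div_mul_eq_mul_div, one_mul]
  gcongr
  nlinarith

/-- The lower bound on n is used only through these two consequences: h = t² ≤ εn bounds the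
smoothing loss, and 1 ≤ εn turns failure terms 1/n into ε. Here n/ε ≥ 8 > e, so the logarithm is at
least 1. -/
theorem param_regime (hn : 0 < n) (hε : 0 < ε) (hε1 : ε ≤ 1 / 8)
    (h : logConst ν ^ 2 * (1 / ε) * Real.log ((n : ℝ) / ε) ^ 2 ≤ n) :
    (paramH n ν ε : ℝ) ≤ ε * n ∧ 1 ≤ ε * n := by
  have hn1 : (1 : ℝ) ≤ n := by exact_mod_cast hn
  have hlog : 1 ≤ Real.log ((n : ℝ) / ε) := by
    rw [Real.le_log_iff_exp_le (by positivity), le_div_iff₀ hε]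
    have := Real.exp_one_lt_d9
    nlinarith
  have h1 := paramT_le_log (ν := ν) hn hε (by linarith) hlog
  have h2 := one_le_logConst ν
  have h3 : logConst ν ^ 2 * Real.log ((n : ℝ) / ε) ^ 2 ≤ ε * n := by
    have := mul_le_mul_of_nonneg_left h hε.le
    have e : ε * (logConst ν ^ 2 * (1 / ε) * Real.log ((n : ℝ) / ε) ^ 2) =
        logConst ν ^ 2 * Real.log ((n : ℝ) / ε) ^ 2 := by field_simp
    linarith
  constructor
  · rw [paramH]
    push_cast
    refine le_trans ?_ h3
    rw [← mul_pow]
    gcongr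
  · refine le_trans ?_ h3
    rw [← mul_pow]
    exact one_le_pow₀ (by nlinarith)

/-- The summand n in the exponent pays for the union bound over 2^n sets and the summand ⌈log₂ 4n⌉
for the factor 4n, both through 2 ≤ e. -/
theorem two_pow_mul_exp_le (hn : 0 < n) {E : ℝ}
    (hE : (n : ℝ) + (Nat.clog 2 (4 * n) : ℝ) ≤ E) :
    2 ^ n * Real.exp (-E) ≤ 1 / (4 * n) := by
  have he : (2 : ℝ) ≤ Real.exp 1 := by
    have := Real.add_one_le_exp (1 : ℝ); linarith
  have h1 : ∀ k : ℕ, (2 : ℝ) ^ k ≤ Real.exp k := fun k => by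
    rw [← mul_one (k : ℝ), Real.exp_nat_mul]
    gcongr
  have h2 : (4 * n : ℝ) ≤ Real.exp (Nat.clog 2 (4 * n)) := by
    refine le_trans ?_ (h1 _)
    exact_mod_cast Nat.le_pow_clog (by norm_num) (4 * n)
  have hn0 : (0 : ℝ) < 4 * n := by positivity
  rw [le_div_iff₀ hn0]
  calc 2 ^ n * Real.exp (-E) * (4 * n)
      ≤ Real.exp n * Real.exp (-E) * Real.exp (Nat.clog 2 (4 * n)) := by
        gcongr
        exact h1 n
    _ = Real.exp ((n : ℝ) + (Nat.clog 2 (4 * n) : ℝ) - E) := by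
        rw [← Real.exp_add, ← Real.exp_add]; congr 1; ring
    _ ≤ 1 := by rw [Real.exp_le_one_iff]; linarith

end params

/-! ### The surrogate function -/

section surrogate
variable {n : ℕ} {f : Finset (Fin n) → ℝ}

theorem surrogate_nonneg (hf0 : ∀ S, 0 ≤ f S) (T : Finset (Finset (Fin n))) (S : Finset (Fin n)) :
    0 ≤ surrogate f T S :=
  div_nonneg (Finset.sum_nonneg fun _ _ => hf0 _) (Nat.cast_nonneg _)

theorem surrogate_le {M : ℝ} (hM : 0 ≤ M) (hf : ∀ S, f S ≤ M) (T : Finset (Finset (Fin n)))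
    (S : Finset (Fin n)) : surrogate f T S ≤ M := by
  unfold surrogate
  rcases T.eq_empty_or_nonempty with rfl | hT
  · simpa using hM
  · rw [div_le_iff₀ (by exact_mod_cast Finset.card_pos.2 hT), mul_comm, ← nsmul_eq_mul]
    exact Finset.sum_le_card_nsmul _ _ _ fun _ _ => hf _

theorem Submodular.surrogate (hf : Submodular f) (T : Finset (Finset (Fin n))) :
    Submodular (surrogate f T) := by
  intro A B hAB x hx
  simp only [NoisySubmodular.surrogate]
  rw [← sub_div, ← sub_div, ← Finset.sum_sub_distrib, ← Finset.sum_sub_distrib]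
  exact div_le_div_of_nonneg_right
    (Finset.sum_le_sum fun H' _ => hf.comp_union H' A B hAB x hx) (Nat.cast_nonneg _)

theorem mean_uniform_eq_surrogate {T : Finset (Finset (Fin n))} (hT : T.Nonempty)
    (S : Finset (Fin n)) : mean (uniform T) (fun H' => f (S ∪ H')) = surrogate f T S := by
  rw [mean_uniform hT, surrogate]

/-- The fresh set H' is independent of S given H, so averaging over it turns f into the full
smoothed function: the subroutine sees a sampled noisy oracle but is judged by the exact average. -/
theorem expect_metaAlgorithm {h t m : ℕ} (hh : h ≤ n) (ht : t ≤ h) (g : Finset (Fin n) → ℝ)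
    (A : (Finset (Fin n) → ℝ) → Finset (Fin n) → PMF (Finset (Fin n))) :
    expect (metaAlgorithm A h t m g) f =
      mean (uniform (Finset.powersetCard h Finset.univ)) fun H =>
        mean (uniform (Finset.powersetCard m (Finset.powersetCard t H))) fun T =>
          mean (A (surrogate g T) (Finset.univ \ H)) (surrogate f (Finset.powersetCard t H)) := by
  rw [metaAlgorithm, if_pos hh]
  change mean _ f = _
  simp only [mean_bind, mean_pure]
  have hne : (Finset.powersetCard h (Finset.univ : Finset (Fin n))).Nonempty :=
    Finset.powersetCard_nonempty.2 (by simpa using hh)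
  have key : ∀ H ∈ (uniform (Finset.powersetCard h (Finset.univ : Finset (Fin n)))).support,
      (mean (uniform (Finset.powersetCard m (Finset.powersetCard t H))) fun T =>
        mean (A (surrogate g T) (Finset.univ \ H)) fun S =>
          mean (uniform (Finset.powersetCard t H)) fun H' => f (S ∪ H')) =
      mean (uniform (Finset.powersetCard m (Finset.powersetCard t H))) fun T =>
          mean (A (surrogate g T) (Finset.univ \ H)) (surrogate f (Finset.powersetCard t H)) := by
    intro H hH
    have hc := (Finset.mem_powersetCard.1 (mem_of_mem_support_uniform hne hH)).2
    have hne' : (Finset.powersetCard t H).Nonempty :=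
      Finset.powersetCard_nonempty.2 (by omega)
    simp only [mean_uniform_eq_surrogate hne']
  exact le_antisymm (mean_mono fun H hH => (key H hH).le) (mean_mono fun H hH => (key H hH).ge)

end surrogate

/-! ### Measurability -/

section measurability
variable {Ω : Type*} [MeasurableSpace Ω] {n : ℕ}

/-- The acceptance probability is discontinuous in the oracle values but piecewise rational; the
mean is built from such terms by sums and products along the list. -/
theorem measurable_mean_doubleGreedyFrom {F : Ω → Finset (Fin n) → ℝ}
    (hF : ∀ S, Measurable fun ω => F ω S) (φ : Finset (Fin n) → ℝ) (l : List (Fin n))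
    (X Y : Finset (Fin n)) : Measurable fun ω => mean (doubleGreedyFrom (F ω) l X Y) φ := by
  induction l generalizing X Y with
  | nil => simp only [doubleGreedyFrom, mean_pure]; exact measurable_const
  | cons u l ih =>
    simp only [doubleGreedyFrom, mean_bind]
    simp only [mean_coin (acceptProb_nonneg _ _) (acceptProb_le_one _ _), if_true,
      Bool.false_eq_true, if_false]
    have ha : Measurable fun ω => F ω (insert u X) - F ω X := (hF _).sub (hF _)
    have hb : Measurable fun ω => F ω (Y.erase u) - F ω Y := (hF _).sub (hF _)
    have hp : Measurable fun ω => acceptProb (F ω (insert u X) - F ω X)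
        (F ω (Y.erase u) - F ω Y) := by
      unfold acceptProb
      refine Measurable.ite ((measurableSet_lt measurable_const ha).inter
        (measurableSet_lt measurable_const hb)) (ha.div (ha.add hb)) ?_
      exact Measurable.ite (measurableSet_lt measurable_const ha) measurable_const measurable_const
    exact (hp.mul (ih _ _)).add ((measurable_const.sub hp).mul (ih _ _))

theorem measurable_surrogate_noisy {f : Finset (Fin n) → ℝ} {ξ : Finset (Fin n) → Ω → ℝ}
    (hξ : ∀ S, Measurable (ξ S)) (T : Finset (Finset (Fin n))) (S : Finset (Fin n)) :
    Measurable fun ω => surrogate (noisy f fun S => ξ S ω) T S := by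
  unfold surrogate noisy
  exact (Finset.measurable_sum _ fun H' _ => (hξ _).mul_const _).div_const _

theorem measurable_mean {β : Type*} [Fintype β] (p : PMF β) {φ : Ω → β → ℝ}
    (hφ : ∀ a, Measurable fun ω => φ ω a) : Measurable fun ω => mean p (φ ω) := by
  unfold mean
  exact Finset.measurable_sum _ fun a _ => (hφ a).const_mul _

theorem integral_mean {β : Type*} [Fintype β] (p : PMF β) {P : Measure Ω} {φ : Ω → β → ℝ}
    (hφ : ∀ a, Integrable (fun ω => φ ω a) P) :
    ∫ ω, mean p (φ ω) ∂P = mean p fun a => ∫ ω, φ ω a ∂P := by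
  unfold mean
  rw [integral_finsetSum _ fun a _ => (hφ a).const_mul _]
  simp only [integral_const_mul]

theorem measurable_expect {f φ : Finset (Fin n) → ℝ} {ξ : Finset (Fin n) → Ω → ℝ}
    (hξ : ∀ S, Measurable (ξ S)) (ν ε : ℝ) :
    Measurable fun ω => expect (noisyDoubleGreedy n ν ε (noisy f fun S => ξ S ω)) φ := by
  change Measurable fun ω => mean (noisyDoubleGreedy n ν ε (noisy f fun S => ξ S ω)) φ
  simp only [noisyDoubleGreedy, metaAlgorithm]
  split_ifs
  · simp only [mean_bind]
    exact measurable_mean _ fun H => measurable_mean _ fun T =>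
      measurable_mean_doubleGreedyFrom (measurable_surrogate_noisy hξ T) _ _ _ _
  · exact measurable_const

end measurability

/-! ### The approximation guarantee -/

section guarantee
variable {n : ℕ}

theorem mean_nonneg {β : Type*} [Fintype β] (p : PMF β) {f : β → ℝ} (hf : ∀ a, 0 ≤ f a) :
    0 ≤ mean p f :=
  Finset.sum_nonneg fun a _ => mul_nonneg ENNReal.toReal_nonneg (hf a)

theorem mean_le {β : Type*} [Fintype β] (p : PMF β) {f : β → ℝ} {M : ℝ} (hf : ∀ a, f a ≤ M) :
    mean p f ≤ M := by
  rw [← mean_const p M]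
  exact mean_mono fun a _ => hf a

/-- The number of subsets of `G` on which `F` and `F'` differ by more than `η`. -/
def deviations (G : Finset (Fin n)) (η : ℝ) (F F' : Finset (Fin n) → ℝ) : ℝ :=
  ∑ S ∈ G.powerset, if η < |F' S - F S| then 1 else 0

theorem deviations_nonneg (G : Finset (Fin n)) (η : ℝ) (F F' : Finset (Fin n) → ℝ) :
    0 ≤ deviations G η F F' :=
  Finset.sum_nonneg fun _ _ => by split_ifs <;> norm_num

theorem deviations_le (G : Finset (Fin n)) (η : ℝ) (F F' : Finset (Fin n) → ℝ) :
    deviations G η F F' ≤ G.powerset.card := by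
  rw [deviations, Finset.sum_boole]
  exact_mod_cast Finset.card_filter_le _ _

theorem one_le_deviations {G S : Finset (Fin n)} {η : ℝ} {F F' : Finset (Fin n) → ℝ} (hS : S ⊆ G)
    (h : η < |F' S - F S|) : 1 ≤ deviations G η F F' := by
  have := Finset.single_le_sum (s := G.powerset)
    (f := fun S => if η < |F' S - F S| then (1 : ℝ) else 0)
    (fun _ _ => by split_ifs <;> norm_num) (Finset.mem_powerset.2 hS)
  rw [if_pos h] at this
  exact this

theorem card_powerset_le (G : Finset (Fin n)) : (G.powerset.card : ℝ) ≤ 2 ^ n := by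
  rw [Finset.card_powerset]
  push_cast
  exact pow_le_pow_right₀ (by norm_num) (card_fin_le G)

/-- Counting bad sets replaces conditioning on a good event. If there is a bad set, the subtracted
term is at least M ≥ F(O) and the bound is trivial; the union bound becomes linearity of
expectation. -/
theorem two_mul_mean_doubleGreedy_ge_of_deviations {F F₁ F' : Finset (Fin n) → ℝ}
    (hF : Submodular F) (hF0 : ∀ S, 0 ≤ F S) {M η₁ η₂ : ℝ} (hM : ∀ S, F S ≤ M) (hη₁ : 0 ≤ η₁)
    (hη₂ : 0 ≤ η₂) {G O : Finset (Fin n)} (hO : O ⊆ G) :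
    F O - 3 * (η₁ + η₂) * n - M * (deviations G η₁ F F₁ + deviations G η₂ F₁ F') ≤
      2 * mean (doubleGreedy F' G) F := by
  have hM0 : 0 ≤ M := (hF0 O).trans (hM O)
  have h1 := deviations_nonneg G η₁ F F₁
  have h2 := deviations_nonneg G η₂ F₁ F'
  by_cases h : ∀ S ⊆ G, |F₁ S - F S| ≤ η₁ ∧ |F' S - F₁ S| ≤ η₂
  · have h3 := two_mul_mean_doubleGreedy_ge hF hF0 (F' := F') (η := η₁ + η₂) (G := G)
      (fun S hS => by
        have e : F' S - F S = (F₁ S - F S) + (F' S - F₁ S) := by ring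
        rw [e]
        exact (abs_add_le _ _).trans (add_le_add (h S hS).1 (h S hS).2)) hO
    have := mul_nonneg hM0 (add_nonneg h1 h2)
    linarith
  · push Not at h
    obtain ⟨S, hS, h⟩ := h
    have h3 : 1 ≤ deviations G η₁ F F₁ + deviations G η₂ F₁ F' := by
      by_cases h4 : |F₁ S - F S| ≤ η₁
      · linarith [one_le_deviations hS (h h4)]
      · linarith [one_le_deviations hS (not_le.1 h4)]
    have h4 := mean_nonneg (doubleGreedy F' G) hF0
    have h5 : 0 ≤ 3 * (η₁ + η₂) * n := by positivity
    have := hM O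
    nlinarith

/-- The expected number of sets whose average over all samples is badly approximated. -/
theorem mean_deviations_sample_le {f : Finset (Fin n) → ℝ} (hf0 : ∀ S, 0 ≤ f S) {M δ : ℝ}
    (hM : 0 < M) (hf : ∀ S, f S ≤ M) (hδ : 0 ≤ δ) {Q : Finset (Finset (Fin n))} {m : ℕ}
    (hm0 : 0 < m) (hm : 2 * m ^ 2 ≤ Q.card) (G : Finset (Fin n)) :
    mean (uniform (Finset.powersetCard m Q))
      (fun T => deviations G (δ * M) (surrogate f Q) (surrogate f T)) ≤
      2 ^ n * (4 * Real.exp (-(m * δ ^ 2 / 2))) := by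
  simp only [deviations]
  rw [mean_sum]
  have hmQ : m ≤ Q.card := by nlinarith
  have h1 : ∀ S ∈ G.powerset, mean (uniform (Finset.powersetCard m Q))
      (fun T => if δ * M < |surrogate f T S - surrogate f Q S| then 1 else 0) ≤
      4 * Real.exp (-(m * δ ^ 2 / 2)) := fun S _ =>
    mean_sample_abs_le (x := fun H' => f (S ∪ H')) hM (fun _ => hf0 _) (fun _ => hf _) hδ hm0 hmQ hm
  refine (Finset.sum_le_card_nsmul _ _ _ h1).trans ?_
  rw [nsmul_eq_mul]
  exact mul_le_mul_of_nonneg_right (card_powerset_le G) (by positivity)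

/-- For S disjoint from H the map A ↦ S ∪ A is injective on subsets of H. The error is therefore a
weighted sum over distinct sets, each with its own independent multiplier. -/
theorem surrogate_noisy_sub (f z : Finset (Fin n) → ℝ) {T : Finset (Finset (Fin n))}
    {S H : Finset (Fin n)} (hT : ∀ A ∈ T, A ⊆ H) (hS : Disjoint S H) :
    surrogate (noisy f z) T S - surrogate f T S =
      (∑ A ∈ T.image (S ∪ ·), f A * (z A - 1)) / T.card := by
  rw [surrogate, surrogate, ← sub_div, ← Finset.sum_sub_distrib, Finset.sum_image]
  · congr 1
    refine Finset.sum_congr rfl fun A _ => ?_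
    rw [noisy]; ring
  · intro A hA B hB hAB
    have hA' := hS.mono_right (hT A hA)
    have hB' := hS.mono_right (hT B hB)
    rw [← Finset.union_sdiff_cancel_left hA', ← Finset.union_sdiff_cancel_left hB']
    exact congrArg (· \ S) hAB

theorem card_image_union {T : Finset (Finset (Fin n))} {S H : Finset (Fin n)}
    (hT : ∀ A ∈ T, A ⊆ H) (hS : Disjoint S H) : (T.image (S ∪ ·)).card = T.card := by
  refine Finset.card_image_of_injOn ?_
  intro A hA B hB hAB
  have hA' := hS.mono_right (hT A hA)
  have hB' := hS.mono_right (hT B hB)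
  rw [← Finset.union_sdiff_cancel_left hA', ← Finset.union_sdiff_cancel_left hB']
  exact congrArg (· \ S) hAB

variable {Ω : Type*} [MeasurableSpace Ω] {P : Measure Ω} [IsProbabilityMeasure P]
  {D : Measure ℝ} {ν α : ℝ} {ξ : Finset (Fin n) → Ω → ℝ} {f : Finset (Fin n) → ℝ}

theorem measurableSet_deviation (hmeas : ∀ S, Measurable (ξ S)) (η : ℝ)
    (T : Finset (Finset (Fin n))) (S : Finset (Fin n)) :
    MeasurableSet {ω | η < |surrogate (noisy f fun S => ξ S ω) T S - surrogate f T S|} :=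
  measurableSet_lt measurable_const
    (((measurable_surrogate_noisy hmeas T S).sub measurable_const).abs)

theorem measurable_deviations (hmeas : ∀ S, Measurable (ξ S)) (G : Finset (Fin n)) (η : ℝ)
    (T : Finset (Finset (Fin n))) :
    Measurable fun ω => deviations G η (surrogate f T) (surrogate (noisy f fun S => ξ S ω) T) := by
  unfold deviations
  exact Finset.measurable_sum _ fun S _ =>
    Measurable.ite (measurableSet_deviation hmeas η T S) measurable_const measurable_const

/-- The expected number of sets whose sampled average is badly distorted by the noise. -/
theorem integral_deviations_noise_le (hD : IsNoise D ν α) (hν : 0 < ν) (hα : 0 ≤ α)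
    (hξ : iIndepFun ξ P) (hlaw : ∀ S, HasLaw (ξ S) D P) (hmeas : ∀ S, Measurable (ξ S))
    (hf0 : ∀ S, 0 ≤ f S) {M δ : ℝ} (hM : 0 < M) (hf : ∀ S, f S ≤ M) (hδ : 0 ≤ δ)
    (hαδ : α * δ ≤ ν ^ 2) {T : Finset (Finset (Fin n))} {H : Finset (Fin n)} (hT0 : T.Nonempty)
    (hT : ∀ A ∈ T, A ⊆ H) :
    ∫ ω, deviations (Finset.univ \ H) (δ * M) (surrogate f T)
      (surrogate (noisy f fun S => ξ S ω) T) ∂P ≤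
      2 ^ n * (2 * Real.exp (-(T.card * δ ^ 2 / (2 * ν ^ 2)))) := by
  have hT1 : (0 : ℝ) < T.card := by exact_mod_cast Finset.card_pos.2 hT0
  simp only [deviations]
  have hind : ∀ S : Finset (Fin n), (fun ω => if δ * M <
      |surrogate (noisy f fun S => ξ S ω) T S - surrogate f T S| then (1 : ℝ) else 0) =
      Set.indicator {ω | δ * M < |surrogate (noisy f fun S => ξ S ω) T S - surrogate f T S|}
        (fun _ => 1) := by
    intro S; ext ω; simp [Set.indicator_apply]
  rw [integral_finsetSum]
  · have h1 : ∀ S ∈ (Finset.univ \ H).powerset, ∫ ω, (if δ * M <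
        |surrogate (noisy f fun S => ξ S ω) T S - surrogate f T S| then (1 : ℝ) else 0) ∂P ≤
        2 * Real.exp (-(T.card * δ ^ 2 / (2 * ν ^ 2))) := by
      intro S hS
      have hdis : Disjoint S H :=
        Finset.disjoint_of_subset_left (Finset.mem_powerset.1 hS) Finset.sdiff_disjoint
      rw [hind, integral_indicator_const _ (measurableSet_deviation hmeas _ T S), smul_eq_mul,
        mul_one]
      have h2 := noise_abs_le hD hν hα hξ hlaw hmeas (T.image (S ∪ ·)) (w := f) hM
        (fun A => by rw [abs_of_nonneg (hf0 A)]; exact hf A) hδ hαδ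
      rw [card_image_union hT hdis] at h2
      refine le_trans (measureReal_mono ?_) h2
      intro ω hω
      simp only [Set.mem_ofPred_eq] at hω ⊢
      rw [surrogate_noisy_sub f _ hT hdis, abs_div, Nat.abs_cast, lt_div_iff₀ hT1] at hω
      linarith
    refine (Finset.sum_le_card_nsmul _ _ _ h1).trans ?_
    rw [nsmul_eq_mul]
    exact mul_le_mul_of_nonneg_right (card_powerset_le _) (by positivity)
  · intro S _
    rw [hind]
    exact (integrable_const _).indicator (measurableSet_deviation hmeas _ T S)

theorem integrable_expect (hmeas : ∀ S, Measurable (ξ S)) (hf0 : ∀ S, 0 ≤ f S) (ν ε : ℝ) :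
    Integrable (fun ω => expect (noisyDoubleGreedy n ν ε (noisy f fun S => ξ S ω)) f) P := by
  refine Integrable.of_bound (measurable_expect hmeas ν ε).aestronglyMeasurable (∑ S, f S)
    (Filter.Eventually.of_forall fun ω => ?_)
  change ‖mean _ f‖ ≤ _
  rw [Real.norm_of_nonneg (mean_nonneg _ hf0)]
  exact mean_le _ fun S => Finset.single_le_sum (fun S _ => hf0 S) (Finset.mem_univ S)

/-- With H fixed, the noise is integrated for each sample T and then T is averaged. The sampling
error depends only on T, so the two error sources never interact. Tolerances δM and δM/2 give
3·(3/2)δMn = (9/2)δMn. -/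
theorem integral_mean_doubleGreedy_ge (hD : IsNoise D ν α) (hν : 0 < ν) (hα : 0 ≤ α)
    (hξ : iIndepFun ξ P) (hlaw : ∀ S, HasLaw (ξ S) D P) (hmeas : ∀ S, Measurable (ξ S))
    (hf0 : ∀ S, 0 ≤ f S) (hsub : Submodular f) {M δ : ℝ} (hM : 0 < M) (hf : ∀ S, f S ≤ M)
    (hδ : 0 ≤ δ) (hαδ : α * (δ / 2) ≤ ν ^ 2) {H O : Finset (Fin n)} {t m : ℕ} (hm0 : 0 < m)
    (hm : 2 * m ^ 2 ≤ (Finset.powersetCard t H).card) :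
    surrogate f (Finset.powersetCard t H) ((Finset.univ \ H) ∩ O) - 9 / 2 * δ * M * n
      - M * (2 ^ n * (4 * Real.exp (-(m * δ ^ 2 / 2))) +
        2 ^ n * (2 * Real.exp (-(m * (δ / 2) ^ 2 / (2 * ν ^ 2))))) ≤
    2 * ∫ ω, mean (uniform (Finset.powersetCard m (Finset.powersetCard t H))) (fun T =>
      mean (doubleGreedy (surrogate (noisy f fun S => ξ S ω) T) (Finset.univ \ H))
        (surrogate f (Finset.powersetCard t H))) ∂P := by
  set Q := Finset.powersetCard t H with hQ
  set F := surrogate f Q with hF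
  set G := Finset.univ \ H with hG
  have hF0 : ∀ S, 0 ≤ F S := surrogate_nonneg hf0 Q
  have hFM : ∀ S, F S ≤ M := surrogate_le hM.le hf Q
  have hint : ∀ T : Finset (Finset (Fin n)), Integrable (fun ω =>
      mean (doubleGreedy (surrogate (noisy f fun S => ξ S ω) T) G) F) P := by
    intro T
    refine Integrable.of_bound (measurable_mean_doubleGreedyFrom
      (measurable_surrogate_noisy hmeas T) _ _ _ _).aestronglyMeasurable M
      (Filter.Eventually.of_forall fun ω => ?_)
    rw [Real.norm_of_nonneg (mean_nonneg _ hF0)]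
    exact mean_le _ hFM
  have hint2 : ∀ T : Finset (Finset (Fin n)), Integrable (fun ω =>
      deviations G (δ / 2 * M) (surrogate f T) (surrogate (noisy f fun S => ξ S ω) T)) P := by
    intro T
    refine Integrable.of_bound (measurable_deviations hmeas _ _ _).aestronglyMeasurable
      (G.powerset.card) (Filter.Eventually.of_forall fun ω => ?_)
    rw [Real.norm_of_nonneg (deviations_nonneg _ _ _ _)]
    exact deviations_le _ _ _ _
  have hmQ : m ≤ Q.card := by nlinarith
  have hne : (Finset.powersetCard m Q).Nonempty := Finset.powersetCard_nonempty.2 hmQ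
  rw [integral_mean _ hint, ← mean_const_mul]
  have hstep : ∀ T ∈ (uniform (Finset.powersetCard m Q)).support,
      F (G ∩ O) - 9 / 2 * δ * M * n
        - M * (2 ^ n * (2 * Real.exp (-(m * (δ / 2) ^ 2 / (2 * ν ^ 2))))) -
        M * deviations G (δ * M) F (surrogate f T) ≤
      2 * ∫ ω, mean (doubleGreedy (surrogate (noisy f fun S => ξ S ω) T) G) F ∂P := by
    intro T hT
    obtain ⟨hTQ, hTm⟩ := Finset.mem_powersetCard.1 (mem_of_mem_support_uniform hne hT)
    have hTH : ∀ A ∈ T, A ⊆ H := fun A hA => (Finset.mem_powersetCard.1 (hTQ hA)).1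
    have h1 := integral_deviations_noise_le hD hν hα hξ hlaw hmeas hf0 hM hf (δ := δ / 2)
      (by positivity) hαδ (Finset.card_pos.1 (by omega)) hTH
    rw [hTm] at h1
    rw [← integral_const_mul]
    have h2 : ∫ ω, (F (G ∩ O) - 9 / 2 * δ * M * n - M * deviations G (δ * M) F (surrogate f T)
        - M * deviations G (δ / 2 * M) (surrogate f T) (surrogate (noisy f fun S => ξ S ω) T)) ∂P ≤
        ∫ ω, 2 * mean (doubleGreedy (surrogate (noisy f fun S => ξ S ω) T) G) F ∂P := by
      refine integral_mono ((integrable_const _).sub ((hint2 T).const_mul M)) ((hint T).const_mul 2)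
        fun ω => ?_
      have := two_mul_mean_doubleGreedy_ge_of_deviations (hsub.surrogate Q) hF0 hFM
        (F₁ := surrogate f T) (F' := surrogate (noisy f fun S => ξ S ω) T)
        (mul_nonneg hδ hM.le) (mul_nonneg (div_nonneg hδ two_pos.le) hM.le)
        (Finset.inter_subset_left (s₁ := G) (s₂ := O))
      linarith
    rw [integral_sub (integrable_const _) ((hint2 T).const_mul M), integral_const,
      integral_const_mul] at h2
    simp only [probReal_univ, one_smul] at h2
    have := mul_le_mul_of_nonneg_left h1 hM.le
    linarith
  refine le_trans ?_ (mean_mono hstep)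
  rw [mean_sub, mean_const, mean_const_mul]
  have h3 := mul_le_mul_of_nonneg_left
    (mean_deviations_sample_le hf0 hM hf hδ hm0 hm G) hM.le
  linarith

end guarantee

/-! ### Averaging over the smoothing set and fixing the constants -/

section guarantee
variable {n : ℕ} {Ω : Type*} [MeasurableSpace Ω] {P : Measure Ω} [IsProbabilityMeasure P]
  {D : Measure ℝ} {ν α ε : ℝ} {ξ : Finset (Fin n) → Ω → ℝ} {f : Finset (Fin n) → ℝ}

/-- The guarantee in the non-degenerate case. -/
theorem integral_expect_ge_of_pos (hD : IsNoise D ν α) (hν : 0 < ν) (hα : 0 ≤ α) (hε : 0 < ε)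
    (hεα : ε * α < 2 * ν ^ 2) (hξ : iIndepFun ξ P) (hlaw : ∀ S, HasLaw (ξ S) D P)
    (hmeas : ∀ S, Measurable (ξ S)) (hf0 : ∀ S, 0 ≤ f S) (hsub : Submodular f)
    {O : Finset (Fin n)} (hO : ∀ S, f S ≤ f O) (hn : 0 < n) (hε1 : ε ≤ 1 / 8) (hM : 0 < f O)
    (hlarge : logConst ν ^ 2 * (1 / ε) * Real.log ((n : ℝ) / ε) ^ 2 ≤ n) :
    (1 / 2 - 4 * ε) * f O ≤
      ∫ ω, expect (noisyDoubleGreedy n ν ε (noisy f fun S => ξ S ω)) f ∂P := by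
  obtain ⟨hhε, hnε⟩ := param_regime hn hε hε1 hlarge
  have hn1 : (1 : ℝ) ≤ n := by exact_mod_cast hn
  have hn0 : (0 : ℝ) < n := by linarith
  have hm2 := two_le_paramM (ν := ν) hn hε (by linarith)
  have hmsq := two_mul_paramM_sq_le (ν := ν) hn hε (by linarith)
  have ht2 := two_le_paramT (n := n) (ν := ν) (ε := ε) (by omega)
  have hth := paramT_le_paramH n ν ε
  have hM' := le_paramM n ν ε
  set m := paramM n ν ε with hm
  set t := paramT n ν ε with ht
  set h := paramH n ν ε with hh
  set E : ℝ := (n : ℝ) + (Nat.clog 2 (4 * n) : ℝ) with hE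
  have hE0 : 0 ≤ E := by positivity
  set M := f O with hMdef
  have hhn : h ≤ n := by
    have : (h : ℝ) ≤ n := by nlinarith
    exact_mod_cast this
  -- The factor 2 in m serves the sampling exponent; the factor 8ν² serves the noise exponent below,
  -- where the tolerance is halved.
  have hE1 : E ≤ m * (ε / n) ^ 2 / 2 := by
    have h1 : 2 * ((n : ℝ) / ε) ^ 2 * E ≤ m := by
      refine le_trans ?_ hM'
      gcongr
      exact le_max_left _ _
    have h2 := mul_le_mul_of_nonneg_right h1 (by positivity : 0 ≤ (ε / n) ^ 2 / 2)
    have e : 2 * ((n : ℝ) / ε) ^ 2 * E * ((ε / n) ^ 2 / 2) = E := by field_simp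
    linarith
  have hE2 : E ≤ m * (ε / n / 2) ^ 2 / (2 * ν ^ 2) := by
    have h1 : 8 * ν ^ 2 * ((n : ℝ) / ε) ^ 2 * E ≤ m := by
      refine le_trans ?_ hM'
      gcongr
      exact le_max_right _ _
    have h2 := mul_le_mul_of_nonneg_right h1 (by positivity : 0 ≤ (ε / n / 2) ^ 2 / (2 * ν ^ 2))
    have e : 8 * ν ^ 2 * ((n : ℝ) / ε) ^ 2 * E * ((ε / n / 2) ^ 2 / (2 * ν ^ 2)) = E := by
      field_simp; norm_num; ring
    have e2 : m * ((ε / n / 2) ^ 2 / (2 * ν ^ 2)) = m * (ε / n / 2) ^ 2 / (2 * ν ^ 2) := by ring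
    linarith
  have hexp1 := two_pow_mul_exp_le hn hE1
  have hexp2 := two_pow_mul_exp_le hn hE2
  have hinv : 1 / (4 * (n : ℝ)) ≤ ε / 4 := by
    rw [div_le_div_iff₀ (by positivity) (by norm_num)]; linarith
  -- The place where ε < 2ν²/α is needed.
  have hαδ : α * (ε / n / 2) ≤ ν ^ 2 := by
    have : α * (ε / n / 2) ≤ α * (ε / 2) := by
      gcongr
      exact div_le_self hε.le hn1
    linarith
  have hne : (Finset.powersetCard h (Finset.univ : Finset (Fin n))).Nonempty :=
    Finset.powersetCard_nonempty.2 (by simpa using hhn)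
  have hcard : ∀ H ∈ (uniform (Finset.powersetCard h (Finset.univ : Finset (Fin n)))).support,
      H.card = h := fun H hH => (Finset.mem_powersetCard.1 (mem_of_mem_support_uniform hne hH)).2
  have hstep : ∀ H ∈ (uniform (Finset.powersetCard h (Finset.univ : Finset (Fin n)))).support,
      mean (uniform (Finset.powersetCard t H)) (fun H' => f ((Finset.univ \ H) ∩ O ∪ H'))
        - 6 * ε * M ≤
      2 * ∫ ω, mean (uniform (Finset.powersetCard m (Finset.powersetCard t H))) (fun T =>
        mean (doubleGreedy (surrogate (noisy f fun S => ξ S ω) T) (Finset.univ \ H))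
          (surrogate f (Finset.powersetCard t H))) ∂P := by
    intro H hH
    have hc := hcard H hH
    rw [mean_uniform_eq_surrogate (Finset.powersetCard_nonempty.2 (by omega))]
    have h1 := integral_mean_doubleGreedy_ge (O := O) (t := t) (m := m) (H := H) hD hν hα hξ hlaw
      hmeas hf0 hsub hM hO (δ := ε / n) (by positivity) hαδ (by omega)
      (by rw [Finset.card_powersetCard, hc]; exact hmsq)
    refine le_trans ?_ h1
    have e : 9 / 2 * (ε / n) * M * n = 9 / 2 * ε * M := by field_simp
    rw [e]
    -- (4 + 2)·1/(4n) ≤ 6·ε/4 = 3ε/2; together with the oracle error 9ε/2 this is the 6ε of `hstep`.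
    have h2 : 2 ^ n * (4 * Real.exp (-(m * (ε / n) ^ 2 / 2))) +
        2 ^ n * (2 * Real.exp (-(m * (ε / n / 2) ^ 2 / (2 * ν ^ 2)))) ≤ 3 / 2 * ε := by linarith
    have := mul_le_mul_of_nonneg_left h2 hM.le
    linarith
  have hint : ∀ H : Finset (Fin n), Integrable (fun ω =>
      mean (uniform (Finset.powersetCard m (Finset.powersetCard t H))) (fun T =>
        mean (doubleGreedy (surrogate (noisy f fun S => ξ S ω) T) (Finset.univ \ H))
          (surrogate f (Finset.powersetCard t H)))) P := by
    intro H
    refine Integrable.of_bound (measurable_mean _ fun T => measurable_mean_doubleGreedyFrom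
      (measurable_surrogate_noisy hmeas T) _ _ _ _).aestronglyMeasurable M
      (Filter.Eventually.of_forall fun ω => ?_)
    rw [Real.norm_of_nonneg (mean_nonneg _ fun T => mean_nonneg _ (surrogate_nonneg hf0 _))]
    exact mean_le _ fun T => mean_le _ (surrogate_le hM.le hO _)
  have hsm := mean_smoothing_ge (t := t) hsub hf0 hhn hn (by omega) hth O
  have hfin := mean_mono hstep
  rw [mean_sub, mean_const, mean_const_mul, ← integral_mean _ hint] at hfin
  have hre : ∀ ω, expect (noisyDoubleGreedy n ν ε (noisy f fun S => ξ S ω)) f = _ := fun ω =>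
    expect_metaAlgorithm (f := f) (m := m) hhn hth (noisy f fun S => ξ S ω) doubleGreedy
  simp only [hre]
  have hhn' : (h : ℝ) / n ≤ ε := by rw [div_le_iff₀ hn0]; exact hhε
  have : (1 - ε) * M ≤ (1 - (h : ℝ) / n) * M := by gcongr
  -- Twice the mean is at least (1 - ε)M - 6εM, so 7ε/2 is lost, which 4ε covers.
  nlinarith

theorem integral_expect_ge_of_measurable (hD : IsNoise D ν α) (hν : 0 < ν) (hα : 0 ≤ α)
    (hε : 0 < ε) (hεα : ε * α < 2 * ν ^ 2) (hξ : iIndepFun ξ P) (hlaw : ∀ S, HasLaw (ξ S) D P)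
    (hmeas : ∀ S, Measurable (ξ S)) (hf0 : ∀ S, 0 ≤ f S) (hsub : Submodular f)
    {O : Finset (Fin n)} (hO : ∀ S, f S ≤ f O)
    (hlarge : logConst ν ^ 2 * (1 / ε) * Real.log ((n : ℝ) / ε) ^ 2 ≤ n) :
    (1 / 2 - 4 * ε) * f O ≤
      ∫ ω, expect (noisyDoubleGreedy n ν ε (noisy f fun S => ξ S ω)) f ∂P := by
  have hnn : 0 ≤ ∫ ω, expect (noisyDoubleGreedy n ν ε (noisy f fun S => ξ S ω)) f ∂P :=
    integral_nonneg fun _ => mean_nonneg _ hf0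
  -- For ε ≥ 1/8 the factor 1/2 - 4ε is not positive. For n = 0 there is only one set and f is
  -- constant.
  rcases le_or_gt (1 / 8) ε with hε1 | hε1
  · nlinarith [hf0 O]
  rcases (hf0 O).eq_or_lt with h0 | hM
  · rw [← h0, mul_zero]; exact hnn
  rcases Nat.eq_zero_or_pos n with rfl | hn
  · have hc : f = fun _ => f O := funext fun S => congrArg f (Subsingleton.elim S O)
    have hre : ∀ ω, expect (noisyDoubleGreedy 0 ν ε (noisy f fun S => ξ S ω)) f = f O := fun ω => by
      conv_lhs => arg 2; rw [hc]
      exact mean_const _ _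
    simp only [hre, integral_const, probReal_univ, one_smul]
    nlinarith
  · exact integral_expect_ge_of_pos hD hν hα hε hεα hξ hlaw hmeas hf0 hsub hO hn hε1.le hM hlarge

theorem approximation_guarantee (hD : IsNoise D ν α) (hν : 0 < ν) (hα : 0 ≤ α)
    (hε : 0 < ε) (hεα : ε * α < 2 * ν ^ 2) (hξ : iIndepFun ξ P) (hlaw : ∀ S, HasLaw (ξ S) D P)
    (hf0 : ∀ S, 0 ≤ f S) (hsub : Submodular f) {O : Finset (Fin n)} (hO : ∀ S, f S ≤ f O)
    (hlarge : logConst ν ^ 2 * (1 / ε) * Real.log ((n : ℝ) / ε) ^ 2 ≤ n) :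
    Integrable (fun ω => expect (noisyDoubleGreedy n ν ε (noisy f fun S => ξ S ω)) f) P ∧
    (1 / 2 - 4 * ε) * f O ≤
      ∫ ω, expect (noisyDoubleGreedy n ν ε (noisy f fun S => ξ S ω)) f ∂P := by
  -- The multipliers are only almost everywhere measurable. Measurable versions agree with all of
  -- them off one null set, as there are finitely many sets, and keep laws and independence.
  set ξ' : Finset (Fin n) → Ω → ℝ := fun S => (hlaw S).aemeasurable.mk (ξ S) with hξ'
  have heq : ∀ S, ξ S =ᵐ[P] ξ' S := fun S => (hlaw S).aemeasurable.ae_eq_mk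
  have hmeas : ∀ S, Measurable (ξ' S) := fun S => (hlaw S).aemeasurable.measurable_mk
  have hlaw' : ∀ S, HasLaw (ξ' S) D P := fun S => (hlaw S).congr (heq S).symm
  have hall : (fun ω => expect (noisyDoubleGreedy n ν ε (noisy f fun S => ξ S ω)) f) =ᵐ[P]
      fun ω => expect (noisyDoubleGreedy n ν ε (noisy f fun S => ξ' S ω)) f := by
    filter_upwards [ae_all_iff.2 heq] with ω hω
    simp only [hω]
  rw [integrable_congr hall, integral_congr_ae hall]
  exact ⟨integrable_expect hmeas hf0 ν ε, integral_expect_ge_of_measurable hD hν hα hε hεα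
    (hξ.congr heq) hlaw' hmeas hf0 hsub hO hlarge⟩

end guarantee

end NoisySubmodular

end

theorem theorem4p5 :
    (∃ c : ℝ, 0 < c ∧ ∀ ν : ℝ, 0 < ν → ∃ C : ℝ, 0 < C ∧
      ∀ (α ε : ℝ), 0 ≤ α → 0 < ε → ε * α < 2 * ν ^ 2 →
      ∀ (D : Measure ℝ), NoisySubmodular.IsNoise D ν α →
      ∀ (n : ℕ), C * (1 / ε) * Real.log ((n : ℝ) / ε) ^ 2 ≤ (n : ℝ) →
      ∀ (f : Finset (Fin n) → ℝ), (∀ S, 0 ≤ f S) → NoisySubmodular.Submodular f →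
      ∀ (Ω : Type*) [MeasurableSpace Ω] (P : Measure Ω) [IsProbabilityMeasure P]
        (ξ : Finset (Fin n) → Ω → ℝ), iIndepFun ξ P → (∀ S, HasLaw (ξ S) D P) →
      ∀ Ostar : Finset (Fin n), (∀ S, f S ≤ f Ostar) →
        Integrable (fun ω => NoisySubmodular.expect (NoisySubmodular.noisyDoubleGreedy n ν ε
          (NoisySubmodular.noisy f fun S => ξ S ω)) f) P ∧
        (1 / 2 - c * ε) * f Ostar ≤
          ∫ ω, NoisySubmodular.expect (NoisySubmodular.noisyDoubleGreedy n ν ε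
            (NoisySubmodular.noisy f fun S => ξ S ω)) f ∂P) ∧
    ∃ prog : NoisySubmodular.Program,
      NoisySubmodular.Computes prog NoisySubmodular.noisyDoubleGreedy ∧
      NoisySubmodular.RunsInPolyTime prog := by
  refine ⟨⟨4, by norm_num, fun ν hν => ⟨NoisySubmodular.logConst ν ^ 2, ?_, ?_⟩⟩,
    NoisySubmodular.mainProg, NoisySubmodular.mainProg_computes,
    NoisySubmodular.mainProg_runsInPolyTime⟩
  · have := NoisySubmodular.one_le_logConst ν
    positivity
  · intro α ε hα hε hεα D hD n hn f hf0 hf Ω _ P _ ξ hξ hlaw O hO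
    exact NoisySubmodular.approximation_guarantee hD hν hα hε hεα hξ hlaw hf0 hf hO hn
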